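/- Let $\alpha\neq 0$ and $\beta,\gamma,l,m$ be real numbers. Let $G_{NC}$ be the group of all $g=(\theta,\phi,\psi,\mathbf q,\mathbf p)$ with $\theta,\phi,\psi\in\mathbb R$ and $\mathbf q,\mathbf p\in\mathbb R^2$, with multiplication $$gg'=\Big(\theta+\theta'+\tfrac{\alpha}{2}(\mathbf q\cdot\mathbf p'-\mathbf p\cdot\mathbf q'),\ \phi+\phi'+\tfrac{\beta}{2}\,\mathbf p\wedge\mathbf p',\ \psi+\psi'+\tfrac{\gamma}{2}\,\mathbf q\wedge\mathbf q',\ \mathbf q+\mathbf q',\ \mathbf p+\mathbf p'\Big),$$ where $\mathbf a\wedge\mathbf b=a_1b_2-a_2b_1$. It is unimodular; take the Haar measure $d\mu=\alpha^2\,d\theta\,d\phi\,d\psi\,d\mathbf q\,d\mathbf p$. Let $\mathfrak N_l\subset\mathbb R^3$ be the set of all $(\rho,\sigma,\tau)$ with $\rho,\sigma,\tau\neq0$, $\rho^2\alpha^2-\gamma\beta\sigma\tau\neq0$ and $D:=\tau\gamma\sigma\beta l-\rho^2\alpha^2\neq0$ (the last condition removes only a Lebesgue null set). For $(\rho,\sigma,\tau)\in\mathfrak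 N_l$ let $U^{\rho,\sigma,\tau}_{l,m}$ be the unitary representation of $G_{NC}$ on $L^2(\mathbb R^2,dr_1dr_2)$ given by $$(U^{\rho,\sigma,\tau}_{l,m}(g)f)(r_1,r_2)=e^{i\Phi(g,r)}f\Big(r_1-\tfrac{(1-m)\sigma\beta}{\rho\alpha}p_2+\tfrac{\tau\gamma\sigma\beta(l+m-lm)-\rho^2\alpha^2}{D}q_1,\ r_2+\tfrac{m\sigma\beta}{\rho\alpha}p_1-\tfrac{\tau\gamma\sigma\beta l(1-m)-\rho^2\alpha^2}{\rho^2\alpha^2}q_2\Big),$$ $$\begin{aligned}\Phi(g,r)={}&\rho\theta+\sigma\phi+\tau\psi+\rho\alpha p_1r_1+\rho\alpha p_2r_2+\tfrac{\rho^2\alpha^2\tau\gamma(1-l)}{D}q_1r_2+l\tau\gamma q_2r_1+\Big[\tfrac{\rho\alpha}{2}+\tfrac{\rho\alpha\tau\gamma\sigma\beta m(1-l)}{D}\Big]p_1q_1\\&+\Big[\tfrac{\rho\alpha}{2}-\tfrac{l\tau\gamma\sigma\beta(1-m)}{\rho\alpha}\Big]p_2q_2+(m-\tfrac12)\sigma\beta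 p_1p_2+\Big[\tfrac{\tau\gamma}{2}-\tfrac{\tau\gamma(1-l)(\tau\gamma\sigma\beta l-\tau\gamma\sigma\beta lm-\rho^2\alpha^2)}{D}\Big]q_1q_2.\end{aligned}$$ Write $x=(\rho,\sigma,\tau)$ and $U_x=U^{\rho,\sigma,\tau}_{l,m}$. Let $\nu$ be a measure on $\mathfrak N_l$ and $x\mapsto C_x$ a measurable field of bounded operators on $L^2(\mathbb R^2)$, with measurable field of inverses, which are positive and invertible for $\nu$-almost every $x$. Call $(\nu,C)$ a pair of Plancherel measure and Duflo–Moore operators for $(U_x)$ if both of the following hold. (a) Plancherel formula: $\int_{\mathfrak N_l}\|U_x(f)C_x^{-1}\|_{HS}^2\,d\nu(x)=\int_{G_{NC}}|f|^2\,d\mu$ for all $f\in L^1(G_{NC})\cap L^2(G_{NC})$, where $U_x(f)=\int f(g)U_x(g)\,d\mu(g)$. (b) Orthogonality relation: for a measurable field of operators $x\mapsto A(x)$ with $\int\|A(x)\|^2_{HS}\,d\nu<\infty$ and $\int\|A(x)C_x^{-1}\|_{1}\,d\nu<\infty$ ($\|\cdot\|_1$ being the trace norm), put $F_A(g)=\int\operatorname{tr}(U_x(g)^*A(x)C_x^{-1})\,d\nu(x)$.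 Then $F_A\in L^2(G_{NC},\mu)$ for every such $A$, and for all such $A^1,A^2$ $$\int_{G_{NC}}\overline{F_{A^1}(g)}\,F_{A^2}(g)\,d\mu(g)=\int_{\mathfrak N_l}\operatorname{tr}(A^1(x)^*A^2(x))\,d\nu(x).$$ **Proposition.** For every fixed gauge pair $(l,m)$, $$d\nu(\rho,\sigma,\tau)=\frac{|\rho^2\alpha^2-\gamma\beta\sigma\tau|}{\alpha^2}\,d\rho\,d\sigma\,d\tau,\qquad C_{\rho,\sigma,\tau}=(2\pi)^{5/2}\,\mathbb I$$ is a pair of Plancherel measure and Duflo–Moore operators for the family $(U^{\rho,\sigma,\tau}_{l,m})$. Moreover, each member of the pair determines the other: this $\nu$ is the only measure on $\mathfrak N_l$ that forms such a pair with the operators $(2\pi)^{5/2}\mathbb I$, and any field $C$ that forms such a pair with this $\nu$ equals $(2\pi)^{5/2}\mathbb I$ almost everywhere. In particular the density and the operators do not depend on $(l,m)$. -/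

import Mathlib

open MeasureTheory
open scoped ENNReal InnerProductSpace

noncomputable section

/-! ## Traces and Hilbert–Schmidt norms -/

section Operators

variable (H : Type*) [NormedAddCommGroup H] [InnerProductSpace ℂ H] [CompleteSpace H]

/-- The index set of a chosen orthonormal basis of `H`. -/
def chosenIndex : Set H := (exists_hilbertBasis ℂ H).choose

/-- A chosen orthonormal (Hilbert) basis of `H`. -/
def chosenBasis : HilbertBasis (chosenIndex H) ℂ H :=
  (exists_hilbertBasis ℂ H).choose_spec.choose

variable {H}

/-- The trace `∑ᵢ ⟪eᵢ, T eᵢ⟫`. It is only used for trace class operators, where the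
sum converges absolutely and does not depend on the basis. -/
def opTrace (T : H →L[ℂ] H) : ℂ :=
  ∑' i, ⟪chosenBasis H i, T (chosenBasis H i)⟫_ℂ

/-- The squared Hilbert–Schmidt norm `∑ᵢ ‖T eᵢ‖²`, with values in `[0, ∞]`. -/
def hsNormSq (T : H → H) : ℝ≥0∞ :=
  ∑' i, ‖T (chosenBasis H i)‖ₑ ^ 2

/-- The trace norm, with values in `[0, ∞]`: the supremum of `∑ᵢ |⟪eᵢ, T fᵢ⟫|` over all
pairs of finite orthonormal systems. `T` is of trace class iff it is finite. -/
def traceNorm (T : H →L[ℂ] H) : ℝ≥0∞ :=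
  ⨆ (n : ℕ) (e : Fin n → H) (f : Fin n → H) (_ : Orthonormal ℂ e) (_ : Orthonormal ℂ f),
    ∑ i, ‖⟪e i, T (f i)⟫_ℂ‖ₑ

/-- A (weakly) measurable field of bounded operators. -/
def IsMeasurableField {X : Type*} [MeasurableSpace X] (A : X → H →L[ℂ] H) : Prop :=
  ∀ u v : H, Measurable fun x => ⟪u, A x v⟫_ℂ

end Operators

/-! ## Plancherel measures and Duflo–Moore operators -/

section Plancherel

variable {G X H : Type*} [Group G] [MeasurableSpace G] [MeasurableSpace X]
  [NormedAddCommGroup H] [InnerProductSpace ℂ H] [CompleteSpace H]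

/-- The integrated representation `π(f) v = ∫ f(g) π(g) v dμ(g)`. -/
def integratedRep (μ : Measure G) (π : G →* unitary (H →L[ℂ] H)) (f : G → ℂ) (v : H) : H :=
  ∫ g, f g • (π g : H →L[ℂ] H) v ∂μ

/-- The function `g ↦ ∫ tr (U_x(g)* A(x) C_x⁻¹) dν(x)` on the group attached to a field of
operators `A`. -/
def fieldTransform (ν : Measure X) (U : X → G →* unitary (H →L[ℂ] H))
    (C : X → H →L[ℂ] H) (A : X → H →L[ℂ] H) (g : G) : ℂ :=
  ∫ x, opTrace (star (U x g : H →L[ℂ] H) * A x * Ring.inverse (C x)) ∂ν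

/-- A measurable square integrable field of Hilbert–Schmidt operators for which
`∫ tr (U_x(g)* A(x) C_x⁻¹) dν(x)` converges absolutely in the sense that
`A(x) C_x⁻¹` is an integrable field of trace class operators. These fields are dense in the
direct integral of the Hilbert–Schmidt spaces. -/
structure IsAdmissibleField (ν : Measure X) (C : X → H →L[ℂ] H) (A : X → H →L[ℂ] H) :
    Prop where
  measurable : IsMeasurableField A
  hilbertSchmidt : ∫⁻ x, hsNormSq (A x) ∂ν < ∞
  traceClass : ∫⁻ x, traceNorm (A x * Ring.inverse (C x)) ∂ν < ∞

/-- `ν` is the Plancherel measure and `C` the field of Duflo–Moore operators of the family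
`U` of unitary representations of the group `G` with Haar measure `μ`: `f ↦ (U_x(f) C_x⁻¹)_x` is
isometric from `L²(G, μ)` to the direct integral of the Hilbert–Schmidt spaces
(`plancherel`), and so is the map `A ↦ ∫ tr (U_x(·)* A(x) C_x⁻¹) dν(x)` in the opposite
direction (`memLp`, `orthogonality`). -/
structure IsPlancherelPair (μ : Measure G) (U : X → G →* unitary (H →L[ℂ] H))
    (ν : Measure X) (C : X → H →L[ℂ] H) : Prop where
  measurable : IsMeasurableField C
  measurable_inverse : IsMeasurableField fun x => Ring.inverse (C x)
  positive : ∀ᵐ x ∂ν, (C x).IsPositive ∧ IsUnit (C x)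
  plancherel : ∀ f : G → ℂ, MemLp f 1 μ → MemLp f 2 μ →
    ∫⁻ x, hsNormSq (fun v => integratedRep μ (U x) f (Ring.inverse (C x) v)) ∂ν
      = ∫⁻ g, ‖f g‖ₑ ^ 2 ∂μ
  memLp : ∀ A, IsAdmissibleField ν C A → MemLp (fieldTransform ν U C A) 2 μ
  orthogonality : ∀ A₁ A₂, IsAdmissibleField ν C A₁ → IsAdmissibleField ν C A₂ →
    ∫ g, starRingEnd ℂ (fieldTransform ν U C A₁ g) * fieldTransform ν U C A₂ g ∂μ
      = ∫ x, opTrace (star (A₁ x) * A₂ x) ∂ν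

end Plancherel

/-! ## The group -/

/-- The underlying manifold `ℝ³ × ℝ² × ℝ²` of the group; an element is
`((θ, φ, ψ), q, p)`. -/
def GNC (_α _β _γ : ℝ) : Type := (ℝ × ℝ × ℝ) × (ℝ × ℝ) × (ℝ × ℝ)

namespace GNC

variable {α β γ : ℝ}

instance : TopologicalSpace (GNC α β γ) :=
  inferInstanceAs (TopologicalSpace ((ℝ × ℝ × ℝ) × (ℝ × ℝ) × (ℝ × ℝ)))
instance : MeasurableSpace (GNC α β γ) :=
  inferInstanceAs (MeasurableSpace ((ℝ × ℝ × ℝ) × (ℝ × ℝ) × (ℝ × ℝ)))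
instance : BorelSpace (GNC α β γ) :=
  inferInstanceAs (BorelSpace ((ℝ × ℝ × ℝ) × (ℝ × ℝ) × (ℝ × ℝ)))

/-- The element `(θ, φ, ψ, q, p)`. -/
def mk (θ φ ψ : ℝ) (q p : ℝ × ℝ) : GNC α β γ := ((θ, φ, ψ), q, p)
def θ (g : GNC α β γ) : ℝ := g.1.1
def φ (g : GNC α β γ) : ℝ := g.1.2.1
def ψ (g : GNC α β γ) : ℝ := g.1.2.2
def q (g : GNC α β γ) : ℝ × ℝ := g.2.1
def p (g : GNC α β γ) : ℝ × ℝ := g.2.2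

/-- The scalar product of two plane vectors. -/
def dot (a b : ℝ × ℝ) : ℝ := a.1 * b.1 + a.2 * b.2
/-- The wedge product of two plane vectors. -/
def wedge (a b : ℝ × ℝ) : ℝ := a.1 * b.2 - a.2 * b.1

instance : Mul (GNC α β γ) where
  mul g h := mk
    (g.θ + h.θ + α / 2 * (dot g.q h.p - dot g.p h.q))
    (g.φ + h.φ + β / 2 * wedge g.p h.p)
    (g.ψ + h.ψ + γ / 2 * wedge g.q h.q)
    (g.q + h.q) (g.p + h.p)
instance : One (GNC α β γ) where
  one := mk 0 0 0 0 0
instance : Inv (GNC α β γ) where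
  inv g := mk (-g.θ) (-g.φ) (-g.ψ) (-g.q) (-g.p)

theorem mul_def (g h : GNC α β γ) : g * h = mk
    (g.θ + h.θ + α / 2 * (dot g.q h.p - dot g.p h.q))
    (g.φ + h.φ + β / 2 * wedge g.p h.p)
    (g.ψ + h.ψ + γ / 2 * wedge g.q h.q)
    (g.q + h.q) (g.p + h.p) := rfl
theorem one_def : (1 : GNC α β γ) = mk 0 0 0 0 0 := rfl
theorem inv_def (g : GNC α β γ) : g⁻¹ = mk (-g.θ) (-g.φ) (-g.ψ) (-g.q) (-g.p) := rfl

theorem ext' {g h : GNC α β γ} (h1 : g.θ = h.θ) (h2 : g.φ = h.φ) (h3 : g.ψ = h.ψ)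
    (h4 : g.q = h.q) (h5 : g.p = h.p) : g = h :=
  Prod.ext (Prod.ext h1 (Prod.ext h2 h3)) (Prod.ext h4 h5)

@[simp] theorem mk_θ (a b c : ℝ) (u v : ℝ × ℝ) : (mk a b c u v : GNC α β γ).θ = a := rfl
@[simp] theorem mk_φ (a b c : ℝ) (u v : ℝ × ℝ) : (mk a b c u v : GNC α β γ).φ = b := rfl
@[simp] theorem mk_ψ (a b c : ℝ) (u v : ℝ × ℝ) : (mk a b c u v : GNC α β γ).ψ = c := rfl
@[simp] theorem mk_q (a b c : ℝ) (u v : ℝ × ℝ) : (mk a b c u v : GNC α β γ).q = u := rfl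
@[simp] theorem mk_p (a b c : ℝ) (u v : ℝ × ℝ) : (mk a b c u v : GNC α β γ).p = v := rfl

instance : Group (GNC α β γ) where
  mul_assoc g h k := by
    apply ext' <;> simp only [mul_def, mk_θ, mk_φ, mk_ψ, mk_q, mk_p, dot, wedge, Prod.fst_add,
      Prod.snd_add] <;> ring
  one_mul g := by
    apply ext' <;> simp [mul_def, one_def, dot, wedge]
  mul_one g := by
    apply ext' <;> simp [mul_def, one_def, dot, wedge]
  inv_mul_cancel g := by
    apply ext' <;> simp only [mul_def, one_def, inv_def, mk_θ, mk_φ, mk_ψ, mk_q, mk_p, dot, wedge,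
      Prod.fst_neg, Prod.snd_neg, neg_add_cancel] <;> ring

/-- Lebesgue measure `dθ dφ dψ dq dp`. -/
def lebesgue (α β γ : ℝ) : Measure (GNC α β γ) :=
  (volume : Measure ((ℝ × ℝ × ℝ) × (ℝ × ℝ) × (ℝ × ℝ)))

/-- The Haar measure `α² dθ dφ dψ dq dp`. -/
def haar (α β γ : ℝ) : Measure (GNC α β γ) :=
  ENNReal.ofReal (α ^ 2) • lebesgue α β γ

/-- A shear followed by a translation preserves Lebesgue measure. -/
theorem measurePreserving_shear (c : (ℝ × ℝ) × (ℝ × ℝ) → ℝ × ℝ × ℝ) (hc : Continuous c)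
    (v₀ : (ℝ × ℝ) × (ℝ × ℝ)) :
    MeasurePreserving (fun g : (ℝ × ℝ × ℝ) × (ℝ × ℝ) × (ℝ × ℝ) => (c g.2 + g.1, v₀ + g.2))
      volume volume := by
  have i1 : (volume : Measure ((ℝ × ℝ) × (ℝ × ℝ))).IsAddLeftInvariant :=
    inferInstanceAs ((volume : Measure (ℝ × ℝ)).prod volume).IsAddLeftInvariant
  have i2 : (volume : Measure (ℝ × ℝ × ℝ)).IsAddLeftInvariant :=
    inferInstanceAs ((volume : Measure ℝ).prod volume).IsAddLeftInvariant
  have h : MeasurePreserving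
      (fun g : ((ℝ × ℝ) × (ℝ × ℝ)) × (ℝ × ℝ × ℝ) => (v₀ + g.1, c g.1 + g.2))
      (volume.prod volume) (volume.prod volume) := by
    refine (measurePreserving_add_left volume v₀).skew_product
      (g := fun v z => c v + z) ?_ ?_
    · exact ((hc.comp continuous_fst).add continuous_snd).measurable
    · exact Filter.Eventually.of_forall fun v => (measurePreserving_add_left volume (c v)).map_eq
  exact (Measure.measurePreserving_swap.comp h).comp Measure.measurePreserving_swap

instance : (lebesgue α β γ).IsMulLeftInvariant where
  map_mul_left_eq_self g := by
    have h := measurePreserving_shear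
      (fun v => (g.θ + α / 2 * (dot g.q v.2 - dot g.p v.1), g.φ + β / 2 * wedge g.p v.2,
        g.ψ + γ / 2 * wedge g.q v.1)) (by unfold dot wedge; fun_prop) (g.q, g.p)
    have he : (fun x : GNC α β γ => g * x) = fun x : GNC α β γ =>
        mk (g.θ + α / 2 * (dot g.q x.p - dot g.p x.q) + x.θ) (g.φ + β / 2 * wedge g.p x.p + x.φ)
          (g.ψ + γ / 2 * wedge g.q x.q + x.ψ) (g.q + x.q) (g.p + x.p) := by
      funext x
      apply ext' <;> simp only [mul_def, mk_θ, mk_φ, mk_ψ, mk_q, mk_p] <;> ring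
    rw [he]
    exact h.map_eq

instance : (lebesgue α β γ).IsMulRightInvariant where
  map_mul_right_eq_self g := by
    have h := measurePreserving_shear
      (fun v => (g.θ + α / 2 * (dot v.1 g.p - dot v.2 g.q), g.φ + β / 2 * wedge v.2 g.p,
        g.ψ + γ / 2 * wedge v.1 g.q)) (by unfold dot wedge; fun_prop) (g.q, g.p)
    have he : (fun x : GNC α β γ => x * g) = fun x : GNC α β γ =>
        mk (g.θ + α / 2 * (dot x.q g.p - dot x.p g.q) + x.θ) (g.φ + β / 2 * wedge x.p g.p + x.φ)
          (g.ψ + γ / 2 * wedge x.q g.q + x.ψ) (g.q + x.q) (g.p + x.p) := by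
      funext x
      apply ext' <;> simp only [mul_def, mk_θ, mk_φ, mk_ψ, mk_q, mk_p] <;> ring
    rw [he]
    exact h.map_eq

/-- `haar α β γ` is a Haar measure. -/
theorem isHaarMeasure_haar (hα : α ≠ 0) : (haar α β γ).IsHaarMeasure := by
  have i1 : (volume : Measure ((ℝ × ℝ) × (ℝ × ℝ))).IsAddHaarMeasure :=
    inferInstanceAs ((volume : Measure (ℝ × ℝ)).prod volume).IsAddHaarMeasure
  have i2 : (volume : Measure (ℝ × ℝ × ℝ)).IsAddHaarMeasure :=
    inferInstanceAs ((volume : Measure ℝ).prod volume).IsAddHaarMeasure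
  have i3 : ((volume : Measure (ℝ × ℝ × ℝ)).prod
      (volume : Measure ((ℝ × ℝ) × (ℝ × ℝ)))).IsAddHaarMeasure :=
    Measure.prod.instIsAddHaarMeasure _ _
  have h1 : (lebesgue α β γ).IsOpenPosMeasure := i3.toIsOpenPosMeasure
  have h2 : IsFiniteMeasureOnCompacts (lebesgue α β γ) := i3.toIsFiniteMeasureOnCompacts
  have h3 : (lebesgue α β γ).IsHaarMeasure := { }
  exact h3.smul _ (by simpa using hα) ENNReal.ofReal_ne_top

/-- The group is unimodular: `haar α β γ` is also right invariant. -/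
instance : (haar α β γ).IsMulRightInvariant :=
  inferInstanceAs (ENNReal.ofReal (α ^ 2) • lebesgue α β γ).IsMulRightInvariant

end GNC

/-! ## The sector of the unitary dual -/

/-- The triples `x = (ρ, σ, τ)` with `ρ, σ, τ ≠ 0` and `ρ²α² - γβστ ≠ 0` at which the
representation of gauge `(l, m)` is defined, that is `γβστ l ≠ ρ²α²`. The last condition excludes a
Lebesgue null set of triples. -/
def Sector (α β γ l : ℝ) : Type :=
  {x : ℝ × ℝ × ℝ // x.1 ≠ 0 ∧ x.2.1 ≠ 0 ∧ x.2.2 ≠ 0 ∧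
    x.1 ^ 2 * α ^ 2 - γ * β * x.2.1 * x.2.2 ≠ 0 ∧
    γ * β * x.2.1 * x.2.2 * l ≠ x.1 ^ 2 * α ^ 2}

namespace Sector

variable {α β γ l : ℝ}

instance : MeasurableSpace (Sector α β γ l) :=
  inferInstanceAs (MeasurableSpace (Subtype _))

/-- Lebesgue measure `dρ dσ dτ` on the sector. -/
instance : MeasureSpace (Sector α β γ l) where
  volume := (volume : Measure (ℝ × ℝ × ℝ)).comap Subtype.val

def ρ (x : Sector α β γ l) : ℝ := x.1.1
def σ (x : Sector α β γ l) : ℝ := x.1.2.1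
def τ (x : Sector α β γ l) : ℝ := x.1.2.2

end Sector

/-! ## The representations -/

/-- The Hilbert space `L²(ℝ², dr₁ dr₂)`. -/
abbrev L2Plane : Type := Lp ℂ 2 (volume : Measure (ℝ × ℝ))

section Representation

variable {α β γ l : ℝ}

open GNC Sector

/-- The phase of the representation. -/
def repPhase (m : ℝ) (x : Sector α β γ l) (g : GNC α β γ) (r : ℝ × ℝ) : ℝ :=
  x.ρ * g.θ + x.σ * g.φ + x.τ * g.ψ
  + x.ρ * α * g.p.1 * r.1 + x.ρ * α * g.p.2 * r.2
  + x.ρ ^ 2 * α ^ 2 * x.τ * γ * (1 - l) / (x.τ * γ * x.σ * β * l - x.ρ ^ 2 * α ^ 2)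
      * g.q.1 * r.2
  + l * x.τ * γ * g.q.2 * r.1
  + (x.ρ * α / 2 + x.ρ * α * x.τ * γ * x.σ * β * m * (1 - l)
      / (x.τ * γ * x.σ * β * l - x.ρ ^ 2 * α ^ 2)) * g.p.1 * g.q.1
  + (x.ρ * α / 2 - l * x.τ * γ * x.σ * β * (1 - m) / (x.ρ * α)) * g.p.2 * g.q.2
  + (m - 1 / 2) * x.σ * β * g.p.1 * g.p.2
  + (x.τ * γ / 2 - x.τ * γ * (1 - l)
      * (x.τ * γ * x.σ * β * l - x.τ * γ * x.σ * β * l * m - x.ρ ^ 2 * α ^ 2)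
      / (x.τ * γ * x.σ * β * l - x.ρ ^ 2 * α ^ 2)) * g.q.1 * g.q.2

/-- The translation vector of the representation. -/
def repShift (m : ℝ) (x : Sector α β γ l) (g : GNC α β γ) : ℝ × ℝ :=
  (-((1 - m) * x.σ * β / (x.ρ * α)) * g.p.2
      + (x.τ * γ * x.σ * β * (l + m - l * m) - x.ρ ^ 2 * α ^ 2)
        / (x.τ * γ * x.σ * β * l - x.ρ ^ 2 * α ^ 2) * g.q.1,
    m * x.σ * β / (x.ρ * α) * g.p.1
      - (x.τ * γ * x.σ * β * l * (1 - m) - x.ρ ^ 2 * α ^ 2) / (x.ρ ^ 2 * α ^ 2) * g.q.2)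

/-- The function `r ↦ exp (i phase(r)) f(r + shift)`. -/
def repFun (m : ℝ) (x : Sector α β γ l) (g : GNC α β γ) (f : ℝ × ℝ → ℂ) (r : ℝ × ℝ) : ℂ :=
  Complex.exp (Complex.I * repPhase m x g r) * f (r + repShift m x g)

theorem quasiPreserving_shift (s : ℝ × ℝ) :
    Measure.QuasiMeasurePreserving (fun r : ℝ × ℝ => r + s) volume volume :=
  (measurePreserving_add_right volume s).quasiMeasurePreserving

theorem repPhase_continuous (m : ℝ) (x : Sector α β γ l) (g : GNC α β γ) :
    Continuous (repPhase m x g) := by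
  unfold repPhase; fun_prop

theorem norm_repFun (m : ℝ) (x : Sector α β γ l) (g : GNC α β γ) (f : ℝ × ℝ → ℂ)
    (r : ℝ × ℝ) : ‖repFun m x g f r‖ = ‖f (r + repShift m x g)‖ := by
  rw [repFun, norm_mul, mul_comm Complex.I, Complex.norm_exp_ofReal_mul_I, one_mul]

theorem repFun_memLp (m : ℝ) (x : Sector α β γ l) (g : GNC α β γ) {f : ℝ × ℝ → ℂ}
    (hf : MemLp f 2 volume) : MemLp (repFun m x g f) 2 volume := by
  have h := hf.comp_measurePreserving (measurePreserving_add_right volume (repShift m x g))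
  refine h.of_le ?_ (Filter.Eventually.of_forall fun r => (norm_repFun m x g f r).le)
  refine AEStronglyMeasurable.mul ?_ h.aestronglyMeasurable
  have := repPhase_continuous m x g
  exact Continuous.aestronglyMeasurable (by fun_prop)

theorem repFun_congr (m : ℝ) (x : Sector α β γ l) (g : GNC α β γ) {f f' : ℝ × ℝ → ℂ}
    (h : f =ᵐ[volume] f') : repFun m x g f =ᵐ[volume] repFun m x g f' := by
  filter_upwards [(quasiPreserving_shift (repShift m x g)).ae_eq_comp h] with r hr
  simp only [Function.comp] at hr
  simp [repFun, hr]

theorem eLpNorm_repFun (m : ℝ) (x : Sector α β γ l) (g : GNC α β γ) {f : ℝ × ℝ → ℂ}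
    (hf : MemLp f 2 volume) : eLpNorm (repFun m x g f) 2 volume = eLpNorm f 2 volume := by
  rw [← eLpNorm_comp_measurePreserving hf.aestronglyMeasurable
    (measurePreserving_add_right volume (repShift m x g))]
  exact eLpNorm_congr_norm_ae (Filter.Eventually.of_forall fun r => norm_repFun m x g f r)

/-- `repFun` as a linear isometry of `L²(ℝ²)`. -/
def repIsometry (m : ℝ) (x : Sector α β γ l) (g : GNC α β γ) : L2Plane →ₗᵢ[ℂ] L2Plane where
  toFun f := (repFun_memLp m x g (Lp.memLp f)).toLp _
  map_add' f f' := by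
    rw [← MemLp.toLp_add]
    refine (MemLp.toLp_eq_toLp_iff _ _).2 ((repFun_congr m x g (Lp.coeFn_add f f')).trans ?_)
    exact Filter.Eventually.of_forall fun r => by simp [repFun, mul_add]
  map_smul' c f := by
    rw [RingHom.id_apply, ← MemLp.toLp_const_smul]
    refine (MemLp.toLp_eq_toLp_iff _ _).2 ((repFun_congr m x g (Lp.coeFn_smul c f)).trans ?_)
    exact Filter.Eventually.of_forall fun r => by
      simp only [repFun, Pi.smul_apply, smul_eq_mul]; ring
  norm_map' f := by
    simp only [LinearMap.coe_mk, AddHom.coe_mk, Lp.norm_toLp]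
    rw [eLpNorm_repFun m x g (Lp.memLp f), Lp.norm_def]

theorem repIsometry_apply (m : ℝ) (x : Sector α β γ l) (g : GNC α β γ) (f : L2Plane) :
    repIsometry m x g f = (repFun_memLp m x g (Lp.memLp f)).toLp _ := rfl

theorem repFun_mul (hα : α ≠ 0) (m : ℝ) (x : Sector α β γ l) (g h : GNC α β γ)
    (f : ℝ × ℝ → ℂ) : repFun m x (g * h) f = repFun m x g (repFun m x h f) := by
  have hρ : x.ρ ≠ 0 := x.2.1
  have hD : x.τ * γ * x.σ * β * l - x.ρ ^ 2 * α ^ 2 ≠ 0 := by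
    intro h0
    apply x.2.2.2.2.2
    change γ * β * x.σ * x.τ * l = x.ρ ^ 2 * α ^ 2
    linarith
  have hs : repShift m x (g * h) = repShift m x g + repShift m x h := by
    ext <;> simp only [repShift, mul_def, mk_q, mk_p, Prod.fst_add, Prod.snd_add] <;> ring
  funext r
  have hp : repPhase m x (g * h) r
      = repPhase m x g r + repPhase m x h (r + repShift m x g) := by
    simp only [repPhase, repShift, mul_def, mk_θ, mk_φ, mk_ψ, mk_q, mk_p, dot, wedge,
      Prod.fst_add, Prod.snd_add]
    generalize hd : x.τ * γ * x.σ * β * l - x.ρ ^ 2 * α ^ 2 = d at hD ⊢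
    field_simp
    rw [← hd]
    ring
  simp only [repFun]
  rw [hs, hp, ← mul_assoc, ← Complex.exp_add, add_assoc]
  push_cast
  ring_nf

theorem repIsometry_mul (hα : α ≠ 0) (m : ℝ) (x : Sector α β γ l) (g h : GNC α β γ) :
    repIsometry m x (g * h) = repIsometry m x g * repIsometry m x h := by
  ext1 f
  change repIsometry m x (g * h) f = repIsometry m x g (repIsometry m x h f)
  rw [repIsometry_apply m x g, repIsometry_apply m x (g * h)]
  refine (MemLp.toLp_eq_toLp_iff _ _).2 ?_
  rw [repFun_mul hα]
  exact repFun_congr m x g (MemLp.coeFn_toLp (repFun_memLp m x h (Lp.memLp f))).symm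

theorem repIsometry_one (m : ℝ) (x : Sector α β γ l) :
    repIsometry m x (1 : GNC α β γ) = 1 := by
  ext1 f
  change repIsometry m x 1 f = f
  rw [repIsometry_apply]
  have h : repFun m x (1 : GNC α β γ) f = f := by
    funext r
    have hs : repShift m x (1 : GNC α β γ) = 0 := by ext <;> simp [repShift, one_def]
    have hp : repPhase m x (1 : GNC α β γ) r = 0 := by simp [repPhase, one_def]
    simp [repFun, hs, hp]
  simp only [h, Lp.toLp_coeFn]

/-- The unitary representation of gauge `(l, m)` at the triple `x = (ρ, σ, τ)`. -/
def gaugeRep (hα : α ≠ 0) (m : ℝ) (x : Sector α β γ l) :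
    GNC α β γ →* unitary (L2Plane →L[ℂ] L2Plane) where
  toFun g := Unitary.linearIsometryEquiv.symm
    { repIsometry m x g with
      invFun := repIsometry m x g⁻¹
      left_inv := fun f => by
        change (repIsometry m x g⁻¹ * repIsometry m x g) f = f
        rw [← repIsometry_mul hα, inv_mul_cancel, repIsometry_one]; rfl
      right_inv := fun f => by
        change (repIsometry m x g * repIsometry m x g⁻¹) f = f
        rw [← repIsometry_mul hα, mul_inv_cancel, repIsometry_one]; rfl }
  map_one' := by
    rw [← map_one Unitary.linearIsometryEquiv.symm]
    congr 1
    ext1 f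
    exact congrArg (fun T : L2Plane →ₗᵢ[ℂ] L2Plane => T f) (repIsometry_one m x)
  map_mul' g h := by
    rw [← map_mul]
    congr 1
    ext1 f
    exact congrArg (fun T : L2Plane →ₗᵢ[ℂ] L2Plane => T f) (repIsometry_mul hα m x g h)

end Representation

/-- The measure `|ρ²α² - γβστ| / α² dρ dσ dτ` on the sector. -/
def sectorPlancherel (α β γ l : ℝ) : Measure (Sector α β γ l) :=
  volume.withDensity fun x =>
    ENNReal.ofReal (|x.ρ ^ 2 * α ^ 2 - γ * β * x.σ * x.τ| / α ^ 2)

end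

/-! Write `x = (ρ, σ, τ)`, `z = (θ, φ, ψ)` and `v = (q, p)`. The operator `U_x(z, v)` is the central
character `cis (x · z)` times a unimodular quadratic phase in `v`, times a plane wave in `r` of
frequency `a(v)`, composed with translation by `s(v)`. Both `a` and `s` are linear in `v`, and `v ↦
(a, s)` has determinant `ρ²α² - γβστ`, the Pfaffian `pf`, whatever the gauge `(l, m)`
(`exists_repEquiv`). Hence the gauge enters no constant.

At a fixed `x`, Plancherel on `ℝ²` together with this change of variables shows that `F ↦ ∫ F(v)
U_x(0, v) dv` multiplies squared norms, from `L²` to Hilbert–Schmidt, by `(2π)² / |pf|`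
(`hsNormSq_weylTransform`). Dually, `v ↦ tr (U_x(0, v)* B)` has squared `L²` norm `(2π)² / |pf|`
times that of `B` (`lintegral_enorm_sq_tsum_fieldEntry`). The central variables contribute an
ordinary Fourier transform on `ℝ³` with constant `(2π)³`; the sector may replace `ℝ³` because its
complement is null. The density `|pf| / α²` absorbs the Pfaffian and the normalisation `α²` of Haar
measure, and the remaining `(2π)⁵` is the square of the scalar Duflo–Moore operator. Polarisation
turns the norm identity for the inverse transform into the orthogonality relation.

The measure is recovered from the Plancherel formula alone: sums of a Gaussian and a translate of it
in `z`, cut off in `v`, prescribe the characteristic function of `ν` times a positive density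
(`eq_sectorPlancherel_of_isPlancherelPair`). The operators are recovered from the orthogonality
relation and positivity: rank-one fields supported on a set `E` force `(2π)^(5/2) ‖(C⁻¹)* u‖ = ‖u‖`
almost everywhere, and a positive operator that is a multiple of an isometry is scalar. -/

noncomputable section

/-! ## The Plancherel formula for integrable square integrable functions -/

section PlancherelFormula

open scoped FourierTransform SchwartzMap

/-- On `L¹ ∩ L²` the `L²` Fourier transform agrees with the Fourier integral. -/
theorem Lp_fourier_toLp_ae_eq {E : Type*} [NormedAddCommGroup E] [InnerProductSpace ℝ E]
    [FiniteDimensional ℝ E] [MeasurableSpace E] [BorelSpace E] {k : E → ℂ}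
    (h1 : Integrable k volume) (h2 : MemLp k 2 volume) :
    (𝓕 (h2.toLp k) : Lp (α := E) ℂ 2 volume) =ᵐ[volume] 𝓕 k := by
  have hcont : Continuous (𝓕 k) :=
    VectorFourier.fourierIntegral_continuous Real.continuous_fourierChar
      (L := innerₗ E) continuous_inner h1
  -- It suffices to integrate both sides against smooth compactly supported functions. Either
  -- transform can then be moved onto the test function: the `L²` one through tempered distributions
  -- (`e1`), the integral one by Fubini (`e2`).
  refine ae_eq_of_integral_contDiff_smul_eq
    ((Lp.memLp _).locallyIntegrable (by norm_num)) hcont.locallyIntegrable ?_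
  intro g hg hgc
  have hg₁ : HasCompactSupport (Complex.ofRealCLM ∘ g) := hgc.comp_left rfl
  have hg₂ : ContDiff ℝ ((⊤ : ℕ∞) : WithTop ℕ∞) (Complex.ofRealCLM ∘ g) := by fun_prop
  set φ : 𝓢(E, ℂ) := hg₁.toSchwartzMap hg₂ with hφ
  have e1 := congrArg (fun T => T φ) (Lp.fourier_toTemperedDistribution_eq (h2.toLp k))
  simp only [TemperedDistribution.fourier_apply, Lp.toTemperedDistribution_apply] at e1
  have e2 := VectorFourier.integral_fourierIntegral_smul_eq_flip (L := innerₗ E)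
    (μ := (volume : Measure E)) (ν := (volume : Measure E)) Real.continuous_fourierChar
    continuous_inner h1 φ.integrable
  have hflip : (innerₗ E).flip = innerₗ E := by
    ext x y; exact real_inner_comm _ _
  rw [hflip] at e2
  calc ∫ x, g x • (𝓕 (h2.toLp k) : Lp (α := E) ℂ 2 volume) x
      = ∫ x, φ x • (𝓕 (h2.toLp k) : Lp (α := E) ℂ 2 volume) x := by
        refine integral_congr_ae (.of_forall fun x => ?_)
        simp [hφ]
    _ = ∫ x, (𝓕 φ) x • h2.toLp k x := e1.symm
    _ = ∫ x, k x • 𝓕 (φ : E → ℂ) x := by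
        refine integral_congr_ae ?_
        filter_upwards [h2.coeFn_toLp] with x hx
        rw [hx, SchwartzMap.fourier_coe, smul_eq_mul, smul_eq_mul, mul_comm]
    _ = ∫ x, 𝓕 k x • φ x := e2.symm
    _ = ∫ x, g x • 𝓕 k x := by
        refine integral_congr_ae (.of_forall fun x => ?_)
        simp [hφ, mul_comm]

theorem eLpNorm_two_sq {X : Type*} [MeasurableSpace X] {μ : Measure X} {E : Type*}
    [NormedAddCommGroup E] (f : X → E) : eLpNorm f 2 μ ^ 2 = ∫⁻ x, ‖f x‖ₑ ^ 2 ∂μ := by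
  rw [eLpNorm_eq_lintegral_rpow_enorm_toReal (by norm_num) (by norm_num), ← ENNReal.rpow_natCast,
    ← ENNReal.rpow_mul]
  simp

theorem memLp_two_iff_lintegral {X : Type*} [MeasurableSpace X] {μ : Measure X} {E : Type*}
    [NormedAddCommGroup E] {f : X → E} (hf : AEStronglyMeasurable f μ) :
    MemLp f 2 μ ↔ ∫⁻ x, ‖f x‖ₑ ^ 2 ∂μ < ∞ := by
  rw [← eLpNorm_two_sq, MemLp, ENNReal.pow_lt_top_iff]
  simp [hf]

/-- Plancherel's theorem for integrable square integrable functions. -/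
theorem lintegral_enorm_sq_fourier {E : Type*} [NormedAddCommGroup E] [InnerProductSpace ℝ E]
    [FiniteDimensional ℝ E] [MeasurableSpace E] [BorelSpace E] {k : E → ℂ}
    (h1 : Integrable k) (h2 : MemLp k 2) :
    ∫⁻ ξ, ‖𝓕 k ξ‖ₑ ^ 2 = ∫⁻ x, ‖k x‖ₑ ^ 2 := by
  have h := Lp.norm_fourier_eq (h2.toLp k)
  rw [Lp.norm_def, Lp.norm_def, ENNReal.toReal_eq_toReal_iff' (Lp.eLpNorm_ne_top _)
    (Lp.eLpNorm_ne_top _), eLpNorm_congr_ae (Lp_fourier_toLp_ae_eq h1 h2),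
    eLpNorm_congr_ae h2.coeFn_toLp] at h
  rw [← eLpNorm_two_sq, ← eLpNorm_two_sq, h]

end PlancherelFormula

/-! ## Characters -/

/-- The function `t ↦ exp (i t)`. -/
def cis (t : ℝ) : ℂ := Complex.exp (Complex.I * t)

theorem cis_add (s t : ℝ) : cis (s + t) = cis s * cis t := by
  rw [cis, cis, cis, ← Complex.exp_add]; push_cast; ring_nf

@[simp] theorem cis_zero : cis 0 = 1 := by simp [cis]

@[simp] theorem norm_cis (t : ℝ) : ‖cis t‖ = 1 := by
  rw [cis, mul_comm, Complex.norm_exp_ofReal_mul_I]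

@[simp] theorem enorm_cis (t : ℝ) : ‖cis t‖ₑ = 1 := by
  rw [← ofReal_norm, norm_cis, ENNReal.ofReal_one]

theorem conj_cis (t : ℝ) : starRingEnd ℂ (cis t) = cis (-t) := by
  rw [cis, cis, ← Complex.exp_conj]; simp

@[fun_prop] theorem continuous_cis : Continuous cis := by unfold cis; fun_prop

@[fun_prop] theorem measurable_cis : Measurable cis := continuous_cis.measurable

theorem enorm_conj (z : ℂ) : ‖starRingEnd ℂ z‖ₑ = ‖z‖ₑ := by
  rw [← ofReal_norm, RCLike.norm_conj, ofReal_norm]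

theorem measurable_conj : Measurable (starRingEnd ℂ) := Complex.continuous_conj.measurable

/-- `b` is a pairing whose characters `cis (b x ξ)` define a Fourier transform for which the
Plancherel formula holds with the constant `c`. -/
structure IsPlancherelPairing {E : Type*} [MeasureSpace E] (b : E → E → ℝ) (c : ℝ≥0∞) :
    Prop where
  measurable : Measurable fun p : E × E => b p.1 p.2
  ne_top : c ≠ ∞
  lintegral_eq : ∀ k : E → ℂ, Measurable k → Integrable k → ∫⁻ x, ‖k x‖ₑ ^ 2 < ∞ →
    ∫⁻ ξ, ‖∫ x, k x * cis (b x ξ)‖ₑ ^ 2 = c * ∫⁻ x, ‖k x‖ₑ ^ 2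

theorem isPlancherelPairing_real :
    IsPlancherelPairing (fun x ξ : ℝ => x * ξ) (ENNReal.ofReal (2 * Real.pi)) where
  measurable := by fun_prop
  ne_top := ENNReal.ofReal_ne_top
  lintegral_eq k hk h1 h2 := by
    have hL := (memLp_two_iff_lintegral h1.aestronglyMeasurable).2 h2
    rw [← lintegral_enorm_sq_fourier h1 hL]
    -- The kernel `e^{-2πi xξ}` is `cis` at frequency `-2πξ`; undoing this rescaling produces the
    -- constant `2π`.
    have hF : ∀ ξ : ℝ, FourierTransform.fourier k ξ
        = ∫ x, k x * cis (x * (-(2 * Real.pi) * ξ)) := by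
      intro ξ
      rw [Real.fourier_real_eq_integral_exp_smul]
      refine integral_congr_ae (.of_forall fun x => ?_)
      simp only [cis, smul_eq_mul]
      rw [mul_comm]
      congr 2
      push_cast
      ring
    have hm : Measurable fun η : ℝ => ∫ x, k x * cis (x * η) := by
      have : StronglyMeasurable fun q : ℝ × ℝ => k q.2 * cis (q.2 * q.1) :=
        Measurable.stronglyMeasurable (by fun_prop)
      exact this.integral_prod_right.measurable
    simp_rw [hF]
    have hne : -(2 * Real.pi) ≠ 0 := neg_ne_zero.2 Real.two_pi_pos.ne'
    have hs : ∀ G : ℝ → ℝ≥0∞, Measurable G →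
        ∫⁻ ξ, G ξ = ENNReal.ofReal (2 * Real.pi) * ∫⁻ ξ, G (-(2 * Real.pi) * ξ) := by
      intro G hG
      conv_lhs => rw [← Real.smul_map_volume_mul_left hne]
      rw [lintegral_smul_measure, lintegral_map hG (by fun_prop), abs_neg,
        abs_of_pos Real.two_pi_pos, smul_eq_mul]
    exact hs _ (hm.enorm.pow_const 2)

/-- Parametrised Plancherel formula. -/
theorem IsPlancherelPairing.lintegral_lintegral_eq {E Y : Type*} [MeasureSpace E]
    [SFinite (volume : Measure E)] [MeasurableSpace Y] {b : E → E → ℝ} {c : ℝ≥0∞}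
    (hb : IsPlancherelPairing b c) (ν : Measure Y) {k : E → Y → ℂ}
    (hk : Measurable fun p : E × Y => k p.1 p.2) (h1 : ∀ᵐ y ∂ν, Integrable fun x => k x y)
    (h2 : ∫⁻ y, (∫⁻ x, ‖k x y‖ₑ ^ 2) ∂ν < ∞) :
    ∫⁻ y, (∫⁻ ξ, ‖∫ x, k x y * cis (b x ξ)‖ₑ ^ 2) ∂ν
      = c * ∫⁻ y, (∫⁻ x, ‖k x y‖ₑ ^ 2) ∂ν := by
  have hm : Measurable fun y => ∫⁻ x, ‖k x y‖ₑ ^ 2 :=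
    Measurable.lintegral_prod_left (f := fun x y => ‖k x y‖ₑ ^ 2) (by
      change Measurable fun p : E × Y => ‖k p.1 p.2‖ₑ ^ 2
      fun_prop)
  rw [← lintegral_const_mul _ hm]
  refine lintegral_congr_ae ?_
  filter_upwards [h1, ae_lt_top hm h2.ne] with y hy hy2
  exact hb.lintegral_eq _ (hk.comp (by fun_prop : Measurable fun x : E => (x, y))) hy hy2

/-- One variable is transformed at a time: the formula in `x` for fixed `y` gives `c`, the formula
in `y` for fixed `ξ` gives `c'`, and Tonelli exchanges the order in between. -/
theorem IsPlancherelPairing.prod {E E' : Type*} [MeasureSpace E] [MeasureSpace E']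
    [SigmaFinite (volume : Measure E)] [SigmaFinite (volume : Measure E')]
    {b : E → E → ℝ} {b' : E' → E' → ℝ} {c c' : ℝ≥0∞} (hb : IsPlancherelPairing b c)
    (hb' : IsPlancherelPairing b' c') :
    IsPlancherelPairing (fun x ξ : E × E' => b x.1 ξ.1 + b' x.2 ξ.2) (c' * c) where
  measurable := (hb.measurable.comp (by fun_prop : Measurable fun p : (E × E') × (E × E') =>
    (p.1.1, p.2.1))).add (hb'.measurable.comp (by fun_prop :
      Measurable fun p : (E × E') × (E × E') => (p.1.2, p.2.2)))
  ne_top := ENNReal.mul_ne_top hb'.ne_top hb.ne_top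
  lintegral_eq k hk h1 h2 := by
    have hbm := hb.measurable
    have hbm' := hb'.measurable
    set K : E → E' → ℂ := fun ξ y => ∫ x, k (x, y) * cis (b x ξ) with hK
    have hKm : Measurable fun p : E × E' => K p.1 p.2 := by
      have : StronglyMeasurable fun q : (E × E') × E => k (q.2, q.1.2) * cis (b q.2 q.1.1) := by
        refine Measurable.stronglyMeasurable ?_
        have := hbm.comp (by fun_prop : Measurable fun q : (E × E') × E => (q.2, q.1.1))
        fun_prop
      exact this.integral_prod_right.measurable
    have h1' : Integrable k (volume.prod volume) := h1
    have h2' : ∫⁻ y, ∫⁻ x, ‖k (x, y)‖ₑ ^ 2 = ∫⁻ x, ‖k x‖ₑ ^ 2 := by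
      rw [Measure.volume_eq_prod, lintegral_prod_symm' _ (by fun_prop)]
    have e1 := hb.lintegral_lintegral_eq (volume : Measure E') (k := fun x y => k (x, y)) hk
      h1'.prod_left_ae (h2' ▸ h2)
    have hKu : AEMeasurable (Function.uncurry fun (y : E') (ξ : E) => ‖K ξ y‖ₑ ^ 2)
        (volume.prod volume) :=
      ((hKm.comp measurable_swap).enorm.pow_const 2).aemeasurable
    rw [h2', lintegral_lintegral_swap hKu] at e1
    -- The partial transform `K ξ` is integrable for every `ξ`, because multiplying `k` by a
    -- unimodular factor does not affect integrability on the product.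
    have e2 := hb'.lintegral_lintegral_eq (volume : Measure E) (k := fun y ξ => K ξ y)
      (hKm.comp measurable_swap) (.of_forall fun ξ => ?_) ?_
    · rw [e1] at e2
      have hm2 : Measurable fun q : E × E' => ∫ x : E × E', k x * cis (b x.1 q.1 + b' x.2 q.2) := by
        have : StronglyMeasurable fun q : (E × E') × (E × E') =>
            k q.2 * cis (b q.2.1 q.1.1 + b' q.2.2 q.1.2) := by
          refine Measurable.stronglyMeasurable ?_
          have i1 := hbm.comp (by fun_prop : Measurable fun q : (E × E') × (E × E') =>
            (q.2.1, q.1.1))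
          have i2 := hbm'.comp (by fun_prop : Measurable fun q : (E × E') × (E × E') =>
            (q.2.2, q.1.2))
          exact (by fun_prop : Measurable fun q : (E × E') × (E × E') => k q.2).mul
            (measurable_cis.comp (i1.add i2))
        exact this.integral_prod_right.measurable
      have e3 : ∫⁻ q : E × E', ‖∫ x : E × E', k x * cis (b x.1 q.1 + b' x.2 q.2)‖ₑ ^ 2
          = ∫⁻ ξ, ∫⁻ η, ‖∫ x : E × E', k x * cis (b x.1 ξ + b' x.2 η)‖ₑ ^ 2 :=
        lintegral_prod _ (hm2.enorm.pow_const 2).aemeasurable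
      rw [e3, mul_assoc, ← e2]
      refine lintegral_congr fun ξ => lintegral_congr fun η => ?_
      congr 2
      rw [Measure.volume_eq_prod, integral_prod_symm]
      · refine integral_congr_ae (.of_forall fun y => ?_)
        simp only [hK, cis_add]
        rw [← integral_mul_const]
        simp only [mul_assoc]
      · refine h1'.mono ?_ (.of_forall fun x => by simp)
        refine Measurable.aestronglyMeasurable ?_
        have i1 := hbm.comp (by fun_prop : Measurable fun q : E × E' => (q.1, ξ))
        have i2 := hbm'.comp (by fun_prop : Measurable fun q : E × E' => (q.2, η))
        exact hk.mul (measurable_cis.comp (i1.add i2))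
    · have : Integrable (fun p : E × E' => k p * cis (b p.1 ξ)) (volume.prod volume) := by
        refine h1'.mono ?_ (.of_forall fun x => by simp)
        refine Measurable.aestronglyMeasurable ?_
        have i1 := hbm.comp (by fun_prop : Measurable fun q : E × E' => (q.1, ξ))
        exact hk.mul (measurable_cis.comp i1)
      exact this.integral_prod_right
    · rw [e1]
      exact ENNReal.mul_lt_top hb.ne_top.lt_top h2

theorem isPlancherelPairing_dot :
    IsPlancherelPairing GNC.dot (ENNReal.ofReal ((2 * Real.pi) ^ 2)) := by
  have h := isPlancherelPairing_real.prod isPlancherelPairing_real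
  rwa [← ENNReal.ofReal_mul Real.two_pi_pos.le, ← sq] at h

/-- The scalar product on `ℝ³`. -/
def dot3 (x z : ℝ × ℝ × ℝ) : ℝ := x.1 * z.1 + (x.2.1 * z.2.1 + x.2.2 * z.2.2)

theorem isPlancherelPairing_dot3 :
    IsPlancherelPairing dot3 (ENNReal.ofReal ((2 * Real.pi) ^ 3)) := by
  have h := isPlancherelPairing_real.prod isPlancherelPairing_dot
  rwa [← ENNReal.ofReal_mul (by positivity), ← pow_succ] at h

@[fun_prop] theorem measurable_dot {X : Type*} [MeasurableSpace X] {f g : X → ℝ × ℝ}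
    (hf : Measurable f) (hg : Measurable g) : Measurable fun x => GNC.dot (f x) (g x) := by
  unfold GNC.dot; fun_prop

@[fun_prop] theorem measurable_dot3 {X : Type*} [MeasurableSpace X] {f g : X → ℝ × ℝ × ℝ}
    (hf : Measurable f) (hg : Measurable g) : Measurable fun x => dot3 (f x) (g x) := by
  unfold dot3; fun_prop

/-! ## The sector -/

namespace Sector

variable {α β γ l : ℝ}

@[fun_prop] theorem measurable_val : Measurable fun x : Sector α β γ l => x.1 :=
  measurable_subtype_coe

@[fun_prop] theorem measurable_ρ : Measurable fun x : Sector α β γ l => x.ρ :=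
  measurable_fst.comp measurable_val

@[fun_prop] theorem measurable_σ : Measurable fun x : Sector α β γ l => x.σ :=
  (measurable_fst.comp measurable_snd).comp measurable_val

@[fun_prop] theorem measurable_τ : Measurable fun x : Sector α β γ l => x.τ :=
  (measurable_snd.comp measurable_snd).comp measurable_val

/-- The subset of `ℝ³` underlying the sector. -/
def carrier (α β γ l : ℝ) : Set (ℝ × ℝ × ℝ) :=
  {x : ℝ × ℝ × ℝ | x.1 ≠ 0 ∧ x.2.1 ≠ 0 ∧ x.2.2 ≠ 0 ∧
    x.1 ^ 2 * α ^ 2 - γ * β * x.2.1 * x.2.2 ≠ 0 ∧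
    γ * β * x.2.1 * x.2.2 * l ≠ x.1 ^ 2 * α ^ 2}

theorem measurableSet_carrier (α β γ l : ℝ) : MeasurableSet (carrier α β γ l) := by
  refine IsOpen.measurableSet ?_
  refine IsOpen.inter (isOpen_ne_fun (by fun_prop) (by fun_prop)) ?_
  refine IsOpen.inter (isOpen_ne_fun (by fun_prop) (by fun_prop)) ?_
  refine IsOpen.inter (isOpen_ne_fun (by fun_prop) (by fun_prop)) ?_
  exact IsOpen.inter (isOpen_ne_fun (by fun_prop) (by fun_prop))
    (isOpen_ne_fun (by fun_prop) (by fun_prop))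

theorem measurableEmbedding_val : MeasurableEmbedding fun x : Sector α β γ l => x.1 :=
  MeasurableEmbedding.subtype_coe (measurableSet_carrier α β γ l)

instance : SigmaFinite (volume : Measure (Sector α β γ l)) :=
  SigmaFinite.of_map _ measurable_val.aemeasurable <| by
    change SigmaFinite (((volume : Measure (ℝ × ℝ × ℝ)).comap
      fun x : Sector α β γ l => x.1).map fun x : Sector α β γ l => x.1)
    rw [measurableEmbedding_val.map_comap]
    infer_instance

/-- The sector is conull in `ℝ³`. -/
theorem ae_mem_carrier (hα : α ≠ 0) (β γ l : ℝ) :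
    ∀ᵐ x : ℝ × ℝ × ℝ, x ∈ carrier α β γ l := by
  -- For fixed nonzero `σ, τ`, each remaining condition fails for finitely many `ρ` only, so the
  -- complement has null fibres. The variable `ρ` is moved to the last place below to apply Fubini
  -- in this order.
  have hfin : ∀ (y : ℝ × ℝ) (c : ℝ), ∀ᵐ r : ℝ, r ^ 2 * α ^ 2 ≠ c := by
    intro y c
    have : {r : ℝ | r ^ 2 * α ^ 2 = c}.Finite := by
      refine Set.Finite.subset (Set.toFinite {√(c / α ^ 2), -√(c / α ^ 2)}) fun r hr => ?_
      have : c / α ^ 2 = r ^ 2 := by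
        rw [← (hr : r ^ 2 * α ^ 2 = c)]; field_simp
      simp only [Set.mem_insert_iff, Set.mem_singleton_iff]
      rw [this, Real.sqrt_sq_eq_abs]
      rcases abs_choice r with h | h <;> rw [h] <;> simp
    rw [ae_iff]
    simpa using this.measure_zero volume
  have hy : ∀ᵐ y : ℝ × ℝ, y.1 ≠ 0 ∧ y.2 ≠ 0 := by
    have h0 : ∀ᵐ t : ℝ, t ≠ 0 := by simp [ae_iff]
    exact (Measure.quasiMeasurePreserving_fst.ae h0).and (Measure.quasiMeasurePreserving_snd.ae h0)
  have hmeas : MeasurableSet {q : (ℝ × ℝ) × ℝ | q.2 ≠ 0 ∧ q.1.1 ≠ 0 ∧ q.1.2 ≠ 0 ∧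
      q.2 ^ 2 * α ^ 2 - γ * β * q.1.1 * q.1.2 ≠ 0 ∧
      γ * β * q.1.1 * q.1.2 * l ≠ q.2 ^ 2 * α ^ 2} :=
    (measurableSet_carrier α β γ l).preimage measurable_swap
  have key : ∀ᵐ q : (ℝ × ℝ) × ℝ, q.2 ≠ 0 ∧ q.1.1 ≠ 0 ∧ q.1.2 ≠ 0 ∧
      q.2 ^ 2 * α ^ 2 - γ * β * q.1.1 * q.1.2 ≠ 0 ∧
      γ * β * q.1.1 * q.1.2 * l ≠ q.2 ^ 2 * α ^ 2 := by
    rw [Measure.volume_eq_prod, Measure.ae_prod_iff_ae_ae hmeas]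
    filter_upwards [hy] with y hy
    filter_upwards [hfin y 0, hfin y (γ * β * y.1 * y.2), hfin y (γ * β * y.1 * y.2 * l)]
      with r h1 h2 h3
    exact ⟨fun h => h1 (by rw [h]; ring), hy.1, hy.2, sub_ne_zero.2 h2, h3.symm⟩
  exact (Measure.measurePreserving_swap (μ := (volume : Measure ℝ))
    (ν := (volume : Measure (ℝ × ℝ)))).quasiMeasurePreserving.ae key

theorem lintegral_val (hα : α ≠ 0) (G : ℝ × ℝ × ℝ → ℝ≥0∞) :
    ∫⁻ x : Sector α β γ l, G x.1 = ∫⁻ x, G x := by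
  have := lintegral_subtype_comap (μ := volume) (measurableSet_carrier α β γ l) G
  refine this.trans ?_
  rw [Measure.restrict_eq_self_of_ae_mem (ae_mem_carrier hα β γ l)]

theorem integral_val (hα : α ≠ 0) (G : ℝ × ℝ × ℝ → ℂ) :
    ∫ x : Sector α β γ l, G x.1 = ∫ x, G x := by
  have := integral_subtype_comap (μ := volume) (measurableSet_carrier α β γ l) G
  refine this.trans ?_
  rw [Measure.restrict_eq_self_of_ae_mem (ae_mem_carrier hα β γ l)]

/-- Extension by zero from the sector to `ℝ³`. -/
theorem exists_extension {Y : Type*} [MeasurableSpace Y] {k : Sector α β γ l → Y → ℂ}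
    (hk : Measurable fun p : Sector α β γ l × Y => k p.1 p.2) :
    ∃ K : ℝ × ℝ × ℝ → Y → ℂ, Measurable (fun p : (ℝ × ℝ × ℝ) × Y => K p.1 p.2) ∧
      ∀ x y, K x.1 y = k x y := by
  have hemb : MeasurableEmbedding fun p : Sector α β γ l × Y => (p.1.1, p.2) :=
    measurableEmbedding_val.prodMap MeasurableEmbedding.id
  refine ⟨fun x y => Function.extend (fun p : Sector α β γ l × Y => (p.1.1, p.2))
    (fun p => k p.1 p.2) 0 (x, y), hemb.measurable_extend hk measurable_zero, fun x y => ?_⟩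
  exact hemb.injective.extend_apply (fun p => k p.1 p.2) 0 (x, y)

/-- Parametrised Plancherel formula for functions on the sector. -/
theorem lintegral_lintegral_fourier (hα : α ≠ 0) {Y : Type*} [MeasurableSpace Y] (ν : Measure Y)
    {k : Sector α β γ l → Y → ℂ} (hk : Measurable fun p : Sector α β γ l × Y => k p.1 p.2)
    (h1 : ∀ᵐ y ∂ν, Integrable fun x => k x y)
    (h2 : ∫⁻ y, (∫⁻ x, ‖k x y‖ₑ ^ 2) ∂ν < ∞) :
    ∫⁻ y, (∫⁻ z, ‖∫ x, k x y * cis (dot3 x.1 z)‖ₑ ^ 2) ∂ν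
      = ENNReal.ofReal ((2 * Real.pi) ^ 3) * ∫⁻ y, (∫⁻ x, ‖k x y‖ₑ ^ 2) ∂ν := by
  obtain ⟨K, hK, hKk⟩ := exists_extension hk
  have e : ∀ y, ∫⁻ x, ‖k x y‖ₑ ^ 2 = ∫⁻ x, ‖K x y‖ₑ ^ 2 := fun y => by
    rw [← lintegral_val (β := β) (γ := γ) (l := l) hα]; simp only [hKk]
  have e' : ∀ y z, ∫ x, k x y * cis (dot3 x.1 z) = ∫ x, K x y * cis (dot3 x z) := fun y z => by
    rw [← integral_val (β := β) (γ := γ) (l := l) hα]; simp only [hKk]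
  simp only [e, e'] at h2 ⊢
  refine isPlancherelPairing_dot3.lintegral_lintegral_eq ν hK ?_ h2
  filter_upwards [h1] with y hy
  have hKy : Measurable fun x => K x y := hK.comp measurable_prodMk_right
  refine ⟨hKy.aestronglyMeasurable, ?_⟩
  rw [HasFiniteIntegral, ← lintegral_val (β := β) (γ := γ) (l := l) hα]
  simp only [hKk]
  exact hy.2

end Sector
/-! ## Phase space coordinates of the representations -/

/-- With `v = ((q₁, q₂), (p₁, p₂))`, the first and last outputs involve only `p₁, q₂` and the middle
two only `p₂, q₁`. The determinant is therefore a product of two 2×2 blocks. -/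
theorem LinearMap.det_prodProd (f : (ℝ × ℝ) × (ℝ × ℝ) →ₗ[ℝ] (ℝ × ℝ) × (ℝ × ℝ))
    (A B C E F G K : ℝ) (hf : ∀ v, f v = ((A * v.2.1 + B * v.1.2, A * v.2.2 + C * v.1.1),
      (E * v.2.2 + F * v.1.1, G * v.2.1 + K * v.1.2))) :
    LinearMap.det f = (A * K - B * G) * (A * F - C * E) := by
  rw [← LinearMap.det_toMatrix ((Module.Basis.finTwoProd ℝ).prod (Module.Basis.finTwoProd ℝ)),
    ← Matrix.det_reindex_self finSumFinEquiv]
  have : (Matrix.reindex finSumFinEquiv finSumFinEquiv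
      (LinearMap.toMatrix ((Module.Basis.finTwoProd ℝ).prod (Module.Basis.finTwoProd ℝ))
        ((Module.Basis.finTwoProd ℝ).prod (Module.Basis.finTwoProd ℝ)) f))
      = !![0, B, A, 0; C, 0, 0, A; F, 0, 0, E; 0, K, G, 0] := by
    ext i j
    have h0 : (finSumFinEquiv (m := 2) (n := 2)).symm 0 = Sum.inl 0 := rfl
    have h1 : (finSumFinEquiv (m := 2) (n := 2)).symm 1 = Sum.inl 1 := rfl
    have h2 : (finSumFinEquiv (m := 2) (n := 2)).symm 2 = Sum.inr 0 := rfl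
    have h3 : (finSumFinEquiv (m := 2) (n := 2)).symm 3 = Sum.inr 1 := rfl
    fin_cases i <;> fin_cases j <;>
      simp [h0, h1, h2, h3, LinearMap.toMatrix_apply, hf]
  rw [this]
  simp [Matrix.det_succ_row_zero, Fin.sum_univ_succ, Fin.succAbove]
  ring

instance : (volume : Measure ((ℝ × ℝ) × (ℝ × ℝ))).IsAddHaarMeasure :=
  inferInstanceAs ((volume : Measure (ℝ × ℝ)).prod volume).IsAddHaarMeasure

section Coordinates

variable {α β γ l : ℝ}

/-- The group element with central coordinates `z` and phase space coordinates `v`. -/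
def GNC.pair (z : ℝ × ℝ × ℝ) (v : (ℝ × ℝ) × (ℝ × ℝ)) : GNC α β γ := (z, v)

/-- The Pfaffian `ρ²α² - γβστ` of the symplectic form attached to a point of the sector. -/
def Sector.pf (x : Sector α β γ l) : ℝ := x.ρ ^ 2 * α ^ 2 - γ * β * x.σ * x.τ

theorem Sector.pf_ne_zero (x : Sector α β γ l) : x.pf ≠ 0 := x.2.2.2.2.1

/-- The frequency of the plane wave in the representation. -/
def repFreq (x : Sector α β γ l) (v : (ℝ × ℝ) × (ℝ × ℝ)) : ℝ × ℝ :=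
  (x.ρ * α * v.2.1 + l * x.τ * γ * v.1.2,
    x.ρ * α * v.2.2 + x.ρ ^ 2 * α ^ 2 * x.τ * γ * (1 - l)
      / (x.τ * γ * x.σ * β * l - x.ρ ^ 2 * α ^ 2) * v.1.1)

/-- The translation of the representation as a function of the phase space coordinates. -/
def repTrans (m : ℝ) (x : Sector α β γ l) (v : (ℝ × ℝ) × (ℝ × ℝ)) : ℝ × ℝ :=
  repShift m x (GNC.pair 0 v)

/-- The quadratic part of the phase of the representation. -/
def repQuad (m : ℝ) (x : Sector α β γ l) (v : (ℝ × ℝ) × (ℝ × ℝ)) : ℝ :=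
  repPhase m x (GNC.pair 0 v) 0

theorem repPhase_pair (m : ℝ) (x : Sector α β γ l) (z : ℝ × ℝ × ℝ) (v : (ℝ × ℝ) × (ℝ × ℝ))
    (r : ℝ × ℝ) : repPhase m x (GNC.pair z v) r
      = dot3 x.1 z + (repQuad m x v + GNC.dot r (repFreq x v)) := by
  simp only [repQuad, repPhase, dot3, GNC.dot, repFreq, GNC.pair, GNC.θ, GNC.φ, GNC.ψ, GNC.q,
    GNC.p, Sector.ρ, Sector.σ, Sector.τ, Prod.fst_zero, Prod.snd_zero]
  ring

theorem repShift_pair (m : ℝ) (x : Sector α β γ l) (z : ℝ × ℝ × ℝ) (v : (ℝ × ℝ) × (ℝ × ℝ)) :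
    repShift m x (GNC.pair z v) = repTrans m x v := rfl

/-- Frequency and translation together are linear coordinates on phase space, and the Jacobian is
the Pfaffian. This is the point where the gauge parameters cancel. -/
theorem exists_repEquiv (hα : α ≠ 0) (m : ℝ) (x : Sector α β γ l) :
    ∃ e : (ℝ × ℝ) × (ℝ × ℝ) ≃ᵐ (ℝ × ℝ) × (ℝ × ℝ),
      (∀ v, e v = (repFreq x v, repTrans m x v)) ∧
      Measure.map e volume = ENNReal.ofReal |x.pf|⁻¹ • volume := by
  have hρ : x.ρ ≠ 0 := x.2.1
  set D := x.τ * γ * x.σ * β * l - x.ρ ^ 2 * α ^ 2 with hDdef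
  have hD : D ≠ 0 := by
    intro h0
    apply x.2.2.2.2.2
    change γ * β * x.σ * x.τ * l = x.ρ ^ 2 * α ^ 2
    linarith
  let f : (ℝ × ℝ) × (ℝ × ℝ) →ₗ[ℝ] (ℝ × ℝ) × (ℝ × ℝ) :=
    { toFun := fun v => (repFreq x v, repTrans m x v)
      map_add' := fun v w => by
        simp only [repFreq, repTrans, repShift, GNC.pair, GNC.q, GNC.p, Prod.fst_add,
          Prod.snd_add, Prod.mk_add_mk]
        refine Prod.ext (Prod.ext ?_ ?_) (Prod.ext ?_ ?_) <;> dsimp only <;> ring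
      map_smul' := fun c v => by
        simp only [repFreq, repTrans, repShift, GNC.pair, GNC.q, GNC.p, Prod.smul_fst,
          Prod.smul_snd, Prod.smul_mk, smul_eq_mul, RingHom.id_apply]
        refine Prod.ext (Prod.ext ?_ ?_) (Prod.ext ?_ ?_) <;> dsimp only <;> ring }
  have hdet : LinearMap.det f = x.pf := by
    rw [LinearMap.det_prodProd f (x.ρ * α) (l * x.τ * γ) (x.ρ ^ 2 * α ^ 2 * x.τ * γ * (1 - l) / D)
      (-((1 - m) * x.σ * β / (x.ρ * α)))
      ((x.τ * γ * x.σ * β * (l + m - l * m) - x.ρ ^ 2 * α ^ 2) / D)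
      (m * x.σ * β / (x.ρ * α))
      (-((x.τ * γ * x.σ * β * l * (1 - m) - x.ρ ^ 2 * α ^ 2) / (x.ρ ^ 2 * α ^ 2)))
      (fun v => by
        simp only [f, LinearMap.coe_mk, AddHom.coe_mk, repFreq, repTrans, repShift, GNC.pair,
          GNC.q, GNC.p, hDdef]
        refine Prod.ext (Prod.ext ?_ ?_) (Prod.ext ?_ ?_) <;> dsimp only <;> ring)]
    -- The `(p₁, q₂)` block has determinant `-D / (ρα)`, which cancels the denominator `D` of the
    -- other block.
    have h1 : x.ρ * α * -((x.τ * γ * x.σ * β * l * (1 - m) - x.ρ ^ 2 * α ^ 2) / (x.ρ ^ 2 * α ^ 2))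
        - l * x.τ * γ * (m * x.σ * β / (x.ρ * α)) = -D / (x.ρ * α) := by
      rw [hDdef]; field_simp; ring
    rw [h1, Sector.pf]
    field_simp
    ring
  have hdet0 : LinearMap.det f ≠ 0 := hdet ▸ x.pf_ne_zero
  refine ⟨(LinearMap.equivOfDetNeZero f hdet0).toContinuousLinearEquiv.toHomeomorph.toMeasurableEquiv,
    fun v => rfl, ?_⟩
  have := Measure.map_linearMap_addHaar_eq_smul_addHaar (μ := volume) hdet0
  rw [hdet, abs_inv] at this
  exact this

theorem lintegral_repFreq_repTrans (hα : α ≠ 0) (m : ℝ) (x : Sector α β γ l)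
    {h : (ℝ × ℝ) → (ℝ × ℝ) → ℝ≥0∞} (hh : Measurable fun p : (ℝ × ℝ) × (ℝ × ℝ) => h p.1 p.2) :
    ∫⁻ v, h (repFreq x v) (repTrans m x v) = ENNReal.ofReal |x.pf|⁻¹ * ∫⁻ s, ∫⁻ a, h a s := by
  obtain ⟨e, he, hmap⟩ := exists_repEquiv hα m x
  have h1 : ∫⁻ v, h (repFreq x v) (repTrans m x v)
      = ∫⁻ p : (ℝ × ℝ) × (ℝ × ℝ), h p.1 p.2 ∂(Measure.map e volume) := by
    rw [lintegral_map hh e.measurable]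
    simp only [he]
  rw [h1, hmap, lintegral_smul_measure, smul_eq_mul, Measure.volume_eq_prod,
    lintegral_prod_symm' _ hh]

@[fun_prop] theorem measurable_repFreq :
    Measurable fun q : Sector α β γ l × ((ℝ × ℝ) × (ℝ × ℝ)) => repFreq q.1 q.2 := by
  unfold repFreq; fun_prop

@[fun_prop] theorem measurable_repTrans (m : ℝ) :
    Measurable fun q : Sector α β γ l × ((ℝ × ℝ) × (ℝ × ℝ)) => repTrans m q.1 q.2 := by
  unfold repTrans repShift GNC.pair GNC.q GNC.p; fun_prop

@[fun_prop] theorem measurable_repQuad (m : ℝ) :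
    Measurable fun q : Sector α β γ l × ((ℝ × ℝ) × (ℝ × ℝ)) => repQuad m q.1 q.2 := by
  unfold repQuad repPhase GNC.pair GNC.q GNC.p GNC.θ GNC.φ GNC.ψ; fun_prop

end Coordinates
/-! ## Matrix coefficients -/

section Coefficients

variable {α β γ l : ℝ}

/-- Orthonormal vectors lie at distance `√2` from each other, so balls of radius `1/2` around them
are disjoint. Countability of the basis is needed for measurable sums and for almost everywhere
statements about all basis vectors at once. -/
theorem Orthonormal.countable_of_separable {H ι : Type*} [NormedAddCommGroup H]
    [InnerProductSpace ℂ H] [TopologicalSpace.SeparableSpace H] {v : ι → H}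
    (hv : Orthonormal ℂ v) : Countable ι := by
  have hd : Pairwise (Function.onFun Disjoint fun i => Metric.ball (v i) (1 / 2)) := by
    intro i j hij
    refine Metric.ball_disjoint_ball ?_
    have h1 : ‖v i - v j‖ ^ 2 = 2 := by
      rw [@norm_sub_sq ℂ, hv.inner_eq_zero hij, hv.norm_eq_one, hv.norm_eq_one]
      norm_num
    rw [dist_eq_norm]
    nlinarith [norm_nonneg (v i - v j)]
  have := Set.PairwiseDisjoint.countable_of_isOpen (s := fun i => Metric.ball (v i) (1 / 2))
    (a := Set.univ) (fun i _ j _ hij => hd hij) (fun i _ => Metric.isOpen_ball)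
    (fun i _ => Metric.nonempty_ball.2 (by norm_num))
  exact Set.countable_univ_iff.1 this

instance : SecondCountableTopology L2Plane :=
  haveI : Fact ((2 : ℝ≥0∞) ≠ ∞) := ⟨by norm_num⟩
  Lp.SecondCountableTopology

instance : Countable (chosenIndex L2Plane) :=
  (chosenBasis L2Plane).orthonormal.countable_of_separable

theorem L2Plane.measurable (u : L2Plane) : Measurable u := (Lp.stronglyMeasurable u).measurable

theorem L2Plane.lintegral_enorm_sq (u : L2Plane) : ∫⁻ r, ‖u r‖ₑ ^ 2 = ‖u‖ₑ ^ 2 := by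
  rw [← eLpNorm_two_sq, Lp.enorm_def]

theorem gaugeRep_apply (hα : α ≠ 0) (m : ℝ) (x : Sector α β γ l) (g : GNC α β γ) (u : L2Plane) :
    (gaugeRep hα m x g : L2Plane →L[ℂ] L2Plane) u = repIsometry m x g u := rfl

theorem coeFn_gaugeRep (hα : α ≠ 0) (m : ℝ) (x : Sector α β γ l) (z : ℝ × ℝ × ℝ)
    (v : (ℝ × ℝ) × (ℝ × ℝ)) (u : L2Plane) :
    ((gaugeRep hα m x (GNC.pair z v) : L2Plane →L[ℂ] L2Plane) u : ℝ × ℝ → ℂ) =ᵐ[volume]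
      fun r => cis (dot3 x.1 z + (repQuad m x v + GNC.dot r (repFreq x v)))
        * u (r + repTrans m x v) := by
  rw [gaugeRep_apply, repIsometry_apply]
  filter_upwards [MemLp.coeFn_toLp (repFun_memLp m x (GNC.pair z v) (Lp.memLp u))] with r hr
  rw [hr, repFun, repPhase_pair, repShift_pair, cis]

/-- Up to unimodular factors the coefficient is a cross-ambiguity function: the Fourier transform in
`r` of `conj (w r) * u (r + s)` at the frequency attached to `v`. Plancherel on `ℝ²` therefore
applies for each translation `s`. -/
theorem inner_gaugeRep_eq_integral (hα : α ≠ 0) (m : ℝ) (x : Sector α β γ l) (z : ℝ × ℝ × ℝ)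
    (v : (ℝ × ℝ) × (ℝ × ℝ)) (u w : L2Plane) :
    ⟪w, (gaugeRep hα m x (GNC.pair z v) : L2Plane →L[ℂ] L2Plane) u⟫_ℂ
      = cis (dot3 x.1 z) * (cis (repQuad m x v) * ∫ r, starRingEnd ℂ (w r)
          * u (r + repTrans m x v) * cis (GNC.dot r (repFreq x v))) := by
  rw [L2.inner_def, ← integral_const_mul, ← integral_const_mul]
  refine integral_congr_ae ?_
  filter_upwards [coeFn_gaugeRep hα m x z v u] with r hr
  rw [hr, RCLike.inner_apply, cis_add, cis_add]
  ring

theorem inner_gaugeRep_pair (hα : α ≠ 0) (m : ℝ) (x : Sector α β γ l) (z : ℝ × ℝ × ℝ)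
    (v : (ℝ × ℝ) × (ℝ × ℝ)) (u w : L2Plane) :
    ⟪w, (gaugeRep hα m x (GNC.pair z v) : L2Plane →L[ℂ] L2Plane) u⟫_ℂ = cis (dot3 x.1 z)
      * ⟪w, (gaugeRep hα m x (GNC.pair 0 v) : L2Plane →L[ℂ] L2Plane) u⟫_ℂ := by
  rw [inner_gaugeRep_eq_integral, inner_gaugeRep_eq_integral]
  simp [dot3]

theorem gaugeRep_pair_apply (hα : α ≠ 0) (m : ℝ) (x : Sector α β γ l) (z : ℝ × ℝ × ℝ)
    (v : (ℝ × ℝ) × (ℝ × ℝ)) (u : L2Plane) :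
    (gaugeRep hα m x (GNC.pair z v) : L2Plane →L[ℂ] L2Plane) u = cis (dot3 x.1 z)
      • (gaugeRep hα m x (GNC.pair 0 v) : L2Plane →L[ℂ] L2Plane) u :=
  ext_inner_left ℂ fun w => by rw [inner_gaugeRep_pair, inner_smul_right]

/-- Matrix coefficients are jointly measurable. -/
theorem measurable_inner_gaugeRep (hα : α ≠ 0) (m : ℝ) (u w : L2Plane) :
    Measurable fun q : Sector α β γ l × ((ℝ × ℝ × ℝ) × ((ℝ × ℝ) × (ℝ × ℝ))) =>
      ⟪w, (gaugeRep hα m q.1 (GNC.pair q.2.1 q.2.2) : L2Plane →L[ℂ] L2Plane) u⟫_ℂ := by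
  simp only [inner_gaugeRep_eq_integral]
  have hu := u.measurable
  have hw := w.measurable
  have hI : StronglyMeasurable fun q : (Sector α β γ l × ((ℝ × ℝ × ℝ) × ((ℝ × ℝ) × (ℝ × ℝ))))
      × (ℝ × ℝ) => starRingEnd ℂ (w q.2) * u (q.2 + repTrans m q.1.1 q.1.2.2)
        * cis (GNC.dot q.2 (repFreq q.1.1 q.1.2.2)) := by
    have hcu : Measurable fun r => starRingEnd ℂ (w r) := measurable_conj.comp hw
    exact Measurable.stronglyMeasurable (by fun_prop)
  have h1 : Measurable fun q : Sector α β γ l × ((ℝ × ℝ × ℝ) × ((ℝ × ℝ) × (ℝ × ℝ))) =>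
      dot3 q.1.1 q.2.1 := by fun_prop
  have h2 : Measurable fun q : Sector α β γ l × ((ℝ × ℝ × ℝ) × ((ℝ × ℝ) × (ℝ × ℝ))) =>
      repQuad m q.1 q.2.2 := by fun_prop
  exact (measurable_cis.comp h1).mul ((measurable_cis.comp h2).mul
    hI.integral_prod_right.measurable)

theorem Measurable.inner_gaugeRep (hα : α ≠ 0) (m : ℝ) (u w : L2Plane) {Y : Type*}
    [MeasurableSpace Y] {f : Y → Sector α β γ l} (hf : Measurable f) {z : Y → ℝ × ℝ × ℝ}
    (hz : Measurable z) {v : Y → (ℝ × ℝ) × (ℝ × ℝ)} (hv : Measurable v) :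
    Measurable fun q =>
      ⟪w, (gaugeRep hα m (f q) (GNC.pair (z q) (v q)) : L2Plane →L[ℂ] L2Plane) u⟫_ℂ := by
  have key : ∀ F : Sector α β γ l → GNC α β γ → ℂ,
      Measurable (fun q : Sector α β γ l × ((ℝ × ℝ × ℝ) × ((ℝ × ℝ) × (ℝ × ℝ))) =>
        F q.1 (GNC.pair q.2.1 q.2.2)) → Measurable fun q => F (f q) (GNC.pair (z q) (v q)) :=
    fun F hF => hF.comp (hf.prodMk (hz.prodMk hv))
  have h2 := key (fun x g => ⟪w, (gaugeRep hα m x g : L2Plane →L[ℂ] L2Plane) u⟫_ℂ)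
  exact h2 (measurable_inner_gaugeRep hα m u w)

/-- `∫ |∑ cᵢ eᵢ|² = ∑ |cᵢ|²` for orthonormal `eᵢ`. -/
theorem lintegral_enorm_sq_sum_orthonormal {ι : Type*} {e : ι → L2Plane} (he : Orthonormal ℂ e)
    (S : Finset ι) (c : ι → ℂ) :
    ∫⁻ r, ‖∑ i ∈ S, c i * e i r‖ₑ ^ 2 = ∑ i ∈ S, ‖c i‖ₑ ^ 2 := by
  have h1 : ∀ᵐ r : ℝ × ℝ, (∑ i ∈ S, c i • e i : L2Plane) r = ∑ i ∈ S, c i * e i r := by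
    classical
    induction S using Finset.induction_on with
    | empty => simp
    | insert a S ha ih =>
      rw [Finset.sum_insert ha]
      filter_upwards [ih, Lp.coeFn_add (c a • e a) (∑ i ∈ S, c i • e i),
        Lp.coeFn_smul (c a) (e a)] with r h1 h2 h3
      rw [h2, Pi.add_apply, h1, h3, Finset.sum_insert ha]
      simp
  have h2 : ∫⁻ r, ‖∑ i ∈ S, c i * e i r‖ₑ ^ 2 = ‖(∑ i ∈ S, c i • e i : L2Plane)‖ₑ ^ 2 := by
    rw [← L2Plane.lintegral_enorm_sq]
    refine lintegral_congr_ae ?_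
    filter_upwards [h1] with r hr
    rw [hr]
  have h3 : ‖(∑ i ∈ S, c i • e i : L2Plane)‖ ^ 2 = ∑ i ∈ S, ‖c i‖ ^ 2 := by
    have := he.inner_sum c c S
    rw [inner_self_eq_norm_sq_to_K] at this
    have h4 : ((‖(∑ i ∈ S, c i • e i : L2Plane)‖ ^ 2 : ℝ) : ℂ)
        = ((∑ i ∈ S, ‖c i‖ ^ 2 : ℝ) : ℂ) := by
      push_cast
      rw [← RCLike.ofReal_eq_complex_ofReal, this]
      refine Finset.sum_congr rfl fun i _ => ?_
      rw [RCLike.conj_mul]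
    exact_mod_cast h4
  rw [h2, ← ofReal_norm, ← ENNReal.ofReal_pow (norm_nonneg _), h3,
    ENNReal.ofReal_sum_of_nonneg fun i _ => by positivity]
  refine Finset.sum_congr rfl fun i _ => ?_
  rw [ENNReal.ofReal_pow (norm_nonneg _), ofReal_norm]

/-- Orthogonality relations for the matrix coefficients, on finite sums. -/
theorem lintegral_enorm_sq_sum_inner_gaugeRep (hα : α ≠ 0) (m : ℝ) (x : Sector α β γ l)
    {ι : Type*} {e : ι → L2Plane} (he : Orthonormal ℂ e) (w : ι → L2Plane) (S : Finset ι) :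
    ∫⁻ v, ‖∑ i ∈ S, ⟪w i, (gaugeRep hα m x (GNC.pair 0 v) : L2Plane →L[ℂ] L2Plane) (e i)⟫_ℂ‖ₑ ^ 2
      = ENNReal.ofReal ((2 * Real.pi) ^ 2 * |x.pf|⁻¹) * ∑ i ∈ S, ‖w i‖ₑ ^ 2 := by
  have hem := fun i => (e i).measurable
  have hwm := fun i => (w i).measurable
  set k : (ℝ × ℝ) → (ℝ × ℝ) → ℂ :=
    fun r s => ∑ i ∈ S, starRingEnd ℂ (w i r) * e i (r + s) with hk
  have hkm : Measurable fun p : (ℝ × ℝ) × (ℝ × ℝ) => k p.1 p.2 := by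
    refine Finset.measurable_sum _ fun i _ => Measurable.mul ?_ ?_
    · exact measurable_conj.comp ((hwm i).comp measurable_fst)
    · exact (hem i).comp (measurable_fst.add measurable_snd)
  have hint : ∀ s, ∀ i, Integrable fun r => starRingEnd ℂ (w i r) * e i (r + s) := by
    intro s i
    have h1 : MemLp (fun r => starRingEnd ℂ (w i r)) 2 := (Lp.memLp (w i)).star
    have h2 : MemLp (fun r => e i (r + s)) 2 :=
      (Lp.memLp (e i)).comp_measurePreserving (measurePreserving_add_right volume s)
    exact h1.integrable_mul h2
  have hk1 : ∀ s, Integrable fun r => k r s := fun s =>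
    integrable_finsetSum _ fun i _ => hint s i
  have hk2 : ∫⁻ s, ∫⁻ r, ‖k r s‖ₑ ^ 2 = ∑ i ∈ S, ‖w i‖ₑ ^ 2 := by
    rw [lintegral_lintegral_swap
      ((hkm.comp measurable_swap).enorm.pow_const 2).aemeasurable]
    -- For fixed `r` the substitution `t = r + s` leaves a linear combination of the `e i` in `t`
    -- with coefficients `conj (w i r)`; orthonormality removes the cross terms before any
    -- integration in `r`.
    have : ∀ r, ∫⁻ s, ‖k r s‖ₑ ^ 2 = ∑ i ∈ S, ‖w i r‖ₑ ^ 2 := by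
      intro r
      rw [lintegral_add_left_eq_self (fun t => ‖∑ i ∈ S, starRingEnd ℂ (w i r) * e i t‖ₑ ^ 2) r,
        lintegral_enorm_sq_sum_orthonormal he]
      simp only [enorm_conj]
    simp only [this]
    rw [lintegral_finsetSum _ fun i _ => (hwm i).enorm.pow_const 2]
    simp only [L2Plane.lintegral_enorm_sq]
  have hfin : ∑ i ∈ S, ‖w i‖ₑ ^ 2 < ∞ :=
    ENNReal.sum_lt_top.2 fun i _ => ENNReal.pow_lt_top (by simp)
  have e1 := isPlancherelPairing_dot.lintegral_lintegral_eq volume hkm (.of_forall hk1)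
    (hk2 ▸ hfin)
  have hGm : Measurable fun p : (ℝ × ℝ) × (ℝ × ℝ) =>
      ‖∫ r, k r p.2 * cis (GNC.dot r p.1)‖ₑ ^ 2 := by
    have : StronglyMeasurable fun q : ((ℝ × ℝ) × (ℝ × ℝ)) × (ℝ × ℝ) =>
        k q.2 q.1.2 * cis (GNC.dot q.2 q.1.1) := by
      clear_value k
      exact Measurable.stronglyMeasurable (by fun_prop)
    exact this.integral_prod_right.measurable.enorm.pow_const 2
  have e2 := lintegral_repFreq_repTrans hα m x
    (h := fun a s => ‖∫ r, k r s * cis (GNC.dot r a)‖ₑ ^ 2) hGm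
  rw [e1, hk2] at e2
  rw [ENNReal.ofReal_mul (by positivity), mul_comm (ENNReal.ofReal ((2 * Real.pi) ^ 2)), mul_assoc,
    ← e2]
  refine lintegral_congr fun v => ?_
  congr 1
  simp only [inner_gaugeRep_eq_integral]
  rw [← Finset.mul_sum, ← Finset.mul_sum, enorm_mul, enorm_mul, enorm_cis, enorm_cis, one_mul,
    one_mul, ← integral_finsetSum]
  · simp only [hk, Finset.sum_mul]
  · intro i _
    refine (hint (repTrans m x v) i).mono ?_ (.of_forall fun r => by simp)
    exact (hint _ i).aestronglyMeasurable.mul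
      (measurable_cis.comp (by fun_prop)).aestronglyMeasurable

end Coefficients

/-! ## Countable sums of orthogonal functions -/

/-- The hypothesis `h` says that finite partial sums satisfy Pythagoras with squared norms `n i`.
Fatou bounds the remainder after `S` by the tail of `∑ n i`, so the partial sums converge in `L²` to
the pointwise sum. No dominating function is required. -/
theorem lintegral_enorm_sq_tsum {ι X : Type*} [Countable ι] [MeasurableSpace X] {μ : Measure X}
    {f : ι → X → ℂ} (hf : ∀ i, Measurable (f i)) {n : ι → ℝ≥0∞} (hn : ∑' i, n i ≠ ∞)
    (h : ∀ S : Finset ι, ∫⁻ x, ‖∑ i ∈ S, f i x‖ₑ ^ 2 ∂μ = ∑ i ∈ S, n i)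
    (hs : ∀ᵐ x ∂μ, Summable fun i => f i x) :
    ∫⁻ x, ‖∑' i, f i x‖ₑ ^ 2 ∂μ = ∑' i, n i := by
  have hF : Measurable fun x => ∑' i, f i x := Measurable.tsum hf
  -- Fatou's lemma needs a sequence; countability of `ι` provides a cofinal one of finite sets.
  obtain ⟨T, hT⟩ := Filter.exists_seq_tendsto (Filter.atTop : Filter (Finset ι))
  have hFS : ∀ S : Finset ι, Measurable fun x => ∑ i ∈ S, f i x := fun S =>
    Finset.measurable_sum S fun i _ => hf i
  classical
  have key : ∀ S : Finset ι, ∫⁻ x, ‖∑' i, f i x - ∑ i ∈ S, f i x‖ₑ ^ 2 ∂μ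
      ≤ ∑' i, n i - ∑ i ∈ S, n i := by
    intro S
    have hlim : ∀ᵐ x ∂μ, ‖∑' i, f i x - ∑ i ∈ S, f i x‖ₑ ^ 2
        = Filter.liminf (fun k => ‖∑ i ∈ T k, f i x - ∑ i ∈ S, f i x‖ₑ ^ 2) Filter.atTop := by
      filter_upwards [hs] with x hx
      refine (Filter.Tendsto.liminf_eq ?_).symm
      exact ((ENNReal.continuous_pow 2).tendsto _).comp
        (((hx.hasSum.comp hT).sub_const _).enorm)
    rw [lintegral_congr_ae hlim]
    refine (lintegral_liminf_le fun k => ((hFS _).sub (hFS _)).enorm.pow_const 2).trans ?_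
    refine Filter.liminf_le_of_frequently_le' (Filter.Eventually.frequently ?_)
    filter_upwards [hT.eventually (Filter.eventually_ge_atTop S)] with k hk
    have : ∀ x, ∑ i ∈ T k, f i x - ∑ i ∈ S, f i x = ∑ i ∈ T k \ S, f i x := fun x => by
      rw [← Finset.sum_sdiff hk]; ring
    have e1 : ∫⁻ x, ‖∑ i ∈ T k, f i x - ∑ i ∈ S, f i x‖ₑ ^ 2 ∂μ = ∑ i ∈ T k \ S, n i := by
      rw [← h]; simp only [this]
    refine e1.le.trans ?_
    refine ENNReal.le_sub_of_add_le_left ?_ ?_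
    · exact ((ENNReal.sum_le_tsum S).trans_lt hn.lt_top).ne
    · rw [add_comm, Finset.sum_sdiff hk]
      exact ENNReal.sum_le_tsum _
  -- The upper bound is the remainder estimate for `S = ∅`. The lower bound is the triangle
  -- inequality in `L²` followed by the limit over `S`.
  refine le_antisymm (by simpa using key ∅) ?_
  have hle : ∀ S : Finset ι, (∑ i ∈ S, n i) ^ (1 / 2 : ℝ)
      ≤ (∫⁻ x, ‖∑' i, f i x‖ₑ ^ 2 ∂μ) ^ (1 / 2 : ℝ)
        + (∑' i, n i - ∑ i ∈ S, n i) ^ (1 / 2 : ℝ) := by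
    intro S
    have hsq : ∀ g : X → ℂ, (∫⁻ x, ‖g x‖ₑ ^ 2 ∂μ) ^ (1 / 2 : ℝ) = eLpNorm g 2 μ := fun g => by
      rw [← eLpNorm_two_sq, ← ENNReal.rpow_natCast, ← ENNReal.rpow_mul]; simp
    have key2 := ENNReal.rpow_le_rpow (key S) (by norm_num : (0 : ℝ) ≤ 1 / 2)
    rw [hsq] at key2
    conv_lhs => rw [← h S]
    rw [hsq, hsq]
    have e1 : (fun x => ∑ i ∈ S, f i x)
        = (fun x => ∑' i, f i x) - fun x => ∑' i, f i x - ∑ i ∈ S, f i x := by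
      funext x; simp
    rw [e1]
    refine (eLpNorm_sub_le hF.aestronglyMeasurable (hF.sub (hFS S)).aestronglyMeasurable
      (by norm_num)).trans ?_
    exact add_le_add le_rfl key2
  have hlim1 : Filter.Tendsto (fun S : Finset ι => (∑ i ∈ S, n i) ^ (1 / 2 : ℝ)) Filter.atTop
      (nhds ((∑' i, n i) ^ (1 / 2 : ℝ))) :=
    ((ENNReal.continuous_rpow_const).tendsto _).comp ENNReal.summable.hasSum
  have hlim2 : Filter.Tendsto (fun S : Finset ι => (∫⁻ x, ‖∑' i, f i x‖ₑ ^ 2 ∂μ) ^ (1 / 2 : ℝ)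
      + (∑' i, n i - ∑ i ∈ S, n i) ^ (1 / 2 : ℝ)) Filter.atTop
      (nhds ((∫⁻ x, ‖∑' i, f i x‖ₑ ^ 2 ∂μ) ^ (1 / 2 : ℝ) + 0)) := by
    refine tendsto_const_nhds.add ?_
    have : Filter.Tendsto (fun S : Finset ι => ∑' i, n i - ∑ i ∈ S, n i) Filter.atTop
        (nhds (∑' i, n i - ∑' i, n i)) :=
      ENNReal.Tendsto.sub tendsto_const_nhds ENNReal.summable.hasSum (Or.inl hn)
    rw [tsub_self] at this
    have h0 := ((ENNReal.continuous_rpow_const (y := 1 / 2)).tendsto 0).comp this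
    rwa [ENNReal.zero_rpow_of_pos (by norm_num)] at h0
  have := le_of_tendsto_of_tendsto' hlim1 hlim2 hle
  rw [add_zero] at this
  exact (ENNReal.rpow_le_rpow_iff (by norm_num)).1 this
/-! ## Measurable fields of operators -/

section Fields

theorem HilbertBasis.tsum_enorm_inner_sq {H ι : Type*} [NormedAddCommGroup H]
    [InnerProductSpace ℂ H] (b : HilbertBasis ι ℂ H) (u : H) :
    ∑' i, ‖⟪b i, u⟫_ℂ‖ₑ ^ 2 = ‖u‖ₑ ^ 2 := by
  have h := b.hasSum_inner_mul_inner u u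
  have h1 : ∀ i, ⟪u, b i⟫_ℂ * ⟪b i, u⟫_ℂ = ((‖⟪b i, u⟫_ℂ‖ ^ 2 : ℝ) : ℂ) := fun i => by
    rw [← inner_conj_symm u, RCLike.conj_mul]; simp
  have h2 : ⟪u, u⟫_ℂ = ((‖u‖ ^ 2 : ℝ) : ℂ) := by rw [inner_self_eq_norm_sq_to_K]; simp
  simp only [h1, h2] at h
  have h3 := Complex.hasSum_ofReal.1 h
  have h4 : ∀ z : H, ‖z‖ₑ ^ 2 = ENNReal.ofReal (‖z‖ ^ 2) := fun z => by
    rw [ENNReal.ofReal_pow (norm_nonneg _), ofReal_norm]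
  have h5 : ∀ z : ℂ, ‖z‖ₑ ^ 2 = ENNReal.ofReal (‖z‖ ^ 2) := fun z => by
    rw [ENNReal.ofReal_pow (norm_nonneg _), ofReal_norm]
  simp only [h4, h5]
  rw [← h3.tsum_eq, ENNReal.ofReal_tsum_of_nonneg (fun i => by positivity) h3.summable]

/-- The Hilbert–Schmidt norm does not depend on the basis on the left. -/
theorem hsNormSq_eq_tsum_tsum {H : Type*} [NormedAddCommGroup H] [InnerProductSpace ℂ H]
    [CompleteSpace H] (T : H → H) :
    hsNormSq T = ∑' i, ∑' j, ‖⟪chosenBasis H j, T (chosenBasis H i)⟫_ℂ‖ₑ ^ 2 := by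
  simp only [hsNormSq, HilbertBasis.tsum_enorm_inner_sq]

theorem measurable_hsNormSq {X : Type*} [MeasurableSpace X] {A : X → L2Plane → L2Plane}
    (hA : ∀ u v, Measurable fun x => ⟪u, A x v⟫_ℂ) : Measurable fun x => hsNormSq (A x) := by
  simp only [hsNormSq_eq_tsum_tsum]
  exact Measurable.tsum fun i => Measurable.tsum fun j => (hA _ _).enorm.pow_const 2

variable {α β γ l : ℝ}

/-- The matrix entry `⟪U_x(z, v) eᵢ, A eᵢ⟫`. -/
def fieldEntry (hα : α ≠ 0) (m : ℝ) (A : Sector α β γ l → L2Plane →L[ℂ] L2Plane)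
    (i : chosenIndex L2Plane) (x : Sector α β γ l) (z : ℝ × ℝ × ℝ)
    (v : (ℝ × ℝ) × (ℝ × ℝ)) : ℂ :=
  ⟪(gaugeRep hα m x (GNC.pair z v) : L2Plane →L[ℂ] L2Plane) (chosenBasis L2Plane i),
    A x (chosenBasis L2Plane i)⟫_ℂ

theorem fieldEntry_pair (hα : α ≠ 0) (m : ℝ) (A : Sector α β γ l → L2Plane →L[ℂ] L2Plane)
    (i : chosenIndex L2Plane) (x : Sector α β γ l) (z : ℝ × ℝ × ℝ) (v : (ℝ × ℝ) × (ℝ × ℝ)) :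
    fieldEntry hα m A i x z v = cis (-dot3 x.1 z) * fieldEntry hα m A i x 0 v := by
  rw [fieldEntry, gaugeRep_pair_apply, inner_smul_left, conj_cis, fieldEntry]

/-- Both vectors of the inner product vary, so weak measurability does not apply directly. Expanding
in the basis leaves products of entries against fixed vectors. -/
theorem measurable_fieldEntry (hα : α ≠ 0) (m : ℝ)
    {A : Sector α β γ l → L2Plane →L[ℂ] L2Plane} (hA : IsMeasurableField A)
    (i : chosenIndex L2Plane) {Y : Type*} [MeasurableSpace Y] {f : Y → Sector α β γ l}
    (hf : Measurable f) {z : Y → ℝ × ℝ × ℝ} (hz : Measurable z)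
    {v : Y → (ℝ × ℝ) × (ℝ × ℝ)} (hv : Measurable v) :
    Measurable fun y => fieldEntry hα m A i (f y) (z y) (v y) := by
  have h : ∀ y, fieldEntry hα m A i (f y) (z y) (v y)
      = ∑' j, starRingEnd ℂ ⟪chosenBasis L2Plane j,
          (gaugeRep hα m (f y) (GNC.pair (z y) (v y)) : L2Plane →L[ℂ] L2Plane)
            (chosenBasis L2Plane i)⟫_ℂ
          * ⟪chosenBasis L2Plane j, A (f y) (chosenBasis L2Plane i)⟫_ℂ := fun y => by
    rw [fieldEntry, ← (chosenBasis L2Plane).tsum_inner_mul_inner]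
    simp only [inner_conj_symm]
  simp only [h]
  refine Measurable.tsum fun j => ?_
  have h1 := Measurable.inner_gaugeRep hα m (chosenBasis L2Plane i) (chosenBasis L2Plane j)
    hf hz hv
  have h2 := (hA (chosenBasis L2Plane j) (chosenBasis L2Plane i)).comp hf
  exact (measurable_conj.comp h1).mul h2

/-- A square integrable field for which the inverse transform converges absolutely. -/
structure IsTransformableField (hα : α ≠ 0) (m : ℝ)
    (A : Sector α β γ l → L2Plane →L[ℂ] L2Plane) : Prop where
  measurable : IsMeasurableField A
  hilbertSchmidt : ∫⁻ x, hsNormSq (A x) ∂(sectorPlancherel α β γ l) < ∞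
  summable : ∀ z v, ∫⁻ x, ∑' i, ‖fieldEntry hα m A i x z v‖ₑ ∂(sectorPlancherel α β γ l) < ∞

/-- The value at `(z, v)` of the inverse transform of a field of operators. -/
def inverseTransform (hα : α ≠ 0) (m : ℝ) (A : Sector α β γ l → L2Plane →L[ℂ] L2Plane)
    (z : ℝ × ℝ × ℝ) (v : (ℝ × ℝ) × (ℝ × ℝ)) : ℂ :=
  ∫ x, ∑' i, fieldEntry hα m A i x z v ∂(sectorPlancherel α β γ l)

theorem measurable_density : Measurable fun x : Sector α β γ l =>
    ENNReal.ofReal (|x.ρ ^ 2 * α ^ 2 - γ * β * x.σ * x.τ| / α ^ 2) := by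
  fun_prop

theorem measurable_pf : Measurable fun x : Sector α β γ l => x.pf := by
  unfold Sector.pf; fun_prop

instance : SigmaFinite (sectorPlancherel α β γ l) := by
  unfold sectorPlancherel
  exact SigmaFinite.withDensity_ofReal _

/-- The density vanishes nowhere on the sector, since the Pfaffian is nonzero there. -/
theorem ae_sectorPlancherel_iff (hα : α ≠ 0) {p : Sector α β γ l → Prop} :
    (∀ᵐ x ∂(sectorPlancherel α β γ l), p x) ↔ ∀ᵐ x : Sector α β γ l, p x := by
  rw [sectorPlancherel, ae_withDensity_iff measurable_density]
  have : ∀ x : Sector α β γ l,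
      ENNReal.ofReal (|x.ρ ^ 2 * α ^ 2 - γ * β * x.σ * x.τ| / α ^ 2) ≠ 0 := fun x => by
    have := x.pf_ne_zero
    rw [Sector.pf] at this
    have : 0 < |x.ρ ^ 2 * α ^ 2 - γ * β * x.σ * x.τ| := abs_pos.2 this
    rw [ne_eq, ENNReal.ofReal_eq_zero, not_le]
    positivity
  simp [this]

theorem lintegral_sectorPlancherel (G : Sector α β γ l → ℝ≥0∞) :
    ∫⁻ x, G x ∂(sectorPlancherel α β γ l)
      = ∫⁻ x : Sector α β γ l, ENNReal.ofReal (|x.pf| / α ^ 2) * G x := by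
  rw [sectorPlancherel, lintegral_withDensity_eq_lintegral_mul_non_measurable _ measurable_density
    (.of_forall fun x => ENNReal.ofReal_lt_top)]
  rfl

theorem integral_sectorPlancherel (G : Sector α β γ l → ℂ) :
    ∫ x, G x ∂(sectorPlancherel α β γ l) = ∫ x : Sector α β γ l, ((|x.pf| / α ^ 2 : ℝ) : ℂ) * G x := by
  rw [sectorPlancherel, integral_withDensity_eq_integral_toReal_smul measurable_density
    (.of_forall fun x => ENNReal.ofReal_lt_top)]
  refine integral_congr_ae (.of_forall fun x => ?_)
  simp only
  rw [ENNReal.toReal_ofReal (by positivity), Complex.real_smul]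
  rfl

theorem measurable_tsum_fieldEntry (hα : α ≠ 0) (m : ℝ)
    {A : Sector α β γ l → L2Plane →L[ℂ] L2Plane} (hA : IsMeasurableField A)
    {Y : Type*} [MeasurableSpace Y] {f : Y → Sector α β γ l}
    (hf : Measurable f) {z : Y → ℝ × ℝ × ℝ} (hz : Measurable z)
    {v : Y → (ℝ × ℝ) × (ℝ × ℝ)} (hv : Measurable v) :
    Measurable fun y => ∑' i, fieldEntry hα m A i (f y) (z y) (v y) :=
  Measurable.tsum fun i => measurable_fieldEntry hα m hA i hf hz hv

theorem measurable_inverseTransform (hα : α ≠ 0) (m : ℝ)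
    {A : Sector α β γ l → L2Plane →L[ℂ] L2Plane} (hA : IsMeasurableField A) :
    Measurable fun q : (ℝ × ℝ × ℝ) × ((ℝ × ℝ) × (ℝ × ℝ)) => inverseTransform hα m A q.1 q.2 := by
  have h := measurable_tsum_fieldEntry hα m hA
    (Y := ((ℝ × ℝ × ℝ) × ((ℝ × ℝ) × (ℝ × ℝ))) × Sector α β γ l) (f := fun q => q.2)
    (z := fun q => q.1.1) (v := fun q => q.1.2) (by fun_prop) (by fun_prop) (by fun_prop)
  exact h.stronglyMeasurable.integral_prod_right.measurable

theorem enorm_tsum_le {ι : Type*} (f : ι → ℂ) : ‖∑' i, f i‖ₑ ≤ ∑' i, ‖f i‖ₑ := by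
  by_cases h : ∑' i, ‖f i‖ₑ = ∞
  · rw [h]; exact le_top
  · have hs : Summable fun i => ‖f i‖ := by
      have := ENNReal.tsum_coe_ne_top_iff_summable.1 h
      exact NNReal.summable_coe.2 this
    rw [← ofReal_norm]
    calc ENNReal.ofReal ‖∑' i, f i‖ ≤ ENNReal.ofReal (∑' i, ‖f i‖) :=
          ENNReal.ofReal_le_ofReal (norm_tsum_le_tsum_norm hs)
      _ = ∑' i, ‖f i‖ₑ := by
          rw [ENNReal.ofReal_tsum_of_nonneg (fun i => norm_nonneg _) hs]
          simp only [ofReal_norm]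

theorem summable_of_tsum_enorm_lt_top {ι : Type*} {f : ι → ℂ} (h : ∑' i, ‖f i‖ₑ < ∞) :
    Summable f :=
  Summable.of_norm (NNReal.summable_coe.2 (ENNReal.tsum_coe_ne_top_iff_summable.1 h.ne))

theorem IsTransformableField.integrable {hα : α ≠ 0} {m : ℝ}
    {A : Sector α β γ l → L2Plane →L[ℂ] L2Plane} (hA : IsTransformableField hα m A)
    (z : ℝ × ℝ × ℝ) (v : (ℝ × ℝ) × (ℝ × ℝ)) :
    Integrable (fun x => ∑' i, fieldEntry hα m A i x z v) (sectorPlancherel α β γ l) := by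
  refine ⟨(measurable_tsum_fieldEntry hα m hA.measurable measurable_id measurable_const
    measurable_const).aestronglyMeasurable, ?_⟩
  exact (lintegral_mono fun x => enorm_tsum_le _).trans_lt (hA.summable z v)

/-- The orthogonality relations at one point of the sector. -/
theorem lintegral_enorm_sq_tsum_fieldEntry (hα : α ≠ 0) (m : ℝ)
    {A : Sector α β γ l → L2Plane →L[ℂ] L2Plane} (hA : IsMeasurableField A) (x : Sector α β γ l)
    (hhs : hsNormSq (A x) ≠ ∞) (hs : ∀ᵐ v, Summable fun i => fieldEntry hα m A i x 0 v) :
    ∫⁻ v, ‖∑' i, fieldEntry hα m A i x 0 v‖ₑ ^ 2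
      = ENNReal.ofReal ((2 * Real.pi) ^ 2 * |x.pf|⁻¹) * hsNormSq (A x) := by
  rw [hsNormSq] at hhs ⊢
  rw [← ENNReal.tsum_mul_left]
  refine lintegral_enorm_sq_tsum (fun i => measurable_fieldEntry hα m hA i measurable_const
    measurable_const measurable_id) ?_ (fun S => ?_) hs
  · rw [ENNReal.tsum_mul_left]
    exact ENNReal.mul_ne_top ENNReal.ofReal_ne_top hhs
  -- Conjugating the entries turns them into matrix coefficients with `w i = A x eᵢ`, the form of
  -- the finite orthogonality relations.
  · rw [← Finset.mul_sum, ← lintegral_enorm_sq_sum_inner_gaugeRep hα m x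
      (chosenBasis L2Plane).orthonormal (fun i => A x (chosenBasis L2Plane i)) S]
    refine lintegral_congr fun v => ?_
    rw [← enorm_conj, map_sum]
    simp only [fieldEntry, inner_conj_symm, id]

/-- The inverse transform is isometric up to a constant. -/
theorem lintegral_enorm_sq_inverseTransform (hα : α ≠ 0) (m : ℝ)
    {A : Sector α β γ l → L2Plane →L[ℂ] L2Plane} (hA : IsTransformableField hα m A) :
    ENNReal.ofReal (α ^ 2) * ∫⁻ v, ∫⁻ z, ‖inverseTransform hα m A z v‖ₑ ^ 2
      = ENNReal.ofReal ((2 * Real.pi) ^ 5) * ∫⁻ x, hsNormSq (A x) ∂(sectorPlancherel α β γ l) := by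
  -- The inverse transform carries `cis (-x · z)`, hence the conjugate; the density is included in
  -- `k` because the Fourier transform below is taken for Lebesgue measure.
  set k : Sector α β γ l → ((ℝ × ℝ) × (ℝ × ℝ)) → ℂ := fun x v =>
    starRingEnd ℂ (((|x.pf| / α ^ 2 : ℝ) : ℂ) * ∑' i, fieldEntry hα m A i x 0 v) with hk
  have hTm : Measurable fun p : Sector α β γ l × ((ℝ × ℝ) × (ℝ × ℝ)) =>
      ∑' i, fieldEntry hα m A i p.1 0 p.2 :=
    measurable_tsum_fieldEntry hα m hA.measurable measurable_fst measurable_const measurable_snd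
  have hpf := measurable_pf (α := α) (β := β) (γ := γ) (l := l)
  have hkm : Measurable fun p : Sector α β γ l × ((ℝ × ℝ) × (ℝ × ℝ)) => k p.1 p.2 := by
    refine measurable_conj.comp (Measurable.mul ?_ hTm)
    fun_prop
  have hkn : ∀ x v, ‖k x v‖ₑ = ENNReal.ofReal (|x.pf| / α ^ 2)
      * ‖∑' i, fieldEntry hα m A i x 0 v‖ₑ := fun x v => by
    rw [hk, enorm_conj, enorm_mul, ← ofReal_norm (((|x.pf| / α ^ 2 : ℝ) : ℂ)), Complex.norm_real,
      Real.norm_of_nonneg (by positivity)]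
  have hk1 : ∀ v, Integrable fun x => k x v := fun v => by
    refine ⟨(hkm.comp measurable_prodMk_right).aestronglyMeasurable, ?_⟩
    have := (hA.integrable 0 v).2
    rw [HasFiniteIntegral, lintegral_sectorPlancherel] at this
    rw [HasFiniteIntegral]
    simpa only [hkn] using this
  have hae : ∀ᵐ x : Sector α β γ l, ∫⁻ v, ‖∑' i, fieldEntry hα m A i x 0 v‖ₑ ^ 2
      = ENNReal.ofReal ((2 * Real.pi) ^ 2 * |x.pf|⁻¹) * hsNormSq (A x) := by
    have h1 : ∀ᵐ x : Sector α β γ l, hsNormSq (A x) < ∞ :=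
      (ae_sectorPlancherel_iff hα).1 (ae_lt_top (measurable_hsNormSq hA.measurable)
        hA.hilbertSchmidt.ne)
    have hm : Measurable fun p : Sector α β γ l × ((ℝ × ℝ) × (ℝ × ℝ)) =>
        ∑' i, ‖fieldEntry hα m A i p.1 0 p.2‖ₑ :=
      Measurable.tsum fun i => (measurable_fieldEntry hα m hA.measurable i measurable_fst
        measurable_const measurable_snd).enorm
    have h2 : ∀ᵐ v : (ℝ × ℝ) × (ℝ × ℝ), ∀ᵐ x : Sector α β γ l,
        ∑' i, ‖fieldEntry hα m A i x 0 v‖ₑ < ∞ := .of_forall fun v =>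
      (ae_sectorPlancherel_iff hα).1 (ae_lt_top (Measurable.tsum fun i =>
        (measurable_fieldEntry hα m hA.measurable i measurable_id measurable_const
          measurable_const).enorm) (hA.summable 0 v).ne)
    -- Absolute convergence is known for each `v` at almost every `x`; the relations at a fixed `x`
    -- need it at almost every `v`.
    have h3 := (Measure.ae_ae_comm (μ := (volume : Measure (Sector α β γ l)))
      (ν := (volume : Measure ((ℝ × ℝ) × (ℝ × ℝ))))
      (p := fun x v => ∑' i, ‖fieldEntry hα m A i x 0 v‖ₑ < ∞)
      (measurableSet_lt hm measurable_const)).2 h2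
    filter_upwards [h1, h3] with x hx1 hx3
    refine lintegral_enorm_sq_tsum_fieldEntry hα m hA.measurable x hx1.ne ?_
    filter_upwards [hx3] with v hv
    exact summable_of_tsum_enorm_lt_top hv
  have hα2 : 0 < α ^ 2 := by positivity
  -- The squared density `|pf|² / α⁴` times `(2π)² / |pf|` is `(2π)² / α²` times the density itself.
  have hk2 : ∫⁻ v, ∫⁻ x, ‖k x v‖ₑ ^ 2
      = ENNReal.ofReal ((2 * Real.pi) ^ 2 / α ^ 2)
        * ∫⁻ x, hsNormSq (A x) ∂(sectorPlancherel α β γ l) := by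
    rw [lintegral_lintegral_swap ((hkm.comp measurable_swap).enorm.pow_const 2).aemeasurable,
      lintegral_sectorPlancherel, ← lintegral_const_mul _ (by
        have := measurable_hsNormSq (A := fun x => A x) hA.measurable
        fun_prop)]
    refine lintegral_congr_ae ?_
    filter_upwards [hae] with x hx
    simp only [hkn, mul_pow]
    have hm : Measurable fun v => ‖∑' i, fieldEntry hα m A i x 0 v‖ₑ ^ 2 :=
      (measurable_tsum_fieldEntry hα m hA.measurable measurable_const measurable_const
        measurable_id).enorm.pow_const 2
    rw [lintegral_const_mul _ hm, hx, ← mul_assoc, ← mul_assoc, ← ENNReal.ofReal_pow (by positivity),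
      ← ENNReal.ofReal_mul (by positivity), ← ENNReal.ofReal_mul (by positivity)]
    congr 2
    have := abs_pos.2 x.pf_ne_zero
    field_simp
  have e1 := Sector.lintegral_lintegral_fourier hα volume hkm (.of_forall hk1) (by
    rw [hk2]
    exact ENNReal.mul_lt_top ENNReal.ofReal_lt_top hA.hilbertSchmidt)
  have e2 : ∀ v z, ‖inverseTransform hα m A z v‖ₑ = ‖∫ x, k x v * cis (dot3 x.1 z)‖ₑ := by
    intro v z
    rw [inverseTransform, integral_sectorPlancherel, ← enorm_conj, ← integral_conj]
    congr 1
    refine integral_congr_ae (.of_forall fun x => ?_)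
    simp only [fieldEntry_pair hα m A _ x z v, hk, tsum_mul_left, map_mul, conj_cis, neg_neg]
    ring
  simp only [e2]
  rw [e1, hk2, ← mul_assoc, ← mul_assoc, ← ENNReal.ofReal_mul hα2.le,
    ← ENNReal.ofReal_mul (by positivity)]
  congr 2
  field_simp

end Fields
/-! ## Orthogonality relation -/

section Orthogonality

variable {α β γ l : ℝ}

theorem tsum_enorm_inner_le_traceNorm {H ι : Type*} [NormedAddCommGroup H]
    [InnerProductSpace ℂ H] {e f : ι → H} (he : Orthonormal ℂ e)
    (hf : Orthonormal ℂ f) (T : H →L[ℂ] H) : ∑' i, ‖⟪e i, T (f i)⟫_ℂ‖ₑ ≤ traceNorm T := by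
  rw [ENNReal.tsum_eq_iSup_sum]
  refine iSup_le fun S => ?_
  have h1 : ∑ i ∈ S, ‖⟪e i, T (f i)⟫_ℂ‖ₑ
      = ∑ k : Fin S.card, ‖⟪e (S.equivFin.symm k), T (f (S.equivFin.symm k))⟫_ℂ‖ₑ := by
    rw [← Finset.sum_coe_sort]
    exact (Equiv.sum_comp S.equivFin.symm fun i : S => ‖⟪e i, T (f i)⟫_ℂ‖ₑ).symm
  rw [h1, traceNorm]
  have hinj : Function.Injective fun k : Fin S.card => ((S.equivFin.symm k : S) : ι) :=
    Subtype.val_injective.comp S.equivFin.symm.injective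
  exact le_iSup_of_le S.card <| le_iSup_of_le (fun k => e (S.equivFin.symm k)) <|
    le_iSup_of_le (fun k => f (S.equivFin.symm k)) <| le_iSup_of_le (he.comp _ hinj) <|
    le_iSup_of_le (hf.comp _ hinj) le_rfl

theorem orthonormal_gaugeRep (hα : α ≠ 0) (m : ℝ) (x : Sector α β γ l) (g : GNC α β γ) :
    Orthonormal ℂ fun i => (gaugeRep hα m x g : L2Plane →L[ℂ] L2Plane)
      (chosenBasis L2Plane i) :=
  (chosenBasis L2Plane).orthonormal.comp_linearIsometry (repIsometry m x g)

/-- A unitary carries the basis to an orthonormal system, so each finite partial sum is admitted in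
the supremum defining the trace norm. The bound is uniform in the group element and makes the
inverse transform converge absolutely at every point. -/
theorem tsum_enorm_fieldEntry_le (hα : α ≠ 0) (m : ℝ)
    (A : Sector α β γ l → L2Plane →L[ℂ] L2Plane) (x : Sector α β γ l)
    (z : ℝ × ℝ × ℝ) (v : (ℝ × ℝ) × (ℝ × ℝ)) :
    ∑' i, ‖fieldEntry hα m A i x z v‖ₑ ≤ traceNorm (A x) :=
  tsum_enorm_inner_le_traceNorm (orthonormal_gaugeRep hα m x _)
    (chosenBasis L2Plane).orthonormal (A x)

/-- The central coordinates. -/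
def GNC.central (g : GNC α β γ) : ℝ × ℝ × ℝ := g.1

/-- The phase space coordinates. -/
def GNC.phase (g : GNC α β γ) : (ℝ × ℝ) × (ℝ × ℝ) := g.2

theorem opTrace_star_mul_eq_tsum {H : Type*} [NormedAddCommGroup H] [InnerProductSpace ℂ H]
    [CompleteSpace H] (S T : H →L[ℂ] H) : opTrace (star S * T)
      = ∑' i, ⟪S (chosenBasis H i), T (chosenBasis H i)⟫_ℂ := by
  refine tsum_congr fun i => ?_
  rw [ContinuousLinearMap.star_eq_adjoint, mul_apply_eq_comp,
    ContinuousLinearMap.adjoint_inner_right]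

/-- The transform sees `A` and `C` only through `A C⁻¹`. One isometry statement for the inverse
transform thus serves both for the given scalar operators and for an unknown field `C`. -/
theorem fieldTransform_eq_inverseTransform (hα : α ≠ 0) (m : ℝ)
    (C A : Sector α β γ l → L2Plane →L[ℂ] L2Plane) (g : GNC α β γ) :
    fieldTransform (sectorPlancherel α β γ l) (fun x => gaugeRep hα m x) C A g
      = inverseTransform hα m (fun x => A x * Ring.inverse (C x)) g.central g.phase := by
  simp only [fieldTransform, mul_assoc, opTrace_star_mul_eq_tsum]
  rfl

theorem lintegral_haar (G : (ℝ × ℝ × ℝ) → ((ℝ × ℝ) × (ℝ × ℝ)) → ℝ≥0∞)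
    (hG : Measurable fun q : (ℝ × ℝ × ℝ) × ((ℝ × ℝ) × (ℝ × ℝ)) => G q.1 q.2) :
    ∫⁻ g : GNC α β γ, G g.central g.phase ∂(GNC.haar α β γ)
      = ENNReal.ofReal (α ^ 2) * ∫⁻ v, ∫⁻ z, G z v := by
  rw [GNC.haar, lintegral_smul_measure, smul_eq_mul]
  congr 1
  exact lintegral_prod_symm' (μ := (volume : Measure (ℝ × ℝ × ℝ)))
    (ν := (volume : Measure ((ℝ × ℝ) × (ℝ × ℝ)))) _ hG

theorem ENNReal.add_sq_le_four (a b : ℝ≥0∞) : (a + b) ^ 2 ≤ 4 * (a ^ 2 + b ^ 2) := by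
  have h1 : a + b ≤ 2 * max a b := by
    rw [two_mul]; exact add_le_add (le_max_left _ _) (le_max_right _ _)
  calc (a + b) ^ 2 ≤ (2 * max a b) ^ 2 := by gcongr
    _ = 4 * max a b ^ 2 := by rw [mul_pow]; norm_num
    _ ≤ 4 * (a ^ 2 + b ^ 2) := by
      gcongr
      rcases le_total a b with h | h
      · rw [max_eq_right h]; exact le_add_self
      · rw [max_eq_left h]; exact le_self_add

theorem hsNormSq_add_smul_le (S T : L2Plane →L[ℂ] L2Plane) (t : ℂ) :
    hsNormSq (S + t • T : L2Plane →L[ℂ] L2Plane)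
      ≤ 4 * (hsNormSq S + ‖t‖ₑ ^ 2 * hsNormSq T) := by
  simp only [hsNormSq]
  rw [← ENNReal.tsum_mul_left, ← ENNReal.tsum_add, ← ENNReal.tsum_mul_left]
  refine ENNReal.tsum_le_tsum fun i => ?_
  rw [← mul_pow, ← enorm_smul]
  refine le_trans ?_ (ENNReal.add_sq_le_four _ _)
  gcongr
  exact enorm_add_le _ _

theorem fieldEntry_add_smul (hα : α ≠ 0) (m : ℝ)
    (A B : Sector α β γ l → L2Plane →L[ℂ] L2Plane) (t : ℂ) (i : chosenIndex L2Plane)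
    (x : Sector α β γ l) (z : ℝ × ℝ × ℝ) (v : (ℝ × ℝ) × (ℝ × ℝ)) :
    fieldEntry hα m (fun x => A x + t • B x) i x z v
      = fieldEntry hα m A i x z v + t * fieldEntry hα m B i x z v := by
  simp only [fieldEntry, add_apply, smul_apply,
    inner_add_right, inner_smul_right]

/-- Needed for polarisation, which evaluates the norm identity at `A + t B` with `t = ±1, ±i`. -/
theorem IsTransformableField.add_smul {hα : α ≠ 0} {m : ℝ}
    {A B : Sector α β γ l → L2Plane →L[ℂ] L2Plane} (hA : IsTransformableField hα m A)
    (hB : IsTransformableField hα m B) (t : ℂ) :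
    IsTransformableField hα m fun x => A x + t • B x where
  measurable u v := by
    have h1 := hA.measurable u v
    have h2 := hB.measurable u v
    simp only [add_apply, smul_apply,
      inner_add_right, inner_smul_right]
    fun_prop
  hilbertSchmidt := by
    have h1 := measurable_hsNormSq (A := fun x => A x) hA.measurable
    have h2 := measurable_hsNormSq (A := fun x => B x) hB.measurable
    refine (lintegral_mono fun x => hsNormSq_add_smul_le (A x) (B x) t).trans_lt ?_
    rw [lintegral_const_mul _ (by fun_prop), lintegral_add_left h1, lintegral_const_mul _ h2]
    exact ENNReal.mul_lt_top (by norm_num) (ENNReal.add_lt_top.2 ⟨hA.hilbertSchmidt,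
      ENNReal.mul_lt_top (ENNReal.pow_lt_top (by simp)) hB.hilbertSchmidt⟩)
  summable z v := by
    have hm : ∀ {D : Sector α β γ l → L2Plane →L[ℂ] L2Plane}, IsMeasurableField D →
        Measurable fun x => ∑' i, ‖fieldEntry hα m D i x z v‖ₑ := fun hD =>
      Measurable.tsum fun i => (measurable_fieldEntry hα m hD i measurable_id measurable_const
        measurable_const).enorm
    refine (lintegral_mono (g := fun x => ∑' i, ‖fieldEntry hα m A i x z v‖ₑ
      + ‖t‖ₑ * ∑' i, ‖fieldEntry hα m B i x z v‖ₑ) fun x => ?_).trans_lt ?_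
    · simp only
      rw [← ENNReal.tsum_mul_left, ← ENNReal.tsum_add]
      refine ENNReal.tsum_le_tsum fun i => ?_
      rw [fieldEntry_add_smul, ← enorm_mul]
      exact enorm_add_le _ _
    · rw [lintegral_add_left (hm hA.measurable), lintegral_const_mul _ (hm hB.measurable)]
      exact ENNReal.add_lt_top.2 ⟨hA.summable z v,
        ENNReal.mul_lt_top (by simp) (hB.summable z v)⟩

theorem IsTransformableField.ae_summable {hα : α ≠ 0} {m : ℝ}
    {A : Sector α β γ l → L2Plane →L[ℂ] L2Plane} (hA : IsTransformableField hα m A)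
    (z : ℝ × ℝ × ℝ) (v : (ℝ × ℝ) × (ℝ × ℝ)) :
    ∀ᵐ x ∂(sectorPlancherel α β γ l), Summable fun i => fieldEntry hα m A i x z v := by
  filter_upwards [ae_lt_top (Measurable.tsum fun i => (measurable_fieldEntry hα m hA.measurable i
    measurable_id measurable_const measurable_const).enorm) (hA.summable z v).ne] with x hx
  exact summable_of_tsum_enorm_lt_top hx

theorem inverseTransform_add_smul {hα : α ≠ 0} {m : ℝ}
    {A B : Sector α β γ l → L2Plane →L[ℂ] L2Plane} (hA : IsTransformableField hα m A)
    (hB : IsTransformableField hα m B) (t : ℂ) (z : ℝ × ℝ × ℝ) (v : (ℝ × ℝ) × (ℝ × ℝ)) :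
    inverseTransform hα m (fun x => A x + t • B x) z v
      = inverseTransform hα m A z v + t * inverseTransform hα m B z v := by
  rw [inverseTransform, inverseTransform, inverseTransform, ← integral_const_mul,
    ← integral_add (hA.integrable z v) ((hB.integrable z v).const_mul t)]
  refine integral_congr_ae ?_
  filter_upwards [hA.ae_summable z v, hB.ae_summable z v] with x h1 h2
  simp only [fieldEntry_add_smul]
  rw [h1.tsum_add (h2.mul_left t), tsum_mul_left]

theorem lintegral_haar_inverseTransform {hα : α ≠ 0} {m : ℝ}
    {A : Sector α β γ l → L2Plane →L[ℂ] L2Plane} (hA : IsTransformableField hα m A) :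
    ∫⁻ g : GNC α β γ, ‖inverseTransform hα m A g.central g.phase‖ₑ ^ 2 ∂(GNC.haar α β γ)
      = ENNReal.ofReal ((2 * Real.pi) ^ 5) * ∫⁻ x, hsNormSq (A x) ∂(sectorPlancherel α β γ l) := by
  rw [← lintegral_enorm_sq_inverseTransform hα m hA]
  exact lintegral_haar (fun z v => ‖inverseTransform hα m A z v‖ₑ ^ 2)
    ((measurable_inverseTransform hα m hA.measurable).enorm.pow_const 2)

theorem IsTransformableField.memLp {hα : α ≠ 0} {m : ℝ}
    {A : Sector α β γ l → L2Plane →L[ℂ] L2Plane} (hA : IsTransformableField hα m A) :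
    MemLp (fun g : GNC α β γ => inverseTransform hα m A g.central g.phase) 2 (GNC.haar α β γ) := by
  have hm : Measurable fun g : GNC α β γ => inverseTransform hα m A g.central g.phase :=
    measurable_inverseTransform hα m hA.measurable
  rw [memLp_two_iff_lintegral hm.aestronglyMeasurable, lintegral_haar_inverseTransform hA]
  exact ENNReal.mul_lt_top ENNReal.ofReal_lt_top hA.hilbertSchmidt

theorem integral_haar_inverseTransform {hα : α ≠ 0} {m : ℝ}
    {A : Sector α β γ l → L2Plane →L[ℂ] L2Plane} (hA : IsTransformableField hα m A) :
    ∫ g : GNC α β γ, ‖inverseTransform hα m A g.central g.phase‖ ^ 2 ∂(GNC.haar α β γ)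
      = (2 * Real.pi) ^ 5 * ∫ x, (hsNormSq (A x)).toReal ∂(sectorPlancherel α β γ l) := by
  have hm : Measurable fun g : GNC α β γ => inverseTransform hα m A g.central g.phase :=
    measurable_inverseTransform hα m hA.measurable
  have hs := measurable_hsNormSq (A := fun x => A x) hA.measurable
  rw [integral_toReal hs.aemeasurable (ae_lt_top hs hA.hilbertSchmidt.ne),
    integral_eq_lintegral_of_nonneg_ae (.of_forall fun g => by positivity)
      (hm.norm.pow_const 2).aestronglyMeasurable]
  have h := congrArg ENNReal.toReal (lintegral_haar_inverseTransform hA)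
  rw [ENNReal.toReal_mul, ENNReal.toReal_ofReal (by positivity)] at h
  rw [← h]
  congr 1
  refine lintegral_congr fun g => ?_
  rw [ENNReal.ofReal_pow (norm_nonneg _), ofReal_norm]

theorem summable_norm_sq_of_hsNormSq {T : L2Plane → L2Plane} (h : hsNormSq T ≠ ∞) :
    Summable (fun i => ‖T (chosenBasis L2Plane i)‖ ^ 2) ∧
      (hsNormSq T).toReal = ∑' i, ‖T (chosenBasis L2Plane i)‖ ^ 2 := by
  have h1 : ∀ i, ‖T (chosenBasis L2Plane i)‖ₑ ^ 2
      = ENNReal.ofReal (‖T (chosenBasis L2Plane i)‖ ^ 2) := fun i => by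
    rw [ENNReal.ofReal_pow (norm_nonneg _), ofReal_norm]
  simp only [hsNormSq, h1] at h ⊢
  have hs : Summable fun i => ‖T (chosenBasis L2Plane i)‖ ^ 2 := by
    have := ENNReal.summable_toReal h
    simpa [ENNReal.toReal_ofReal, sq_nonneg] using this
  exact ⟨hs, by rw [← ENNReal.ofReal_tsum_of_nonneg (fun i => by positivity) hs,
    ENNReal.toReal_ofReal (tsum_nonneg fun i => by positivity)]⟩

/-- Polarisation of the Hilbert–Schmidt norm. -/
theorem opTrace_star_mul {S T : L2Plane →L[ℂ] L2Plane} (hS : hsNormSq S ≠ ∞)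
    (hT : hsNormSq T ≠ ∞) : opTrace (star S * T) =
      ((((hsNormSq (S + (1 : ℂ) • T : L2Plane →L[ℂ] L2Plane)).toReal : ℝ) : ℂ)
      - (((hsNormSq (S + (-1 : ℂ) • T : L2Plane →L[ℂ] L2Plane)).toReal : ℝ) : ℂ)
      + ((((hsNormSq (S + (-Complex.I) • T : L2Plane →L[ℂ] L2Plane)).toReal : ℝ) : ℂ)
      - (((hsNormSq (S + Complex.I • T : L2Plane →L[ℂ] L2Plane)).toReal : ℝ) : ℂ))
        * Complex.I) / 4 := by
  have hfin : ∀ t : ℂ, hsNormSq (S + t • T : L2Plane →L[ℂ] L2Plane) ≠ ∞ := fun t =>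
    ((hsNormSq_add_smul_le S T t).trans_lt (ENNReal.mul_lt_top (by norm_num)
      (ENNReal.add_lt_top.2 ⟨hS.lt_top, ENNReal.mul_lt_top (ENNReal.pow_lt_top (by simp))
        hT.lt_top⟩))).ne
  have hsum : ∀ t : ℂ, HasSum (fun i => (((‖(S + t • T : L2Plane →L[ℂ] L2Plane)
      (chosenBasis L2Plane i)‖ ^ 2 : ℝ)) : ℂ))
      (((hsNormSq (S + t • T : L2Plane →L[ℂ] L2Plane)).toReal : ℝ) : ℂ) := fun t => by
    have h := summable_norm_sq_of_hsNormSq (hfin t)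
    rw [h.2]
    exact Complex.hasSum_ofReal.2 h.1.hasSum
  have key := ((((hsum 1).sub (hsum (-1))).add
    (((hsum (-Complex.I)).sub (hsum Complex.I)).mul_right Complex.I)).div_const 4)
  rw [opTrace_star_mul_eq_tsum, ← key.tsum_eq]
  refine tsum_congr fun i => ?_
  rw [inner_eq_sum_norm_sq_div_four]
  simp only [add_apply, smul_apply, one_smul, neg_smul,
    ← sub_eq_add_neg]
  push_cast
  rfl

theorem integral_polarization {X : Type*} [MeasurableSpace X] {μ : Measure X}
    {f₁ f₂ f₃ f₄ : X → ℂ} (h₁ : Integrable f₁ μ) (h₂ : Integrable f₂ μ) (h₃ : Integrable f₃ μ)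
    (h₄ : Integrable f₄ μ) :
    ∫ x, (f₁ x - f₂ x + (f₃ x - f₄ x) * Complex.I) / 4 ∂μ
      = (∫ x, f₁ x ∂μ - ∫ x, f₂ x ∂μ + (∫ x, f₃ x ∂μ - ∫ x, f₄ x ∂μ) * Complex.I) / 4 := by
  rw [integral_div]
  have e := integral_add (h₁.sub h₂) ((h₃.sub h₄).mul_const Complex.I)
  simp only [Pi.sub_apply] at e
  rw [e, integral_mul_const, integral_sub h₁ h₂, integral_sub h₃ h₄]

/-- Polarisation of `integral_haar_inverseTransform`. The trace side is polarised only almost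
everywhere, where both fields are Hilbert–Schmidt. -/
theorem integral_conj_inverseTransform_mul {hα : α ≠ 0} {m : ℝ}
    {A B : Sector α β γ l → L2Plane →L[ℂ] L2Plane} (hA : IsTransformableField hα m A)
    (hB : IsTransformableField hα m B) :
    ∫ g : GNC α β γ, starRingEnd ℂ (inverseTransform hα m A g.central g.phase)
        * inverseTransform hα m B g.central g.phase ∂(GNC.haar α β γ)
      = (((2 * Real.pi) ^ 5 : ℝ) : ℂ)
        * ∫ x, opTrace (star (A x) * B x) ∂(sectorPlancherel α β γ l) := by
  have hAB := fun t : ℂ => hA.add_smul hB t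
  have hI : ∀ t : ℂ, Integrable (fun g : GNC α β γ =>
      ((‖inverseTransform hα m (fun x => A x + t • B x) g.central g.phase‖ ^ 2 : ℝ) : ℂ))
      (GNC.haar α β γ) := fun t =>
    ((memLp_two_iff_integrable_sq_norm (hAB t).memLp.1).1 (hAB t).memLp).ofReal
  have hJ : ∀ t : ℂ, Integrable (fun x =>
      (((hsNormSq (A x + t • B x : L2Plane →L[ℂ] L2Plane)).toReal : ℝ) : ℂ))
      (sectorPlancherel α β γ l) := fun t => by
    have hs := measurable_hsNormSq (A := fun x => (A x + t • B x : L2Plane →L[ℂ] L2Plane))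
      (hAB t).measurable
    exact (integrable_toReal_of_lintegral_ne_top hs.aemeasurable (hAB t).hilbertSchmidt.ne).ofReal
  have hIJ : ∀ t : ℂ, ∫ g : GNC α β γ,
      ((‖inverseTransform hα m (fun x => A x + t • B x) g.central g.phase‖ ^ 2 : ℝ) : ℂ) ∂(GNC.haar α β γ)
      = (((2 * Real.pi) ^ 5 : ℝ) : ℂ) * ∫ x,
        (((hsNormSq (A x + t • B x : L2Plane →L[ℂ] L2Plane)).toReal : ℝ) : ℂ)
          ∂(sectorPlancherel α β γ l) := fun t => by
    have h := integral_haar_inverseTransform (hAB t)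
    have h1 := congrArg (fun r : ℝ => (r : ℂ)) h
    rw [Complex.ofReal_mul, ← integral_complex_ofReal, ← integral_complex_ofReal] at h1
    exact h1
  have e1 : ∀ g : GNC α β γ, starRingEnd ℂ (inverseTransform hα m A g.central g.phase)
        * inverseTransform hα m B g.central g.phase =
      (((‖inverseTransform hα m (fun x => A x + (1 : ℂ) • B x) g.central g.phase‖ ^ 2 : ℝ) : ℂ)
      - ((‖inverseTransform hα m (fun x => A x + (-1 : ℂ) • B x) g.central g.phase‖ ^ 2 : ℝ) : ℂ)
      + (((‖inverseTransform hα m (fun x => A x + (-Complex.I) • B x) g.central g.phase‖ ^ 2 : ℝ) : ℂ)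
      - ((‖inverseTransform hα m (fun x => A x + Complex.I • B x) g.central g.phase‖ ^ 2 : ℝ) : ℂ))
        * Complex.I) / 4 := fun g => by
    simp only [inverseTransform_add_smul hA hB]
    generalize inverseTransform hα m A g.central g.phase = a
    generalize inverseTransform hα m B g.central g.phase = b
    have h := inner_eq_sum_norm_sq_div_four (𝕜 := ℂ) a b
    rw [RCLike.inner_apply, mul_comm] at h
    rw [h]
    simp only [smul_eq_mul, one_mul, neg_mul, ← sub_eq_add_neg]
    push_cast
    rfl
  have e2 : ∀ᵐ x ∂(sectorPlancherel α β γ l), opTrace (star (A x) * B x) =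
      ((((hsNormSq (A x + (1 : ℂ) • B x : L2Plane →L[ℂ] L2Plane)).toReal : ℝ) : ℂ)
      - (((hsNormSq (A x + (-1 : ℂ) • B x : L2Plane →L[ℂ] L2Plane)).toReal : ℝ) : ℂ)
      + ((((hsNormSq (A x + (-Complex.I) • B x : L2Plane →L[ℂ] L2Plane)).toReal : ℝ) : ℂ)
      - (((hsNormSq (A x + Complex.I • B x : L2Plane →L[ℂ] L2Plane)).toReal : ℝ) : ℂ))
        * Complex.I) / 4 := by
    filter_upwards [ae_lt_top (measurable_hsNormSq (A := fun x => A x) hA.measurable)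
      hA.hilbertSchmidt.ne, ae_lt_top (measurable_hsNormSq (A := fun x => B x) hB.measurable)
      hB.hilbertSchmidt.ne] with x h1 h2
    exact opTrace_star_mul h1.ne h2.ne
  rw [integral_congr_ae (.of_forall e1), integral_congr_ae e2,
    integral_polarization (hI 1) (hI (-1)) (hI (-Complex.I)) (hI Complex.I),
    integral_polarization (hJ 1) (hJ (-1)) (hJ (-Complex.I)) (hJ Complex.I)]
  simp only [hIJ]
  ring

end Orthogonality
/-! ## The Weyl transform -/

section Weyl

variable {α β γ l : ℝ}

/-- A concrete case of Pettis' theorem: `f` is the pointwise limit of its finite basis expansions.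
-/
theorem stronglyMeasurable_of_inner {Y : Type*} [MeasurableSpace Y] {f : Y → L2Plane}
    (h : ∀ w, Measurable fun y => ⟪w, f y⟫_ℂ) : StronglyMeasurable f := by
  refine stronglyMeasurable_of_tendsto (Filter.atTop : Filter (Finset (chosenIndex L2Plane)))
    (f := fun S y => ∑ i ∈ S, ⟪chosenBasis L2Plane i, f y⟫_ℂ • chosenBasis L2Plane i)
    (fun S => Finset.stronglyMeasurable_fun_sum S fun i _ => (h _).stronglyMeasurable.smul_const _)
    ?_
  rw [tendsto_pi_nhds]
  intro y
  have := (chosenBasis L2Plane).hasSum_repr (f y)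
  simp only [HilbertBasis.repr_apply_apply] at this
  exact this

theorem stronglyMeasurable_gaugeRep (hα : α ≠ 0) (m : ℝ) (u : L2Plane) (x : Sector α β γ l) :
    StronglyMeasurable fun q : (ℝ × ℝ × ℝ) × ((ℝ × ℝ) × (ℝ × ℝ)) =>
      (gaugeRep hα m x (GNC.pair q.1 q.2) : L2Plane →L[ℂ] L2Plane) u :=
  stronglyMeasurable_of_inner fun w =>
    Measurable.inner_gaugeRep hα m u w measurable_const measurable_fst measurable_snd

theorem stronglyMeasurable_gaugeRep_zero (hα : α ≠ 0) (m : ℝ) (u : L2Plane) (x : Sector α β γ l) :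
    StronglyMeasurable fun v : (ℝ × ℝ) × (ℝ × ℝ) =>
      (gaugeRep hα m x (GNC.pair 0 v) : L2Plane →L[ℂ] L2Plane) u :=
  stronglyMeasurable_of_inner fun w =>
    Measurable.inner_gaugeRep hα m u w measurable_const measurable_const measurable_id

theorem norm_gaugeRep_apply (hα : α ≠ 0) (m : ℝ) (x : Sector α β γ l) (g : GNC α β γ)
    (u : L2Plane) : ‖(gaugeRep hα m x g : L2Plane →L[ℂ] L2Plane) u‖ = ‖u‖ :=
  (repIsometry m x g).norm_map u

/-- The operator `∫ F(v) U_x(0, v) dv`. -/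
def weylTransform (hα : α ≠ 0) (m : ℝ) (x : Sector α β γ l) (F : (ℝ × ℝ) × (ℝ × ℝ) → ℂ)
    (u : L2Plane) : L2Plane :=
  ∫ v, F v • (gaugeRep hα m x (GNC.pair 0 v) : L2Plane →L[ℂ] L2Plane) u

theorem integrable_smul_gaugeRep (hα : α ≠ 0) (m : ℝ) (x : Sector α β γ l)
    {F : (ℝ × ℝ) × (ℝ × ℝ) → ℂ} (hF : Integrable F) (u : L2Plane) :
    Integrable fun v => F v • (gaugeRep hα m x (GNC.pair 0 v) : L2Plane →L[ℂ] L2Plane) u := by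
  refine (hF.norm.mul_const ‖u‖).mono' ?_ (.of_forall fun v => ?_)
  · exact hF.1.smul (stronglyMeasurable_gaugeRep_zero hα m u x).aestronglyMeasurable
  · rw [norm_smul, norm_gaugeRep_apply]

/-- The integrand of the kernel representation of the Weyl transform is integrable over sets of
finite measure. -/
theorem integrable_weylKernel (m : ℝ) (x : Sector α β γ l)
    {F : (ℝ × ℝ) × (ℝ × ℝ) → ℂ} (hFm : Measurable F) (hF : Integrable F) (u : L2Plane)
    {S : Set (ℝ × ℝ)} (hS : volume S < ∞) :
    Integrable (fun q : ((ℝ × ℝ) × (ℝ × ℝ)) × (ℝ × ℝ) => F q.1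
      * (cis (repQuad m x q.1 + GNC.dot q.2 (repFreq x q.1)) * u (q.2 + repTrans m x q.1)))
      ((volume : Measure ((ℝ × ℝ) × (ℝ × ℝ))).prod (volume.restrict S)) := by
  have hu := u.measurable
  have hm : Measurable fun q : ((ℝ × ℝ) × (ℝ × ℝ)) × (ℝ × ℝ) => F q.1
      * (cis (repQuad m x q.1 + GNC.dot q.2 (repFreq x q.1)) * u (q.2 + repTrans m x q.1)) := by
    have h1 : Measurable fun v => repQuad m x v := by fun_prop
    have h2 : Measurable fun v => repFreq x v := by fun_prop
    have h3 : Measurable fun v => repTrans m x v := by fun_prop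
    fun_prop
  refine ⟨hm.aestronglyMeasurable, ?_⟩
  rw [HasFiniteIntegral, lintegral_prod _ hm.enorm.aemeasurable]
  have hle : ∀ v, ∫⁻ r in S, ‖F v * (cis (repQuad m x v + GNC.dot r (repFreq x v))
      * u (r + repTrans m x v))‖ₑ ≤ ‖F v‖ₑ * (‖u‖ₑ * volume S ^ (1 / 2 : ℝ)) := by
    intro v
    simp only [enorm_mul, enorm_cis, one_mul]
    rw [lintegral_const_mul _ (by fun_prop)]
    gcongr
    -- Cauchy–Schwarz against the constant `1` on `S`; the translate of `u` has the norm of `u`, so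
    -- the bound does not depend on `v`.
    have h1 := ENNReal.lintegral_mul_le_Lp_mul_Lq (volume.restrict S) Real.HolderConjugate.two_two
      (f := fun r => ‖u (r + repTrans m x v)‖ₑ) (g := fun _ => 1) (by fun_prop) (by fun_prop)
    simp only [Pi.mul_apply, mul_one, ENNReal.one_rpow, lintegral_const, one_mul,
      Measure.restrict_apply MeasurableSet.univ, Set.univ_inter] at h1
    refine h1.trans ?_
    gcongr
    have h2 : ∫⁻ r in S, ‖u (r + repTrans m x v)‖ₑ ^ (2 : ℝ) ≤ ‖u‖ₑ ^ (2 : ℝ) := by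
      refine (lintegral_mono' Measure.restrict_le_self le_rfl).trans ?_
      rw [lintegral_add_right_eq_self (fun r => ‖u r‖ₑ ^ (2 : ℝ))]
      have := u.lintegral_enorm_sq
      simp only [← ENNReal.rpow_natCast] at this
      exact_mod_cast this.le
    refine (ENNReal.rpow_le_rpow h2 (by norm_num)).trans ?_
    rw [← ENNReal.rpow_mul]
    norm_num
  refine (lintegral_mono hle).trans_lt ?_
  rw [lintegral_mul_const _ (by fun_prop)]
  exact ENNReal.mul_lt_top hF.2 (ENNReal.mul_lt_top (by simp)
    (ENNReal.rpow_lt_top_of_nonneg (by norm_num) hS.ne))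

/-- As `u` is only square integrable, joint integrability is available over sets of finite measure
in `r`; balls of integer radius exhaust the plane. -/
theorem ae_integrable_weylKernel (m : ℝ) (x : Sector α β γ l)
    {F : (ℝ × ℝ) × (ℝ × ℝ) → ℂ} (hFm : Measurable F) (hF : Integrable F) (u : L2Plane) :
    ∀ᵐ r : ℝ × ℝ, Integrable fun v => F v
      * (cis (repQuad m x v + GNC.dot r (repFreq x v)) * u (r + repTrans m x v)) := by
  have h : ∀ n : ℕ, ∀ᵐ r : ℝ × ℝ, r ∈ Metric.ball (0 : ℝ × ℝ) n → Integrable fun v => F v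
      * (cis (repQuad m x v + GNC.dot r (repFreq x v)) * u (r + repTrans m x v)) := fun n => by
    rw [← ae_restrict_iff' Metric.isOpen_ball.measurableSet]
    exact (integrable_weylKernel m x hFm hF u measure_ball_lt_top).prod_left_ae
  filter_upwards [ae_all_iff.2 h] with r hr
  obtain ⟨n, hn⟩ := exists_nat_gt ‖r‖
  exact hr n (by simpa using hn)

/-- The Weyl transform acts by an integral formula. -/
theorem coeFn_weylTransform (hα : α ≠ 0) (m : ℝ) (x : Sector α β γ l)
    {F : (ℝ × ℝ) × (ℝ × ℝ) → ℂ} (hFm : Measurable F) (hF : Integrable F) (u : L2Plane) :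
    (weylTransform hα m x F u : ℝ × ℝ → ℂ) =ᵐ[volume] fun r => ∫ v, F v
      * (cis (repQuad m x v + GNC.dot r (repFreq x v)) * u (r + repTrans m x v)) := by
  refine ae_eq_of_forall_setIntegral_eq_of_sigmaFinite (fun S hS hS' => ?_) (fun S hS hS' => ?_)
    (fun S hS hS' => ?_)
  · have : IsFiniteMeasure ((volume : Measure (ℝ × ℝ)).restrict S) := ⟨by simpa using hS'⟩
    exact ((Lp.memLp (weylTransform hα m x F u)).restrict S).integrable (by norm_num)
  · exact (integrable_weylKernel m x hFm hF u hS').integral_prod_right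
  · have e := integral_integral_swap (f := fun v r => F v
      * (cis (repQuad m x v + GNC.dot r (repFreq x v)) * u (r + repTrans m x v)))
      (integrable_weylKernel m x hFm hF u hS')
    -- An integral over `S` is an inner product with the indicator of `S`, and this functional
    -- passes under the Bochner integral.
    rw [← e, ← L2.inner_indicatorConstLp_one (𝕜 := ℂ) hS hS'.ne, weylTransform,
      ← integral_inner (integrable_smul_gaugeRep hα m x hF u)]
    refine integral_congr_ae (.of_forall fun v => ?_)
    simp only
    rw [inner_smul_right, L2.inner_indicatorConstLp_one, ← integral_const_mul]
    refine integral_congr_ae (ae_restrict_of_ae ?_)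
    filter_upwards [coeFn_gaugeRep hα m x 0 v u] with r hr
    rw [hr]
    simp [dot3]

theorem dot_comm (a b : ℝ × ℝ) : GNC.dot a b = GNC.dot b a := by
  unfold GNC.dot; ring

/-- The Hilbert–Schmidt norm of an integral operator with kernel `K(r, s)`, `s` being the
difference of the two arguments. -/
theorem hsNormSq_of_kernel {T : L2Plane → L2Plane} {K : (ℝ × ℝ) → (ℝ × ℝ) → ℂ}
    (hKm : Measurable fun p : (ℝ × ℝ) × (ℝ × ℝ) => K p.1 p.2)
    (hK2 : ∫⁻ r, ∫⁻ s, ‖K r s‖ₑ ^ 2 < ∞) {c : ℝ} (hc : 0 ≤ c)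
    (hT : ∀ u : L2Plane, ∀ᵐ r, T u r = c • ∫ s, K r s * u (r + s)) :
    hsNormSq T = ENNReal.ofReal (c ^ 2) * ∫⁻ r, ∫⁻ s, ‖K r s‖ₑ ^ 2 := by
  have hKr : ∀ᵐ r, ∫⁻ s, ‖K r s‖ₑ ^ 2 < ∞ :=
    ae_lt_top (Measurable.lintegral_prod_right'
      (f := fun p : (ℝ × ℝ) × (ℝ × ℝ) => ‖K p.1 p.2‖ₑ ^ 2) (hKm.enorm.pow_const 2)) hK2.ne
  have hsum : ∀ᵐ r, ∑' i, ‖T (chosenBasis L2Plane i) r‖ₑ ^ 2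
      = ENNReal.ofReal (c ^ 2) * ∫⁻ s, ‖K r s‖ₑ ^ 2 := by
    filter_upwards [ae_all_iff.2 fun i => hT (chosenBasis L2Plane i), hKr] with r h1 h2
    have hKrm : Measurable fun t => K r (t - r) :=
      by fun_prop
    have h2' : ∫⁻ t, ‖starRingEnd ℂ (K r (t - r))‖ₑ ^ 2 = ∫⁻ s, ‖K r s‖ₑ ^ 2 := by
      simp only [enorm_conj]
      exact lintegral_sub_right_eq_self (fun s => ‖K r s‖ₑ ^ 2) r
    have hmem : MemLp (fun t => starRingEnd ℂ (K r (t - r))) 2 :=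
      (memLp_two_iff_lintegral (measurable_conj.comp hKrm).aestronglyMeasurable).2 (h2' ▸ h2)
    -- At fixed `r` the values of `T eᵢ` are, up to `c` and conjugation, the basis coefficients of
    -- `t ↦ conj (K r (t - r))`. Parseval then sums over `i`.
    have h3 : ∀ i, ∫ s, K r s * chosenBasis L2Plane i (r + s)
        = starRingEnd ℂ ⟪chosenBasis L2Plane i, hmem.toLp _⟫_ℂ := fun i => by
      rw [inner_conj_symm, L2.inner_def,
        ← integral_sub_right_eq_self (fun s => K r s * chosenBasis L2Plane i (r + s)) r]
      refine integral_congr_ae ?_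
      filter_upwards [hmem.coeFn_toLp] with t ht
      rw [ht, RCLike.inner_apply, RCLike.conj_conj, add_sub_cancel, mul_comm]
    have h4 : ∀ i, ‖T (chosenBasis L2Plane i) r‖ₑ ^ 2
        = ENNReal.ofReal (c ^ 2) * ‖⟪chosenBasis L2Plane i, hmem.toLp _⟫_ℂ‖ₑ ^ 2 :=
      fun i => by
        rw [h1 i, enorm_smul, h3 i, enorm_conj, mul_pow, ENNReal.ofReal_pow (by positivity),
          Real.enorm_of_nonneg (by positivity)]
    simp only [h4]
    rw [ENNReal.tsum_mul_left, HilbertBasis.tsum_enorm_inner_sq, ← L2Plane.lintegral_enorm_sq,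
      ← h2']
    congr 1
    refine lintegral_congr_ae ?_
    filter_upwards [hmem.coeFn_toLp] with t ht
    rw [ht]
  simp only [hsNormSq, ← L2Plane.lintegral_enorm_sq]
  rw [← lintegral_tsum fun i => ((L2Plane.measurable _).enorm.pow_const 2).aemeasurable,
    lintegral_congr_ae hsum, lintegral_const_mul' _ _ ENNReal.ofReal_ne_top]

/-- The Hilbert–Schmidt norm of the Weyl transform. -/
theorem hsNormSq_weylTransform (hα : α ≠ 0) (m : ℝ) (x : Sector α β γ l)
    {F : (ℝ × ℝ) × (ℝ × ℝ) → ℂ} (hFm : Measurable F) (hF : Integrable F)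
    (hF2 : ∫⁻ v, ‖F v‖ₑ ^ 2 < ∞) :
    hsNormSq (weylTransform hα m x F)
      = ENNReal.ofReal ((2 * Real.pi) ^ 2 * |x.pf|⁻¹) * ∫⁻ v, ‖F v‖ₑ ^ 2 := by
  obtain ⟨e, he, hmap⟩ := exists_repEquiv hα m x
  have hpf : 0 < |x.pf| := abs_pos.2 x.pf_ne_zero
  have hQ : Measurable fun v => repQuad m x v := by fun_prop
  -- `F` in the coordinates (frequency, translation), with the quadratic phase absorbed; being
  -- unimodular, the phase changes no norm.
  set G : (ℝ × ℝ) × (ℝ × ℝ) → ℂ := fun p => F (e.symm p) * cis (repQuad m x (e.symm p)) with hG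
  have hGm : Measurable G := by
    have := e.symm.measurable
    fun_prop
  have hGe : ∀ v, G (e v) = F v * cis (repQuad m x v) := fun v => by simp [hG]
  have hint : ∀ H : (ℝ × ℝ) × (ℝ × ℝ) → ℂ, ∫ v, H (e v) = (|x.pf|⁻¹ : ℝ) • ∫ p, H p := fun H => by
    rw [← integral_map_equiv e, hmap, integral_smul_measure, ENNReal.toReal_ofReal (by positivity)]
  have hlint : ∀ H : (ℝ × ℝ) × (ℝ × ℝ) → ℝ≥0∞,
      ENNReal.ofReal |x.pf| * ∫⁻ v, H (e v) = ∫⁻ p, H p := fun H => by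
    rw [← lintegral_map_equiv H e, hmap, lintegral_smul_measure, smul_eq_mul, ← mul_assoc,
      ← ENNReal.ofReal_mul hpf.le, mul_inv_cancel₀ hpf.ne', ENNReal.ofReal_one, one_mul]
  have hintble : ∀ H : (ℝ × ℝ) × (ℝ × ℝ) → ℂ, Measurable H → Integrable (fun v => H (e v)) →
      Integrable H := fun H hH h => by
    refine ⟨hH.aestronglyMeasurable, ?_⟩
    rw [HasFiniteIntegral, ← hlint]
    exact ENNReal.mul_lt_top ENNReal.ofReal_lt_top h.2
  have hG1 : Integrable G := by
    refine hintble G hGm ?_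
    simp only [hGe]
    refine hF.mono (hFm.mul (measurable_cis.comp hQ)).aestronglyMeasurable
      (.of_forall fun v => by simp)
  have hG2 : ∫⁻ s, ∫⁻ a, ‖G (a, s)‖ₑ ^ 2 = ENNReal.ofReal |x.pf| * ∫⁻ v, ‖F v‖ₑ ^ 2 := by
    have h1 := lintegral_prod_symm' (μ := (volume : Measure (ℝ × ℝ)))
      (ν := (volume : Measure (ℝ × ℝ))) (fun p => ‖G p‖ₑ ^ 2) (by fun_prop)
    rw [← h1, ← Measure.volume_eq_prod, ← hlint]
    simp only [hGe, enorm_mul, enorm_cis, mul_one]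
  -- Integrating out the frequency makes the kernel a partial Fourier transform of `G`, so its `L²`
  -- norm is known by Plancherel on `ℝ²`.
  set K : (ℝ × ℝ) → (ℝ × ℝ) → ℂ := fun r s => ∫ a, G (a, s) * cis (GNC.dot a r) with hK
  have hKm : Measurable fun p : (ℝ × ℝ) × (ℝ × ℝ) => K p.1 p.2 := by
    have : StronglyMeasurable fun q : ((ℝ × ℝ) × (ℝ × ℝ)) × (ℝ × ℝ) =>
        G (q.2, q.1.2) * cis (GNC.dot q.2 q.1.1) := Measurable.stronglyMeasurable (by fun_prop)
    exact this.integral_prod_right.measurable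
  have hK2 : ∫⁻ r, ∫⁻ s, ‖K r s‖ₑ ^ 2
      = ENNReal.ofReal ((2 * Real.pi) ^ 2) * (ENNReal.ofReal |x.pf| * ∫⁻ v, ‖F v‖ₑ ^ 2) := by
    rw [lintegral_lintegral_swap (hKm.enorm.pow_const 2).aemeasurable, ← hG2]
    refine isPlancherelPairing_dot.lintegral_lintegral_eq volume (k := fun a s => G (a, s)) hGm
      ?_ ?_
    · have hG1' : Integrable G (volume.prod volume) := hG1
      exact hG1'.prod_left_ae
    · rw [hG2]
      exact ENNReal.mul_lt_top ENNReal.ofReal_lt_top hF2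
  have hT : ∀ u : L2Plane, ∀ᵐ r, weylTransform hα m x F u r
      = (|x.pf|⁻¹ : ℝ) • ∫ s, K r s * u (r + s) := by
    intro u
    have hum := u.measurable
    filter_upwards [coeFn_weylTransform hα m x hFm hF u,
      ae_integrable_weylKernel m x hFm hF u] with r h1 h2
    have h3 : ∀ v, F v * (cis (repQuad m x v + GNC.dot r (repFreq x v))
        * u (r + repTrans m x v))
        = (fun p : (ℝ × ℝ) × (ℝ × ℝ) => G p * cis (GNC.dot p.1 r)
          * u (r + p.2)) (e v) := fun v => by
      simp only
      rw [hGe, he, cis_add, dot_comm r]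
      ring
    simp only [h3] at h1 h2
    have h4 := hintble (fun p : (ℝ × ℝ) × (ℝ × ℝ) => G p * cis (GNC.dot p.1 r)
          * u (r + p.2)) (by fun_prop) h2
    rw [h1, hint (fun p : (ℝ × ℝ) × (ℝ × ℝ) => G p * cis (GNC.dot p.1 r)
          * u (r + p.2))]
    congr 1
    refine (integral_prod_symm (μ := (volume : Measure (ℝ × ℝ))) (ν := (volume : Measure (ℝ × ℝ)))
      _ h4).trans ?_
    refine integral_congr_ae (.of_forall fun s => ?_)
    simp only [hK]
    rw [integral_mul_const]
  -- The Jacobian in front of the kernel contributes `|pf|⁻²` and the norm of `G` contributes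
  -- `|pf|`, which leaves `|pf|⁻¹`.
  rw [hsNormSq_of_kernel hKm (hK2 ▸ ENNReal.mul_lt_top ENNReal.ofReal_lt_top
    (ENNReal.mul_lt_top ENNReal.ofReal_lt_top hF2)) (by positivity) hT, hK2, ← mul_assoc,
    ← mul_assoc, ← ENNReal.ofReal_mul (by positivity), ← ENNReal.ofReal_mul (by positivity)]
  congr 2
  field_simp

end Weyl
/-! ## The Plancherel formula of the group -/

section GroupPlancherel

variable {α β γ l : ℝ}

/-- The scalar `(2π)^(5/2)`. -/
def dufloMooreConst : ℝ := (2 * Real.pi) ^ (5 / 2 : ℝ)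

theorem dufloMooreConst_pos : 0 < dufloMooreConst := Real.rpow_pos_of_pos Real.two_pi_pos _

theorem dufloMooreConst_sq : dufloMooreConst ^ 2 = (2 * Real.pi) ^ 5 := by
  rw [dufloMooreConst, ← Real.rpow_natCast, ← Real.rpow_mul Real.two_pi_pos.le,
    ← Real.rpow_natCast]
  norm_num

theorem Ring.inverse_smul_one {H : Type*} [NormedAddCommGroup H] [InnerProductSpace ℂ H]
    {c : ℂ} (hc : c ≠ 0) :
    Ring.inverse (c • (1 : H →L[ℂ] H)) = c⁻¹ • (1 : H →L[ℂ] H) := by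
  have h1 : c • (1 : H →L[ℂ] H) * c⁻¹ • (1 : H →L[ℂ] H) = 1 := by
    rw [smul_mul_smul_comm, mul_inv_cancel₀ hc, one_smul, one_mul]
  have h2 : c⁻¹ • (1 : H →L[ℂ] H) * c • (1 : H →L[ℂ] H) = 1 := by
    rw [smul_mul_smul_comm, inv_mul_cancel₀ hc, one_smul, one_mul]
  exact Ring.inverse_unit ⟨_, _, h1, h2⟩

theorem isUnit_smul_one {H : Type*} [NormedAddCommGroup H] [InnerProductSpace ℂ H]
    {c : ℂ} (hc : c ≠ 0) : IsUnit (c • (1 : H →L[ℂ] H)) :=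
  (isUnit_one).smul (Units.mk0 c hc)

theorem dufloMooreConst_ne_zero : (dufloMooreConst : ℂ) ≠ 0 :=
  Complex.ofReal_ne_zero.2 dufloMooreConst_pos.ne'

/-- The partial Fourier transform in the central variables. -/
def centralFourier (f : (ℝ × ℝ × ℝ) → ((ℝ × ℝ) × (ℝ × ℝ)) → ℂ) (x : ℝ × ℝ × ℝ)
    (v : (ℝ × ℝ) × (ℝ × ℝ)) : ℂ :=
  ∫ z, f z v * cis (dot3 x z)

theorem measurable_centralFourier {f : (ℝ × ℝ × ℝ) → ((ℝ × ℝ) × (ℝ × ℝ)) → ℂ}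
    (hf : Measurable fun q : (ℝ × ℝ × ℝ) × ((ℝ × ℝ) × (ℝ × ℝ)) => f q.1 q.2) :
    Measurable fun q : (ℝ × ℝ × ℝ) × ((ℝ × ℝ) × (ℝ × ℝ)) => centralFourier f q.1 q.2 := by
  have : StronglyMeasurable fun q : ((ℝ × ℝ × ℝ) × ((ℝ × ℝ) × (ℝ × ℝ))) × (ℝ × ℝ × ℝ) =>
      f q.2 q.1.2 * cis (dot3 q.1.1 q.2) := Measurable.stronglyMeasurable (by fun_prop)
  exact this.integral_prod_right.measurable

theorem integrable_mul_cis {f : (ℝ × ℝ × ℝ) → ((ℝ × ℝ) × (ℝ × ℝ)) → ℂ}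
    (hf : Measurable fun q : (ℝ × ℝ × ℝ) × ((ℝ × ℝ) × (ℝ × ℝ)) => f q.1 q.2)
    (hf1 : Integrable (fun q : (ℝ × ℝ × ℝ) × ((ℝ × ℝ) × (ℝ × ℝ)) => f q.1 q.2)
      ((volume : Measure (ℝ × ℝ × ℝ)).prod (volume : Measure ((ℝ × ℝ) × (ℝ × ℝ)))))
    (x : ℝ × ℝ × ℝ) :
    Integrable (fun q : (ℝ × ℝ × ℝ) × ((ℝ × ℝ) × (ℝ × ℝ)) => f q.1 q.2 * cis (dot3 x q.1))
      ((volume : Measure (ℝ × ℝ × ℝ)).prod (volume : Measure ((ℝ × ℝ) × (ℝ × ℝ)))) := by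
  refine hf1.mono ?_ (.of_forall fun q => by simp)
  exact Measurable.aestronglyMeasurable (by fun_prop)

theorem dot3_comm (x z : ℝ × ℝ × ℝ) : dot3 x z = dot3 z x := by unfold dot3; ring

theorem integral_haar {E : Type*} [NormedAddCommGroup E] [NormedSpace ℝ E]
    {H : GNC α β γ → E}
    (hH : Integrable (fun q : (ℝ × ℝ × ℝ) × ((ℝ × ℝ) × (ℝ × ℝ)) => H (GNC.pair q.1 q.2))
      ((volume : Measure (ℝ × ℝ × ℝ)).prod (volume : Measure ((ℝ × ℝ) × (ℝ × ℝ))))) :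
    ∫ g, H g ∂(GNC.haar α β γ) = (α ^ 2 : ℝ) • ∫ v, ∫ z, H (GNC.pair z v) := by
  rw [GNC.haar, integral_smul_measure, ENNReal.toReal_ofReal (by positivity)]
  congr 1
  exact integral_prod_symm (μ := (volume : Measure (ℝ × ℝ × ℝ)))
    (ν := (volume : Measure ((ℝ × ℝ) × (ℝ × ℝ)))) _ hH

/-- The integrated representation is the Weyl transform of the partial Fourier transform. -/
theorem integratedRep_gaugeRep (hα : α ≠ 0) (m : ℝ) (x : Sector α β γ l)
    {f : (ℝ × ℝ × ℝ) → ((ℝ × ℝ) × (ℝ × ℝ)) → ℂ}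
    (hf1 : Integrable (fun q : (ℝ × ℝ × ℝ) × ((ℝ × ℝ) × (ℝ × ℝ)) => f q.1 q.2)
      ((volume : Measure (ℝ × ℝ × ℝ)).prod (volume : Measure ((ℝ × ℝ) × (ℝ × ℝ)))))
    (c : ℂ) (u : L2Plane) :
    integratedRep (GNC.haar α β γ) (gaugeRep hα m x) (fun g => f g.central g.phase) (c • u)
      = weylTransform hα m x (fun v => c * (α ^ 2 : ℝ) * centralFourier f x.1 v) u := by
  have hH : Integrable (fun q : (ℝ × ℝ × ℝ) × ((ℝ × ℝ) × (ℝ × ℝ)) => f q.1 q.2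
      • (gaugeRep hα m x (GNC.pair q.1 q.2) : L2Plane →L[ℂ] L2Plane) (c • u))
      ((volume : Measure (ℝ × ℝ × ℝ)).prod (volume : Measure ((ℝ × ℝ) × (ℝ × ℝ)))) := by
    refine (hf1.norm.mul_const ‖c • u‖).mono' ?_ (.of_forall fun q => ?_)
    · exact hf1.1.smul (stronglyMeasurable_gaugeRep hα m (c • u) x).aestronglyMeasurable
    · rw [norm_smul, norm_gaugeRep_apply]
  have e := integral_haar (H := fun g : GNC α β γ => f g.central g.phase
      • (gaugeRep hα m x g : L2Plane →L[ℂ] L2Plane) (c • u)) hH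
  refine e.trans ?_
  rw [weylTransform, ← integral_smul]
  refine integral_congr_ae (.of_forall fun v => ?_)
  have e2 : ∀ z, f (GNC.pair z v : GNC α β γ).central (GNC.pair z v : GNC α β γ).phase
      • (gaugeRep hα m x (GNC.pair z v) : L2Plane →L[ℂ] L2Plane) (c • u)
      = (f z v * cis (dot3 x.1 z)) • (c • (gaugeRep hα m x (GNC.pair 0 v) :
        L2Plane →L[ℂ] L2Plane) u) := fun z => by
    rw [gaugeRep_pair_apply hα m x z v, map_smul, smul_smul, smul_smul, smul_smul]
    rfl
  simp only [e2]
  have e3 : ∀ (r : ℝ) (a : ℂ) (w : L2Plane), r • a • w = ((r : ℂ) * a) • w := fun r a w => by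
    rw [← smul_assoc, Complex.real_smul]
  rw [integral_smul_const, smul_smul]
  refine (e3 _ _ _).trans ?_
  congr 1
  simp only [centralFourier]
  ring

/-- Plancherel formula for the partial Fourier transform. -/
theorem lintegral_centralFourier (hα : α ≠ 0) (β γ l : ℝ)
    {f : (ℝ × ℝ × ℝ) → ((ℝ × ℝ) × (ℝ × ℝ)) → ℂ}
    (hf : Measurable fun q : (ℝ × ℝ × ℝ) × ((ℝ × ℝ) × (ℝ × ℝ)) => f q.1 q.2)
    (hf1 : Integrable (fun q : (ℝ × ℝ × ℝ) × ((ℝ × ℝ) × (ℝ × ℝ)) => f q.1 q.2)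
      ((volume : Measure (ℝ × ℝ × ℝ)).prod (volume : Measure ((ℝ × ℝ) × (ℝ × ℝ)))))
    (hf2 : ∫⁻ v, ∫⁻ z, ‖f z v‖ₑ ^ 2 < ∞) :
    ∫⁻ x : Sector α β γ l, ∫⁻ v, ‖centralFourier f x.1 v‖ₑ ^ 2
      = ENNReal.ofReal ((2 * Real.pi) ^ 3) * ∫⁻ v, ∫⁻ z, ‖f z v‖ₑ ^ 2 := by
  rw [Sector.lintegral_val hα fun x => ∫⁻ v, ‖centralFourier f x v‖ₑ ^ 2,
    lintegral_lintegral_swap ((measurable_centralFourier hf).enorm.pow_const 2).aemeasurable,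
    ← isPlancherelPairing_dot3.lintegral_lintegral_eq volume hf hf1.prod_left_ae hf2]
  simp only [centralFourier, dot3_comm]

/-- Plancherel formula for measurable functions in the coordinates `(z, v)`. -/
theorem lintegral_hsNormSq_integratedRep (hα : α ≠ 0) (m : ℝ)
    {f : (ℝ × ℝ × ℝ) → ((ℝ × ℝ) × (ℝ × ℝ)) → ℂ}
    (hf : Measurable fun q : (ℝ × ℝ × ℝ) × ((ℝ × ℝ) × (ℝ × ℝ)) => f q.1 q.2)
    (hf1 : Integrable (fun q : (ℝ × ℝ × ℝ) × ((ℝ × ℝ) × (ℝ × ℝ)) => f q.1 q.2)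
      ((volume : Measure (ℝ × ℝ × ℝ)).prod (volume : Measure ((ℝ × ℝ) × (ℝ × ℝ)))))
    (hf2 : ∫⁻ v, ∫⁻ z, ‖f z v‖ₑ ^ 2 < ∞) :
    ∫⁻ x, hsNormSq (fun u => integratedRep (GNC.haar α β γ) (gaugeRep hα m x)
        (fun g => f g.central g.phase) ((dufloMooreConst : ℂ)⁻¹ • u)) ∂(sectorPlancherel α β γ l)
      = ENNReal.ofReal (α ^ 2) * ∫⁻ v, ∫⁻ z, ‖f z v‖ₑ ^ 2 := by
  have hcm := measurable_centralFourier hf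
  have hfin : ∀ᵐ x : Sector α β γ l, ∫⁻ v, ‖centralFourier f x.1 v‖ₑ ^ 2 < ∞ := by
    refine ae_lt_top ?_ ?_
    · exact Measurable.lintegral_prod_right' (f := fun p : Sector α β γ l × ((ℝ × ℝ) × (ℝ × ℝ)) =>
        ‖centralFourier f p.1.1 p.2‖ₑ ^ 2) (by fun_prop)
    · rw [lintegral_centralFourier hα β γ l hf hf1 hf2]
      exact (ENNReal.mul_lt_top ENNReal.ofReal_lt_top hf2).ne
  have hα2 : 0 < α ^ 2 := by positivity
  have hc := dufloMooreConst_pos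
  simp only [integratedRep_gaugeRep hα m _ hf1]
  rw [lintegral_sectorPlancherel]
  -- The constants are `|pf| / α²` from the density, `(2π)² / |pf|` from the Weyl transform, and `α⁴
  -- / (2π)⁵` from Haar measure and the Duflo–Moore scalar. The resulting `(2π)⁻³` is cancelled by
  -- the central Fourier transform.
  have hae : ∀ᵐ x : Sector α β γ l, ENNReal.ofReal (|x.pf| / α ^ 2)
      * hsNormSq (weylTransform hα m x fun v =>
          (dufloMooreConst : ℂ)⁻¹ * (α ^ 2 : ℝ) * centralFourier f x.1 v)
      = ENNReal.ofReal (α ^ 2 / (2 * Real.pi) ^ 3)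
        * ∫⁻ v, ‖centralFourier f x.1 v‖ₑ ^ 2 := by
    filter_upwards [hfin] with x hx
    have hFm : Measurable fun v => centralFourier f x.1 v := by fun_prop
    have hF1 : Integrable fun v => centralFourier f x.1 v :=
      (integrable_mul_cis hf hf1 x.1).integral_prod_right
    have hn : ∀ v, ‖(dufloMooreConst : ℂ)⁻¹ * (α ^ 2 : ℝ) * centralFourier f x.1 v‖ₑ ^ 2
        = ENNReal.ofReal ((dufloMooreConst⁻¹ * α ^ 2) ^ 2) * ‖centralFourier f x.1 v‖ₑ ^ 2 :=
      fun v => by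
        rw [enorm_mul, mul_pow, ENNReal.ofReal_pow (by positivity), ← Complex.ofReal_inv,
          ← Complex.ofReal_mul, ← ofReal_norm (((dufloMooreConst⁻¹ * α ^ 2 : ℝ)) : ℂ),
          Complex.norm_real, Real.norm_of_nonneg (by positivity)]
    have hl : ∫⁻ v, ‖(dufloMooreConst : ℂ)⁻¹ * (α ^ 2 : ℝ) * centralFourier f x.1 v‖ₑ ^ 2
        = ENNReal.ofReal ((dufloMooreConst⁻¹ * α ^ 2) ^ 2)
          * ∫⁻ v, ‖centralFourier f x.1 v‖ₑ ^ 2 := by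
      simp only [hn]
      rw [lintegral_const_mul _ (by fun_prop)]
    rw [hsNormSq_weylTransform hα m x (by fun_prop) (hF1.const_mul _) (by
      rw [hl]; exact ENNReal.mul_lt_top ENNReal.ofReal_lt_top hx), hl, ← mul_assoc, ← mul_assoc,
      ← ENNReal.ofReal_mul (by positivity), ← ENNReal.ofReal_mul (by positivity)]
    congr 2
    have hpf : 0 < |x.pf| := abs_pos.2 x.pf_ne_zero
    rw [mul_pow dufloMooreConst⁻¹, inv_pow, dufloMooreConst_sq]
    field_simp
  rw [lintegral_congr_ae hae, lintegral_const_mul' _ _ ENNReal.ofReal_ne_top,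
    lintegral_centralFourier hα β γ l hf hf1 hf2, ← mul_assoc, ← ENNReal.ofReal_mul (by positivity)]
  congr 2
  field_simp

theorem integrable_prod_of_memLp_haar (hα : α ≠ 0)
    {f : (ℝ × ℝ × ℝ) → ((ℝ × ℝ) × (ℝ × ℝ)) → ℂ}
    (h : MemLp (fun g : GNC α β γ => f g.central g.phase) 1 (GNC.haar α β γ)) :
    Integrable (fun q : (ℝ × ℝ × ℝ) × ((ℝ × ℝ) × (ℝ × ℝ)) => f q.1 q.2)
      ((volume : Measure (ℝ × ℝ × ℝ)).prod (volume : Measure ((ℝ × ℝ) × (ℝ × ℝ)))) := by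
  have h1 : Integrable (fun g : GNC α β γ => f g.central g.phase) (GNC.haar α β γ) :=
    memLp_one_iff_integrable.1 h
  rw [GNC.haar, integrable_smul_measure (by simpa using hα) ENNReal.ofReal_ne_top] at h1
  exact h1

theorem gaugeRep_plancherel (hα : α ≠ 0) (m : ℝ) (f : GNC α β γ → ℂ)
    (h1 : MemLp f 1 (GNC.haar α β γ)) (h2 : MemLp f 2 (GNC.haar α β γ)) :
    ∫⁻ x, hsNormSq (fun u => integratedRep (GNC.haar α β γ) (gaugeRep hα m x) f
        ((dufloMooreConst : ℂ)⁻¹ • u)) ∂(sectorPlancherel α β γ l)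
      = ∫⁻ g, ‖f g‖ₑ ^ 2 ∂(GNC.haar α β γ) := by
  have hfm : StronglyMeasurable (h1.1.mk f) := h1.1.stronglyMeasurable_mk
  have hff : f =ᵐ[GNC.haar α β γ] h1.1.mk f := h1.1.ae_eq_mk
  -- Both sides depend only on the almost everywhere class of `f`, so a measurable representative
  -- may be used in the coordinates `(z, v)`.
  set F : (ℝ × ℝ × ℝ) → ((ℝ × ℝ) × (ℝ × ℝ)) → ℂ := fun z v => h1.1.mk f (GNC.pair z v) with hF
  have hFm : Measurable fun q : (ℝ × ℝ × ℝ) × ((ℝ × ℝ) × (ℝ × ℝ)) => F q.1 q.2 := hfm.measurable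
  have hFf : f =ᵐ[GNC.haar α β γ] fun g => F g.central g.phase := hff
  have e1 : ∀ (x : Sector α β γ l) (u : L2Plane),
      integratedRep (GNC.haar α β γ) (gaugeRep hα m x) f u
        = integratedRep (GNC.haar α β γ) (gaugeRep hα m x) (fun g => F g.central g.phase) u := by
    intro x u
    refine integral_congr_ae ?_
    filter_upwards [hFf] with g hg
    rw [hg]
  have e2 : ∫⁻ g, ‖f g‖ₑ ^ 2 ∂(GNC.haar α β γ)
      = ENNReal.ofReal (α ^ 2) * ∫⁻ v, ∫⁻ z, ‖F z v‖ₑ ^ 2 := by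
    rw [← lintegral_haar (α := α) (β := β) (γ := γ) (fun z v => ‖F z v‖ₑ ^ 2)
      (hFm.enorm.pow_const 2)]
    refine lintegral_congr_ae ?_
    filter_upwards [hFf] with g hg
    rw [hg]
  have hfin : ∫⁻ v, ∫⁻ z, ‖F z v‖ₑ ^ 2 < ∞ := by
    have h3 := (memLp_two_iff_lintegral h2.1).1 h2
    rw [e2] at h3
    have hα2 : ENNReal.ofReal (α ^ 2) ≠ 0 := by simpa using hα
    exact ENNReal.lt_top_of_mul_ne_top_right h3.ne hα2
  simp only [e1]
  rw [lintegral_hsNormSq_integratedRep hα m hFm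
    (integrable_prod_of_memLp_haar hα ((memLp_congr_ae hFf).1 h1)) hfin, e2]

theorem isPositive_smul_one {H : Type*} [NormedAddCommGroup H] [InnerProductSpace ℂ H]
    [CompleteSpace H] {c : ℝ} (hc : 0 ≤ c) : ((c : ℂ) • (1 : H →L[ℂ] H)).IsPositive :=
  ContinuousLinearMap.isPositive_one.smul_of_nonneg (by exact_mod_cast hc)

/-- Because the operators are one fixed scalar, square integrability passes from `A` to `A C⁻¹`;
absolute convergence comes from the trace norm condition. -/
theorem isTransformableField_of_isAdmissibleField_const (hα : α ≠ 0) (m : ℝ)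
    {A : Sector α β γ l → L2Plane →L[ℂ] L2Plane}
    (hA : IsAdmissibleField (sectorPlancherel α β γ l)
      (fun _ => (dufloMooreConst : ℂ) • (1 : L2Plane →L[ℂ] L2Plane)) A) :
    IsTransformableField hα m
      fun x => A x * Ring.inverse ((dufloMooreConst : ℂ) • (1 : L2Plane →L[ℂ] L2Plane)) where
  measurable u v := by
    have := hA.measurable u v
    simp only [Ring.inverse_smul_one dufloMooreConst_ne_zero, mul_smul_comm, mul_one,
      smul_apply, inner_smul_right]
    fun_prop
  hilbertSchmidt := by
    have h : ∀ x, hsNormSq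
        (A x * Ring.inverse ((dufloMooreConst : ℂ) • (1 : L2Plane →L[ℂ] L2Plane)) :
          L2Plane →L[ℂ] L2Plane)
        = ‖(dufloMooreConst : ℂ)⁻¹‖ₑ ^ 2 * hsNormSq (A x) := fun x => by
      simp only [hsNormSq, Ring.inverse_smul_one dufloMooreConst_ne_zero, mul_smul_comm, mul_one,
        smul_apply, enorm_smul, mul_pow, ENNReal.tsum_mul_left]
    simp only [h]
    rw [lintegral_const_mul _ (measurable_hsNormSq (A := fun x => A x) hA.measurable)]
    exact ENNReal.mul_lt_top (ENNReal.pow_lt_top enorm_lt_top) hA.hilbertSchmidt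
  summable z v := (lintegral_mono fun x => tsum_enorm_fieldEntry_le hα m _ x z v).trans_lt
    hA.traceClass

theorem isPlancherelPair_sectorPlancherel (hα : α ≠ 0) (m : ℝ) :
    IsPlancherelPair (GNC.haar α β γ) (fun x : Sector α β γ l => gaugeRep hα m x)
      (sectorPlancherel α β γ l)
      (fun _ => (dufloMooreConst : ℂ) • (1 : L2Plane →L[ℂ] L2Plane)) where
  measurable _ _ := measurable_const
  measurable_inverse _ _ := measurable_const
  positive := .of_forall fun _ =>
    ⟨isPositive_smul_one dufloMooreConst_pos.le, isUnit_smul_one dufloMooreConst_ne_zero⟩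
  plancherel f h1 h2 := by
    rw [← gaugeRep_plancherel (l := l) hα m f h1 h2]
    simp only [Ring.inverse_smul_one dufloMooreConst_ne_zero, smul_apply, one_apply_eq_self]
  memLp A hA := by
    have h := (isTransformableField_of_isAdmissibleField_const hα m hA).memLp
    refine (memLp_congr_ae (.of_forall fun g => ?_)).2 h
    exact fieldTransform_eq_inverseTransform hα m _ A g
  orthogonality A₁ A₂ hA₁ hA₂ := by
    simp only [fieldTransform_eq_inverseTransform]
    rw [integral_conj_inverseTransform_mul
      (isTransformableField_of_isAdmissibleField_const hα m hA₁)
      (isTransformableField_of_isAdmissibleField_const hα m hA₂), ← integral_const_mul]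
    refine integral_congr_ae (.of_forall fun x => ?_)
    simp only [opTrace_star_mul_eq_tsum]
    rw [← tsum_mul_left]
    refine tsum_congr fun i => ?_
    -- The two factors `C⁻¹` contribute `(2π)⁻⁵`, which cancels the constant of the inverse
    -- transform.
    simp only [Ring.inverse_smul_one dufloMooreConst_ne_zero, mul_smul_comm, mul_one,
      smul_apply, inner_smul_left, inner_smul_right, ← dufloMooreConst_sq]
    have := dufloMooreConst_ne_zero
    simp only [map_inv₀, Complex.conj_ofReal]
    push_cast
    field_simp

end GroupPlancherel

/-! ## Uniqueness of the Plancherel measure -/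

section UniqueMeasure

variable {α β γ l : ℝ}

instance : (volume : Measure (ℝ × ℝ × ℝ)).IsAddHaarMeasure :=
  Measure.prod.instIsAddHaarMeasure _ _

/-- A product of three Gaussians. -/
def gaussian3 (z : ℝ × ℝ × ℝ) : ℂ :=
  Complex.exp (-1 * (z.1 : ℂ) ^ 2) * (Complex.exp (-1 * (z.2.1 : ℂ) ^ 2)
    * Complex.exp (-1 * (z.2.2 : ℂ) ^ 2))

theorem continuous_gaussian3 : Continuous gaussian3 := by unfold gaussian3; fun_prop

@[fun_prop]
theorem measurable_gaussian3 : Measurable gaussian3 := continuous_gaussian3.measurable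

theorem integrable_cexp_neg_sq : Integrable fun t : ℝ => Complex.exp (-1 * (t : ℂ) ^ 2) := by
  simpa using integrable_cexp_quadratic (b := 1) (by simp) 0 0

theorem integrable_gaussian3 : Integrable gaussian3 :=
  integrable_cexp_neg_sq.mul_prod (integrable_cexp_neg_sq.mul_prod integrable_cexp_neg_sq)

theorem norm_gaussian3_le (z : ℝ × ℝ × ℝ) : ‖gaussian3 z‖ ≤ 1 := by
  have h : ∀ t : ℝ, ‖Complex.exp (-1 * (t : ℂ) ^ 2)‖ ≤ 1 := fun t => by
    rw [Complex.norm_exp, Real.exp_le_one_iff]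
    have : (-1 * (t : ℂ) ^ 2).re = -t ^ 2 := by
      rw [neg_one_mul, Complex.neg_re, ← Complex.ofReal_pow, Complex.ofReal_re]
    rw [this]
    nlinarith [sq_nonneg t]
  rw [gaussian3, norm_mul, norm_mul]
  exact mul_le_one₀ (h _) (by positivity) (mul_le_one₀ (h _) (norm_nonneg _) (h _))

/-- The Fourier transform of a Gaussian is again a Gaussian and has no zeros. Without this the test
functions would lose the measure on the zero set. -/
theorem integral_gaussian3_mul_cis_ne_zero (x : ℝ × ℝ × ℝ) :
    ∫ z, gaussian3 z * cis (dot3 x z) ≠ 0 := by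
  have h : ∀ s : ℝ, ∫ t : ℝ, Complex.exp (-1 * (t : ℂ) ^ 2) * cis (s * t) ≠ 0 := fun s => by
    have e := fourierIntegral_gaussian (b := 1) (by simp) s
    have e2 : ∀ t : ℝ, Complex.exp (-1 * (t : ℂ) ^ 2) * cis (s * t)
        = Complex.exp (Complex.I * s * t) * Complex.exp (-1 * (t : ℂ) ^ 2) := fun t => by
      rw [cis, mul_comm]
      push_cast
      ring_nf
    simp only [e2]
    rw [e]
    refine mul_ne_zero ?_ (Complex.exp_ne_zero _)
    rw [Ne, Complex.cpow_eq_zero_iff]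
    simp [Real.pi_ne_zero]
  have e : ∀ z : ℝ × ℝ × ℝ, gaussian3 z * cis (dot3 x z)
      = (Complex.exp (-1 * (z.1 : ℂ) ^ 2) * cis (x.1 * z.1))
        * ((Complex.exp (-1 * (z.2.1 : ℂ) ^ 2) * cis (x.2.1 * z.2.1))
        * (Complex.exp (-1 * (z.2.2 : ℂ) ^ 2) * cis (x.2.2 * z.2.2))) := fun z => by
    rw [gaussian3, dot3, cis_add, cis_add]
    ring
  simp only [e]
  have e1 := integral_prod_mul (μ := (volume : Measure ℝ)) (ν := (volume : Measure (ℝ × ℝ)))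
    (fun t : ℝ => Complex.exp (-1 * (t : ℂ) ^ 2) * cis (x.1 * t))
    (fun z : ℝ × ℝ => (Complex.exp (-1 * (z.1 : ℂ) ^ 2) * cis (x.2.1 * z.1))
        * (Complex.exp (-1 * (z.2 : ℂ) ^ 2) * cis (x.2.2 * z.2)))
  have e2 := integral_prod_mul (μ := (volume : Measure ℝ)) (ν := (volume : Measure ℝ))
    (fun t : ℝ => Complex.exp (-1 * (t : ℂ) ^ 2) * cis (x.2.1 * t))
    (fun t : ℝ => Complex.exp (-1 * (t : ℂ) ^ 2) * cis (x.2.2 * t))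
  rw [Measure.volume_eq_prod]
  refine ne_of_eq_of_ne e1 (mul_ne_zero (h _) ?_)
  rw [Measure.volume_eq_prod]
  exact ne_of_eq_of_ne e2 (mul_ne_zero (h _) (h _))

/-- A sum of two translated Gaussians in the central variables, cut off to the unit ball in the
phase space variables. -/
def testFun (t : ℂ) (w z : ℝ × ℝ × ℝ) (v : (ℝ × ℝ) × (ℝ × ℝ)) : ℂ :=
  (gaussian3 z + t * gaussian3 (z - w))
    * (Metric.ball (0 : (ℝ × ℝ) × (ℝ × ℝ)) 1).indicator (fun _ => (1 : ℂ)) v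

theorem integrable_ball_indicator : Integrable
    ((Metric.ball (0 : (ℝ × ℝ) × (ℝ × ℝ)) 1).indicator fun _ => (1 : ℂ)) :=
  (integrable_indicator_iff Metric.isOpen_ball.measurableSet).2
    (integrableOn_const (by finiteness))

theorem integrable_testFun (t : ℂ) (w : ℝ × ℝ × ℝ) :
    Integrable (fun q : (ℝ × ℝ × ℝ) × ((ℝ × ℝ) × (ℝ × ℝ)) => testFun t w q.1 q.2)
      ((volume : Measure (ℝ × ℝ × ℝ)).prod (volume : Measure ((ℝ × ℝ) × (ℝ × ℝ)))) := by
  have h : Integrable fun z => gaussian3 z + t * gaussian3 (z - w) :=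
    integrable_gaussian3.add ((integrable_gaussian3.comp_sub_right w).const_mul t)
  exact h.mul_prod integrable_ball_indicator

theorem norm_testFun_le (t : ℂ) (w z : ℝ × ℝ × ℝ) (v : (ℝ × ℝ) × (ℝ × ℝ)) :
    ‖testFun t w z v‖ ≤ 1 + ‖t‖ := by
  have h1 : ‖(Metric.ball (0 : (ℝ × ℝ) × (ℝ × ℝ)) 1).indicator (fun _ => (1 : ℂ)) v‖ ≤ 1 := by
    refine (norm_indicator_le_norm_self _ _).trans (by simp)
  have h2 : ‖gaussian3 z + t * gaussian3 (z - w)‖ ≤ 1 + ‖t‖ := by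
    refine (norm_add_le _ _).trans (add_le_add (norm_gaussian3_le _) ?_)
    rw [norm_mul]
    exact mul_le_of_le_one_right (norm_nonneg _) (norm_gaussian3_le _)
  rw [testFun, norm_mul]
  exact (mul_le_mul h2 h1 (norm_nonneg _) (by positivity)).trans (by rw [mul_one])

theorem memLp_two_of_bound {X : Type*} [MeasurableSpace X] {μ : Measure X} {f : X → ℂ}
    (h : MemLp f 1 μ) {b : ℝ} (hb : ∀ x, ‖f x‖ ≤ b) : MemLp f 2 μ := by
  rw [memLp_two_iff_lintegral h.1]
  have h1 : ∫⁻ x, ‖f x‖ₑ ∂μ < ∞ := (memLp_one_iff_integrable.1 h).2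
  refine (lintegral_mono fun x => ?_).trans_lt
    ((lintegral_const_mul' (ENNReal.ofReal b) _ ENNReal.ofReal_ne_top).trans_lt
      (ENNReal.mul_lt_top ENNReal.ofReal_lt_top h1))
  simp only [pow_two]
  gcongr
  rw [← ofReal_norm]
  exact ENNReal.ofReal_le_ofReal (hb x)

theorem memLp_testFun_one (t : ℂ) (w : ℝ × ℝ × ℝ) :
    MemLp (fun g : GNC α β γ => testFun t w g.central g.phase) 1 (GNC.haar α β γ) := by
  have h : Integrable (fun g : GNC α β γ => testFun t w g.central g.phase)
    (GNC.lebesgue α β γ) := integrable_testFun t w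
  exact memLp_one_iff_integrable.2 (h.smul_measure ENNReal.ofReal_ne_top)

theorem memLp_testFun_two (t : ℂ) (w : ℝ × ℝ × ℝ) :
    MemLp (fun g : GNC α β γ => testFun t w g.central g.phase) 2 (GNC.haar α β γ) :=
  memLp_two_of_bound (memLp_testFun_one t w) fun g => norm_testFun_le t w g.central g.phase

/-- Translation by `w` becomes multiplication by `cis (x · w)`, so `t` and `w` enter only through
the factor `1 + t cis (x · w)`. -/
theorem centralFourier_testFun (t : ℂ) (w x : ℝ × ℝ × ℝ) (v : (ℝ × ℝ) × (ℝ × ℝ)) :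
    centralFourier (testFun t w) x v
      = (∫ z, gaussian3 z * cis (dot3 x z)) * (1 + t * cis (dot3 x w))
        * (Metric.ball (0 : (ℝ × ℝ) × (ℝ × ℝ)) 1).indicator (fun _ => (1 : ℂ)) v := by
  have hi : Integrable fun z => gaussian3 z * cis (dot3 x z) := by
    refine integrable_gaussian3.mono (Measurable.aestronglyMeasurable (by fun_prop))
      (.of_forall fun z => by simp)
  have hd : ∀ z, cis (dot3 x z) = cis (dot3 x (z - w)) * cis (dot3 x w) := fun z => by
    rw [← cis_add]
    congr 1
    simp only [dot3, Prod.fst_sub, Prod.snd_sub]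
    ring
  have e : ∀ z, testFun t w z v * cis (dot3 x z)
      = (gaussian3 z * cis (dot3 x z)
        + t * cis (dot3 x w) * (gaussian3 (z - w) * cis (dot3 x (z - w))))
        * (Metric.ball (0 : (ℝ × ℝ) × (ℝ × ℝ)) 1).indicator (fun _ => (1 : ℂ)) v := fun z => by
    have e1 : gaussian3 (z - w) * cis (dot3 x z)
        = cis (dot3 x w) * (gaussian3 (z - w) * cis (dot3 x (z - w))) := by rw [hd z]; ring
    rw [testFun, mul_right_comm, add_mul, mul_assoc t, e1, ← mul_assoc t]
  simp only [centralFourier, e]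
  rw [integral_mul_const, integral_add hi ((hi.comp_sub_right w).const_mul _),
    integral_const_mul, integral_sub_right_eq_self (fun z => gaussian3 z * cis (dot3 x z)) w]
  ring

/-- The density produced by the test functions. -/
def testDensity (x : Sector α β γ l) : ℝ≥0∞ :=
  ENNReal.ofReal ((2 * Real.pi) ^ 2 * |x.pf|⁻¹)
    * (‖(dufloMooreConst : ℂ)⁻¹ * (α ^ 2 : ℝ) * ∫ z, gaussian3 z * cis (dot3 x.1 z)‖ₑ ^ 2
      * volume (Metric.ball (0 : (ℝ × ℝ) × (ℝ × ℝ)) 1))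

/-- At fixed `x` the Weyl transform acts on a scalar multiple of the ball indicator. The weight
independent of `t` and `w` splits off, leaving a trigonometric factor to test the measure with. -/
theorem hsNormSq_testFun (hα : α ≠ 0) (m : ℝ) (x : Sector α β γ l) (t : ℂ) (w : ℝ × ℝ × ℝ) :
    hsNormSq (fun u => integratedRep (GNC.haar α β γ) (gaugeRep hα m x)
        (fun g => testFun t w g.central g.phase) ((dufloMooreConst : ℂ)⁻¹ • u))
      = testDensity x * ‖1 + t * cis (dot3 x.1 w)‖ₑ ^ 2 := by
  simp only [integratedRep_gaugeRep hα m x (integrable_testFun t w), centralFourier_testFun]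
  set c : ℂ := ∫ z, gaussian3 z * cis (dot3 x.1 z)
  have hi := (integrable_ball_indicator.const_mul (c * (1 + t * cis (dot3 x.1 w)))).const_mul
    ((dufloMooreConst : ℂ)⁻¹ * (α ^ 2 : ℝ))
  have hm : Measurable ((Metric.ball (0 : (ℝ × ℝ) × (ℝ × ℝ)) 1).indicator fun _ => (1 : ℂ)) :=
    measurable_const.indicator Metric.isOpen_ball.measurableSet
  have hI : ∫⁻ v, ‖(Metric.ball (0 : (ℝ × ℝ) × (ℝ × ℝ)) 1).indicator (fun _ => (1 : ℂ)) v‖ₑ ^ 2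
      = volume (Metric.ball (0 : (ℝ × ℝ) × (ℝ × ℝ)) 1) := by
    rw [← lintegral_indicator_one Metric.isOpen_ball.measurableSet]
    refine lintegral_congr fun v => ?_
    by_cases hv : v ∈ Metric.ball (0 : (ℝ × ℝ) × (ℝ × ℝ)) 1 <;> simp [hv]
  have hl : ∫⁻ v, ‖(dufloMooreConst : ℂ)⁻¹ * (α ^ 2 : ℝ) * (c * (1 + t * cis (dot3 x.1 w))
        * (Metric.ball (0 : (ℝ × ℝ) × (ℝ × ℝ)) 1).indicator (fun _ => (1 : ℂ)) v)‖ₑ ^ 2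
      = ‖(dufloMooreConst : ℂ)⁻¹ * (α ^ 2 : ℝ) * c‖ₑ ^ 2 * ‖1 + t * cis (dot3 x.1 w)‖ₑ ^ 2
        * volume (Metric.ball (0 : (ℝ × ℝ) × (ℝ × ℝ)) 1) := by
    rw [← hI, ← lintegral_const_mul _ (by fun_prop)]
    refine lintegral_congr fun v => ?_
    simp only [enorm_mul]
    ring
  rw [hsNormSq_weylTransform hα m x (by fun_prop) hi, hl, testDensity]
  · ring
  · rw [hl]
    exact ENNReal.mul_lt_top (ENNReal.mul_lt_top (ENNReal.pow_lt_top enorm_lt_top)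
      (ENNReal.pow_lt_top enorm_lt_top)) measure_ball_lt_top

theorem testDensity_ne_zero (hα : α ≠ 0) (x : Sector α β γ l) : testDensity x ≠ 0 := by
  have hpf : 0 < |x.pf| := abs_pos.2 x.pf_ne_zero
  refine mul_ne_zero ?_ (mul_ne_zero (pow_ne_zero 2 ?_) ?_)
  · simp only [ne_eq, ENNReal.ofReal_eq_zero, not_le]
    positivity
  · rw [enorm_ne_zero]
    refine mul_ne_zero (mul_ne_zero (inv_ne_zero dufloMooreConst_ne_zero) ?_)
      (integral_gaussian3_mul_cis_ne_zero _)
    exact_mod_cast pow_ne_zero 2 hα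
  · exact (Metric.measure_ball_pos volume _ one_pos).ne'

theorem testDensity_ne_top (x : Sector α β γ l) : testDensity x ≠ ∞ :=
  (ENNReal.mul_lt_top ENNReal.ofReal_lt_top (ENNReal.mul_lt_top
    (ENNReal.pow_lt_top enorm_lt_top) measure_ball_lt_top)).ne

theorem measurable_testDensity : Measurable (testDensity : Sector α β γ l → ℝ≥0∞) := by
  have h1 : StronglyMeasurable fun q : (ℝ × ℝ × ℝ) × (ℝ × ℝ × ℝ) =>
      gaussian3 q.2 * cis (dot3 q.1 q.2) := Measurable.stronglyMeasurable (by fun_prop)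
  have h2 : Measurable fun x => ∫ z, gaussian3 z * cis (dot3 x z) :=
    h1.integral_prod_right.measurable
  have h3 : Measurable fun x : Sector α β γ l => ∫ z, gaussian3 z * cis (dot3 x.1 z) :=
    h2.comp Sector.measurableEmbedding_val.measurable
  have h4 : Measurable fun x : Sector α β γ l => x.pf := measurable_pf
  unfold testDensity
  fun_prop

/-- Finite measures on `ℝ³` are determined by the integrals of `‖1 + t e^{i x·w}‖²`. -/
theorem Measure.ext_of_lintegral_cis {μ ν : Measure (ℝ × ℝ × ℝ)} [IsFiniteMeasure μ]
    [IsFiniteMeasure ν] (h : ∀ (t : ℂ) (w : ℝ × ℝ × ℝ),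
      ∫⁻ x, ‖1 + t * cis (dot3 x w)‖ₑ ^ 2 ∂μ = ∫⁻ x, ‖1 + t * cis (dot3 x w)‖ₑ ^ 2 ∂ν) :
    μ = ν := by
  have hint : ∀ (ξ : Measure (ℝ × ℝ × ℝ)) [IsFiniteMeasure ξ] (w : ℝ × ℝ × ℝ),
      Integrable (fun x => cis (dot3 x w)) ξ := fun ξ _ w =>
    (integrable_const (1 : ℂ)).mono (Measurable.aestronglyMeasurable (by fun_prop))
      (.of_forall fun x => by simp)
  -- For unimodular `t`, `|1 + t e|² = 2 + 2 Re (t e)` when `|e| = 1`, so the integral reveals the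
  -- real part of `t` times the characteristic function.
  have hone : ∀ (ξ : Measure (ℝ × ℝ × ℝ)) [IsFiniteMeasure ξ] (w : ℝ × ℝ × ℝ) (t : ℂ),
      ‖t‖ = 1 → (∫⁻ x, ‖1 + t * cis (dot3 x w)‖ₑ ^ 2 ∂ξ).toReal
        = 2 * ξ.real Set.univ + 2 * (t * ∫ x, cis (dot3 x w) ∂ξ).re := by
    intro ξ _ w t ht
    have e1 : ∀ x, ‖1 + t * cis (dot3 x w)‖ₑ ^ 2
        = ENNReal.ofReal (2 + 2 * (t * cis (dot3 x w)).re) := fun x => by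
      have hn : ‖t * cis (dot3 x w)‖ = 1 := by rw [norm_mul, ht, norm_cis, one_mul]
      rw [← ofReal_norm, ← ENNReal.ofReal_pow (norm_nonneg _), ← Complex.normSq_eq_norm_sq,
        Complex.normSq_add, Complex.normSq_eq_norm_sq (_ * _), hn]
      simp only [map_one, one_mul, Complex.conj_re]
      ring_nf
    have e2 : ∀ x, 0 ≤ 2 + 2 * (t * cis (dot3 x w)).re := fun x => by
      have hn : ‖t * cis (dot3 x w)‖ = 1 := by rw [norm_mul, ht, norm_cis, one_mul]
      have := (abs_le.1 (Complex.abs_re_le_norm (t * cis (dot3 x w)))).1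
      linarith
    have hi := ((hint ξ w).const_mul t)
    have hi' : Integrable (fun x => 2 * (t * cis (dot3 x w)).re) ξ := hi.re.const_mul 2
    simp only [e1]
    rw [← integral_eq_lintegral_of_nonneg_ae (.of_forall e2)
      (Measurable.aestronglyMeasurable (by fun_prop)), integral_add (integrable_const _) hi',
      integral_const, integral_const_mul, ← integral_const_mul t]
    congr 1
    · rw [smul_eq_mul, mul_comm]
    · congr 1
      exact integral_re hi
  -- The choice `t = 0` compares total masses; afterwards `t = 1` and `t = i` give the real and
  -- imaginary parts of the characteristic function.
  have huniv : μ.real Set.univ = ν.real Set.univ := by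
    have := h 0 0
    simp only [zero_mul, add_zero, enorm_one, one_pow, lintegral_one] at this
    rw [measureReal_def, measureReal_def, this]
  have hcis : ∀ w, ∫ x, cis (dot3 x w) ∂μ = ∫ x, cis (dot3 x w) ∂ν := fun w => by
    have h1 := hone μ w 1 (by simp)
    have h2 := hone μ w Complex.I (by simp)
    rw [h, hone ν w _ (by simp), huniv] at h1 h2
    simp only [one_mul, Complex.I_mul_re] at h1 h2
    apply Complex.ext <;> linarith
  refine Measure.ext_of_charFunDual (funext fun L => ?_)
  rw [charFunDual_apply, charFunDual_apply]
  -- A linear functional on `ℝ³` is `dot3` with the vector of its values on the standard basis.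
  have e : ∀ x : ℝ × ℝ × ℝ, Complex.exp (L x * Complex.I)
      = cis (dot3 x (L (1, 0, 0), L (0, 1, 0), L (0, 0, 1))) := fun x => by
    have hx : x = x.1 • ((1, 0, 0) : ℝ × ℝ × ℝ) + (x.2.1 • ((0, 1, 0) : ℝ × ℝ × ℝ)
        + x.2.2 • ((0, 0, 1) : ℝ × ℝ × ℝ)) := by
      ext <;> simp
    have hL : L x = dot3 x (L (1, 0, 0), L (0, 1, 0), L (0, 0, 1)) := by
      conv_lhs => rw [hx]
      simp only [map_add, map_smul, smul_eq_mul, dot3]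
    rw [hL, cis, mul_comm]
  simp only [e, hcis]

/-- For the test functions the right-hand side of the Plancherel formula does not involve the
measure. Any two solutions, weighted by `testDensity`, therefore have the same characteristic
function. The weight is positive and finite everywhere and can be divided out. -/
theorem eq_sectorPlancherel_of_isPlancherelPair (hα : α ≠ 0) (m : ℝ)
    {ν : Measure (Sector α β γ l)}
    (h : IsPlancherelPair (GNC.haar α β γ) (fun x : Sector α β γ l => gaugeRep hα m x) ν
      (fun _ => (dufloMooreConst : ℂ) • (1 : L2Plane →L[ℂ] L2Plane))) :
    ν = sectorPlancherel α β γ l := by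
  have key : ∀ {ξ : Measure (Sector α β γ l)},
      IsPlancherelPair (GNC.haar α β γ) (fun x : Sector α β γ l => gaugeRep hα m x) ξ
        (fun _ => (dufloMooreConst : ℂ) • (1 : L2Plane →L[ℂ] L2Plane)) →
      ∀ (t : ℂ) (w : ℝ × ℝ × ℝ),
        ∫⁻ x, ‖1 + t * cis (dot3 x w)‖ₑ ^ 2 ∂((ξ.withDensity testDensity).map fun x => x.1)
        = ∫⁻ g : GNC α β γ, ‖testFun t w g.central g.phase‖ₑ ^ 2 ∂(GNC.haar α β γ) := by
    intro ξ hξ t w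
    rw [← hξ.plancherel _ (memLp_testFun_one t w) (memLp_testFun_two t w)]
    simp only [Ring.inverse_smul_one dufloMooreConst_ne_zero, smul_apply, one_apply_eq_self,
      hsNormSq_testFun]
    have hm : Measurable fun x => ‖1 + t * cis (dot3 x w)‖ₑ ^ 2 := by fun_prop
    rw [lintegral_map hm Sector.measurableEmbedding_val.measurable]
    exact lintegral_withDensity_eq_lintegral_mul _ measurable_testDensity
      (hm.comp Sector.measurableEmbedding_val.measurable)
  -- The case `t = 0` identifies the total weighted mass with the squared norm of one test function,
  -- so no finiteness assumption on the measure itself is needed.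
  have hfin : ∀ {ξ : Measure (Sector α β γ l)},
      IsPlancherelPair (GNC.haar α β γ) (fun x : Sector α β γ l => gaugeRep hα m x) ξ
        (fun _ => (dufloMooreConst : ℂ) • (1 : L2Plane →L[ℂ] L2Plane)) →
      IsFiniteMeasure ((ξ.withDensity testDensity).map fun x => x.1) := fun hξ => ⟨by
    have h1 := key hξ 0 0
    simp only [zero_mul, add_zero, enorm_one, one_pow, lintegral_one] at h1
    rw [h1]
    exact (memLp_two_iff_lintegral (memLp_testFun_two 0 0).1).1 (memLp_testFun_two 0 0)⟩
  have h0 := isPlancherelPair_sectorPlancherel (β := β) (γ := γ) (l := l) hα m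
  have f1 := hfin h
  have f2 := hfin h0
  have hmap := Measure.ext_of_lintegral_cis fun t w => (key h t w).trans (key h0 t w).symm
  have hd : ν.withDensity testDensity = (sectorPlancherel α β γ l).withDensity testDensity := by
    rw [← Sector.measurableEmbedding_val.comap_map (ν.withDensity testDensity), hmap,
      Sector.measurableEmbedding_val.comap_map]
  rw [← withDensity_inv_same (μ := ν) measurable_testDensity
    (.of_forall fun x => testDensity_ne_zero hα x) (.of_forall testDensity_ne_top), hd,
    withDensity_inv_same measurable_testDensity
    (.of_forall fun x => testDensity_ne_zero hα x) (.of_forall testDensity_ne_top)]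

end UniqueMeasure

/-! ## Uniqueness of the Duflo–Moore operators -/

section RankOne

open InnerProductSpace

/-- Cauchy–Schwarz for the sum, then Bessel's inequality for each of the two orthonormal systems. -/
theorem traceNorm_rankOne_le {H : Type*} [NormedAddCommGroup H] [InnerProductSpace ℂ H]
    (u a : H) : traceNorm (rankOne ℂ u a : H →L[ℂ] H)
    ≤ ENNReal.ofReal (‖u‖ * ‖a‖) := by
  rw [traceNorm]
  refine iSup_le fun n => iSup_le fun e => iSup_le fun f => iSup_le fun he => iSup_le fun hf => ?_
  have h1 : ∀ i, ‖⟪e i, (rankOne ℂ u a : H →L[ℂ] H) (f i)⟫_ℂ‖ₑ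
      = ENNReal.ofReal (‖⟪e i, u⟫_ℂ‖ * ‖⟪f i, a⟫_ℂ‖) := fun i => by
    rw [rankOne_apply, inner_smul_right, ← ofReal_norm, norm_mul, mul_comm, norm_inner_symm a]
  simp only [h1]
  rw [← ENNReal.ofReal_sum_of_nonneg fun i _ => by positivity]
  refine ENNReal.ofReal_le_ofReal ((Real.sum_mul_le_sqrt_mul_sqrt _ _ _).trans ?_)
  refine mul_le_mul (Real.sqrt_le_iff.2 ⟨norm_nonneg _, he.sum_inner_products_le u⟩)
    (Real.sqrt_le_iff.2 ⟨norm_nonneg _, hf.sum_inner_products_le a⟩) (Real.sqrt_nonneg _)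
    (norm_nonneg _)

variable {H : Type*} [NormedAddCommGroup H] [InnerProductSpace ℂ H] [CompleteSpace H]

theorem hsNormSq_rankOne (u a : H) : hsNormSq (rankOne ℂ u a : H →L[ℂ] H)
    = ‖u‖ₑ ^ 2 * ‖a‖ₑ ^ 2 := by
  rw [← (chosenBasis H).tsum_enorm_inner_sq a, ← ENNReal.tsum_mul_left, hsNormSq]
  refine tsum_congr fun i => ?_
  rw [rankOne_apply, enorm_smul, mul_pow, mul_comm, ← inner_conj_symm, enorm_conj]

theorem rankOne_mul (u a : H) (D : H →L[ℂ] H) : (rankOne ℂ u a : H →L[ℂ] H) * D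
    = rankOne ℂ u (ContinuousLinearMap.adjoint D a) := by
  ext1 y
  rw [mul_apply_eq_comp, rankOne_apply, rankOne_apply, ContinuousLinearMap.adjoint_inner_left]

theorem opTrace_star_mul_self (S : H →L[ℂ] H) :
    opTrace (star S * S) = ((hsNormSq S).toReal : ℂ) := by
  rw [opTrace_star_mul_eq_tsum, hsNormSq,
    ENNReal.tsum_toReal_eq fun i => ENNReal.pow_ne_top enorm_ne_top, Complex.ofReal_tsum]
  refine tsum_congr fun i => ?_
  rw [inner_self_eq_norm_sq_to_K, ENNReal.toReal_pow, toReal_enorm]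
  simp

/-- A positive invertible operator whose inverse has a multiple of an isometry as its adjoint is
scalar. -/
theorem ContinuousLinearMap.IsPositive.eq_smul_one {C : H →L[ℂ] H} (hC : C.IsPositive)
    (hu : IsUnit C) {c : ℝ} (hc : 0 < c)
    (h : ∀ u, c * ‖ContinuousLinearMap.adjoint (Ring.inverse C) u‖ = ‖u‖) :
    C = (c : ℂ) • (1 : H →L[ℂ] H) := by
  have hsa : ContinuousLinearMap.adjoint C = C := hC.isSelfAdjoint.adjoint_eq
  have hinv : ∀ w, ContinuousLinearMap.adjoint (Ring.inverse C) (C w) = w := fun w => by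
    have h1 : star (Ring.inverse C) * C = 1 := by
      have : star C = C := hC.isSelfAdjoint
      rw [← this, ← star_mul, this, Ring.mul_inverse_cancel C hu, star_one]
    exact congrArg (fun T : H →L[ℂ] H => T w) h1
  have hn : ∀ w, c * ‖w‖ = ‖C w‖ := fun w => by
    have := h (C w)
    rwa [hinv] at this
  -- Over `ℂ` an operator is determined by its quadratic form, and that of `C²` at `w` is `‖C w‖² =
  -- c² ‖w‖²`.
  have hsq : ∀ w, C (C w) = ((c ^ 2 : ℝ) : ℂ) • w := by
    have e : (C * C : H →L[ℂ] H).toLinearMap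
        = (((c ^ 2 : ℝ) : ℂ) • (1 : H →L[ℂ] H)).toLinearMap := by
      rw [← ext_inner_map]
      intro w
      have e1 : ⟪C (C w), w⟫_ℂ = ⟪C w, C w⟫_ℂ := by
        conv_lhs => rw [← hsa]
        rw [ContinuousLinearMap.adjoint_inner_left, hsa]
      have e2 : ⟪((c ^ 2 : ℝ) : ℂ) • w, w⟫_ℂ = ((c ^ 2 : ℝ) : ℂ) * ⟪w, w⟫_ℂ := by
        rw [inner_smul_left, Complex.conj_ofReal]
      refine e1.trans (Eq.trans ?_ e2.symm)
      rw [inner_self_eq_norm_sq_to_K, inner_self_eq_norm_sq_to_K, ← hn w]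
      simp only [Complex.coe_algebraMap]
      push_cast
      ring
    exact fun w => congrArg (fun T : H →ₗ[ℂ] H => T w) e
  ext1 w
  rw [smul_apply, one_apply_eq_self, ← sub_eq_zero]
  -- Since `C² = c²`, the vector `y` satisfies `C y = -c y`; positivity of `C` forces `y = 0`.
  set y := C w - (c : ℂ) • w with hy
  have hCy : C y = -((c : ℂ) • y) := by
    rw [hy, map_sub, map_smul, hsq, smul_sub, smul_smul, neg_sub, ← Complex.ofReal_mul, ← pow_two]
  have h1 : 0 ≤ RCLike.re ⟪C y, y⟫_ℂ := hC.re_inner_nonneg_left y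
  rw [hCy, inner_neg_left, inner_smul_left, Complex.conj_ofReal, inner_self_eq_norm_sq_to_K] at h1
  have h2 : RCLike.re (-((c : ℂ) * ((‖y‖ : ℝ) : ℂ) ^ 2)) = -(c * ‖y‖ ^ 2) := by
    rw [← Complex.ofReal_pow, ← Complex.ofReal_mul, ← Complex.ofReal_neg]
    exact Complex.ofReal_re _
  have h3 : 0 ≤ -(c * ‖y‖ ^ 2) := h2 ▸ h1
  have h4 : ‖y‖ ^ 2 ≤ 0 := by
    by_contra h5
    have := mul_pos hc (not_le.1 h5)
    linarith
  have h5 : ‖y‖ = 0 := by nlinarith [norm_nonneg y]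
  exact norm_eq_zero.1 h5

end RankOne

/-! ### Testing the orthogonality relation on rank-one fields -/

section UniqueOperators

open InnerProductSpace

variable {α β γ l : ℝ}

/-- The field with value `u ⊗ u` on a set. -/
def indicatorField (E : Set (Sector α β γ l)) (u : L2Plane) (x : Sector α β γ l) :
    L2Plane →L[ℂ] L2Plane :=
  E.indicator (fun _ => rankOne ℂ u u) x

theorem indicatorField_mul (E : Set (Sector α β γ l)) (u : L2Plane) (x : Sector α β γ l)
    (D : L2Plane →L[ℂ] L2Plane) : indicatorField E u x * D
      = E.indicator (fun _ => rankOne ℂ u (ContinuousLinearMap.adjoint D u)) x := by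
  by_cases hx : x ∈ E <;> simp [indicatorField, hx, rankOne_mul]

theorem isMeasurableField_indicatorField_mul {E : Set (Sector α β γ l)} (hE : MeasurableSet E)
    (u : L2Plane) {D : Sector α β γ l → L2Plane →L[ℂ] L2Plane} (hD : IsMeasurableField D) :
    IsMeasurableField fun x => indicatorField E u x * D x := by
  intro y z
  have h : ∀ x, ⟪y, (indicatorField E u x * D x) z⟫_ℂ
      = E.indicator (fun x => ⟪u, D x z⟫_ℂ * ⟪y, u⟫_ℂ) x := fun x => by
    by_cases hx : x ∈ E <;> simp [indicatorField, hx, inner_smul_right]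
  simp only [h]
  exact ((hD u z).mul_const _).indicator hE

theorem isMeasurableField_indicatorField {E : Set (Sector α β γ l)} (hE : MeasurableSet E)
    (u : L2Plane) : IsMeasurableField (indicatorField E u) := by
  have h := isMeasurableField_indicatorField_mul hE u
    (D := fun _ => (1 : L2Plane →L[ℂ] L2Plane)) fun _ _ => measurable_const
  simpa only [mul_one] using h

theorem hsNormSq_zero {H : Type*} [NormedAddCommGroup H] [InnerProductSpace ℂ H]
    [CompleteSpace H] : hsNormSq ((0 : H →L[ℂ] H) : H → H) = 0 := by simp [hsNormSq]

theorem traceNorm_zero {H : Type*} [NormedAddCommGroup H] [InnerProductSpace ℂ H] : traceNorm (0 : H →L[ℂ] H) = 0 := by simp [traceNorm]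

theorem hsNormSq_indicatorField_mul (E : Set (Sector α β γ l)) (u : L2Plane)
    (D : Sector α β γ l → L2Plane →L[ℂ] L2Plane) (x : Sector α β γ l) :
    hsNormSq (indicatorField E u x * D x : L2Plane →L[ℂ] L2Plane)
      = E.indicator (fun x => ‖u‖ₑ ^ 2 * ‖ContinuousLinearMap.adjoint (D x) u‖ₑ ^ 2) x := by
  rw [indicatorField_mul]
  by_cases hx : x ∈ E
  · simp only [Set.indicator_of_mem hx, hsNormSq_rankOne]
  · simp only [Set.indicator_of_notMem hx, hsNormSq_zero]

theorem hsNormSq_indicatorField (E : Set (Sector α β γ l)) (u : L2Plane) (x : Sector α β γ l) :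
    hsNormSq (indicatorField E u x) = E.indicator (fun _ => ‖u‖ₑ ^ 2 * ‖u‖ₑ ^ 2) x := by
  by_cases hx : x ∈ E
  · simp only [indicatorField, Set.indicator_of_mem hx, hsNormSq_rankOne]
  · simp only [indicatorField, Set.indicator_of_notMem hx, hsNormSq_zero]

theorem lintegral_indicator_lt_top {X : Type*} [MeasurableSpace X] {μ : Measure X} {E : Set X}
    (hE : MeasurableSet E) (hμ : μ E < ∞) {k : X → ℝ≥0∞} {b : ℝ≥0∞} (hb : b < ∞)
    (hk : ∀ x ∈ E, k x ≤ b) : ∫⁻ x, E.indicator k x ∂μ < ∞ := by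
  refine (lintegral_mono (g := E.indicator fun _ => b) fun x => ?_).trans_lt ?_
  · exact Set.indicator_le_indicator' (hk x)
  · rw [lintegral_indicator_const hE]
    exact ENNReal.mul_lt_top hb hμ

theorem measurable_norm_adjoint {D : Sector α β γ l → L2Plane →L[ℂ] L2Plane}
    (hD : IsMeasurableField D) (u : L2Plane) :
    Measurable fun x => ‖ContinuousLinearMap.adjoint (D x) u‖ := by
  have h1 : Measurable fun x => ‖ContinuousLinearMap.adjoint (D x) u‖ₑ ^ 2 := by
    simp only [← (chosenBasis L2Plane).tsum_enorm_inner_sq]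
    refine Measurable.tsum fun i => ?_
    simp only [ContinuousLinearMap.adjoint_inner_right]
    have h2 : ∀ x, ‖⟪D x (chosenBasis L2Plane i), u⟫_ℂ‖ₑ
        = ‖⟪u, D x (chosenBasis L2Plane i)⟫_ℂ‖ₑ := fun x => by
      rw [← inner_conj_symm, enorm_conj]
    simp only [h2]
    exact (hD _ _).enorm.pow_const 2
  have h3 : ∀ x, ‖ContinuousLinearMap.adjoint (D x) u‖
      = √(‖ContinuousLinearMap.adjoint (D x) u‖ₑ ^ 2).toReal := fun x => by
    rw [ENNReal.toReal_pow, toReal_enorm, Real.sqrt_sq (norm_nonneg _)]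
  simp only [h3]
  exact h1.ennreal_toReal.sqrt

/-- On `E` the product with `C⁻¹` is `u ⊗ (C⁻¹)* u`, so the bound `b` is exactly what controls its
trace norm. -/
theorem isAdmissibleField_indicatorField {C : Sector α β γ l → L2Plane →L[ℂ] L2Plane}
    {ν : Measure (Sector α β γ l)} {E : Set (Sector α β γ l)} (hE : MeasurableSet E)
    (hν : ν E < ∞) (u : L2Plane) {b : ℝ}
    (hb : ∀ x ∈ E, ‖ContinuousLinearMap.adjoint (Ring.inverse (C x)) u‖ ≤ b) :
    IsAdmissibleField ν C (indicatorField E u) where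
  measurable := isMeasurableField_indicatorField hE u
  hilbertSchmidt := by
    simp only [hsNormSq_indicatorField]
    exact lintegral_indicator_lt_top hE hν
      (ENNReal.mul_lt_top (ENNReal.pow_lt_top enorm_lt_top) (ENNReal.pow_lt_top enorm_lt_top))
      fun _ _ => le_rfl
  traceClass := by
    refine (lintegral_mono (g := E.indicator fun _ => ENNReal.ofReal (‖u‖ * b)) fun x => ?_).trans_lt
      (lintegral_indicator_lt_top hE hν ENNReal.ofReal_lt_top fun _ _ => le_rfl)
    rw [indicatorField_mul]
    by_cases hx : x ∈ E
    · simp only [Set.indicator_of_mem hx]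
      exact (traceNorm_rankOne_le _ _).trans
        (ENNReal.ofReal_le_ofReal (mul_le_mul_of_nonneg_left (hb x hx) (norm_nonneg _)))
    · simp only [Set.indicator_of_notMem hx, traceNorm_zero, le_refl]

theorem isTransformableField_indicatorField (hα : α ≠ 0) (m : ℝ)
    {C : Sector α β γ l → L2Plane →L[ℂ] L2Plane}
    (hC : IsMeasurableField fun x => Ring.inverse (C x)) {E : Set (Sector α β γ l)}
    (hE : MeasurableSet E) (hν : sectorPlancherel α β γ l E < ∞) (u : L2Plane) {b : ℝ}
    (hb : ∀ x ∈ E, ‖ContinuousLinearMap.adjoint (Ring.inverse (C x)) u‖ ≤ b) :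
    IsTransformableField hα m fun x => indicatorField E u x * Ring.inverse (C x) where
  measurable := isMeasurableField_indicatorField_mul hE u hC
  hilbertSchmidt := by
    simp only [hsNormSq_indicatorField_mul E u fun x => Ring.inverse (C x)]
    refine lintegral_indicator_lt_top (b := ‖u‖ₑ ^ 2 * ENNReal.ofReal b ^ 2) hE hν
      (ENNReal.mul_lt_top (ENNReal.pow_lt_top enorm_lt_top)
        (ENNReal.pow_lt_top ENNReal.ofReal_lt_top)) fun x hx => ?_
    gcongr
    rw [← ofReal_norm]
    exact ENNReal.ofReal_le_ofReal (hb x hx)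
  summable z v := (lintegral_mono fun x => tsum_enorm_fieldEntry_le hα m _ x z v).trans_lt
    (isAdmissibleField_indicatorField hE hν u hb).traceClass

/-- The orthogonality relation with both fields equal to `u ⊗ u` on `E`. The group side is evaluated
by the isometry of the inverse transform applied to `u ⊗ (C⁻¹)* u`, where the known constant `(2π)⁵`
enters. -/
theorem setIntegral_norm_adjoint_inverse (hα : α ≠ 0) (m : ℝ)
    {C : Sector α β γ l → L2Plane →L[ℂ] L2Plane}
    (h : IsPlancherelPair (GNC.haar α β γ) (fun x : Sector α β γ l => gaugeRep hα m x)
      (sectorPlancherel α β γ l) C) {E : Set (Sector α β γ l)} (hE : MeasurableSet E)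
    (hν : sectorPlancherel α β γ l E < ∞) (u : L2Plane) {b : ℝ}
    (hb : ∀ x ∈ E, ‖ContinuousLinearMap.adjoint (Ring.inverse (C x)) u‖ ≤ b) :
    ∫ x in E, dufloMooreConst ^ 2 * (‖u‖ ^ 2
        * ‖ContinuousLinearMap.adjoint (Ring.inverse (C x)) u‖ ^ 2) ∂(sectorPlancherel α β γ l)
      = ∫ _x in E, ‖u‖ ^ 2 * ‖u‖ ^ 2 ∂(sectorPlancherel α β γ l) := by
  have hA := isAdmissibleField_indicatorField (C := C) hE hν u hb
  have hB := isTransformableField_indicatorField hα m h.measurable_inverse hE hν u hb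
  have h1 := h.orthogonality _ _ hA hA
  simp only [fieldTransform_eq_inverseTransform] at h1
  rw [integral_conj_inverseTransform_mul hB hB] at h1
  simp only [opTrace_star_mul_self, hsNormSq_indicatorField,
    hsNormSq_indicatorField_mul E u fun x => Ring.inverse (C x)] at h1
  rw [integral_complex_ofReal, integral_complex_ofReal, ← Complex.ofReal_mul, Complex.ofReal_inj,
    ← dufloMooreConst_sq] at h1
  have e : ∀ (k : Sector α β γ l → ℝ≥0∞) x,
      (E.indicator k x).toReal = E.indicator (fun x => (k x).toReal) x := fun k x => by
    by_cases hx : x ∈ E <;> simp [hx]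
  simp only [e, ENNReal.toReal_mul, ENNReal.toReal_pow, toReal_enorm] at h1
  rw [integral_indicator hE, integral_indicator hE] at h1
  rw [integral_const_mul, h1]

/-- Integrals over all sets of finite measure determine the integrand. The sets are cut down to
`‖(C⁻¹)* u‖ ≤ n`, where the test fields are admissible, and these regions cover the sector. -/
theorem ae_norm_adjoint_inverse (hα : α ≠ 0) (m : ℝ)
    {C : Sector α β γ l → L2Plane →L[ℂ] L2Plane}
    (h : IsPlancherelPair (GNC.haar α β γ) (fun x : Sector α β γ l => gaugeRep hα m x)
      (sectorPlancherel α β γ l) C) (u : L2Plane) :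
    ∀ᵐ x ∂(sectorPlancherel α β γ l),
      dufloMooreConst * ‖ContinuousLinearMap.adjoint (Ring.inverse (C x)) u‖ = ‖u‖ := by
  have hN := measurable_norm_adjoint h.measurable_inverse u
  have hn : ∀ n : ℕ, ∀ᵐ x ∂(sectorPlancherel α β γ l),
      ‖ContinuousLinearMap.adjoint (Ring.inverse (C x)) u‖ ≤ n →
        dufloMooreConst ^ 2 * (‖u‖ ^ 2
          * ‖ContinuousLinearMap.adjoint (Ring.inverse (C x)) u‖ ^ 2) = ‖u‖ ^ 2 * ‖u‖ ^ 2 := by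
    intro n
    have hS : MeasurableSet
        {x | ‖ContinuousLinearMap.adjoint (Ring.inverse (C x)) u‖ ≤ n} :=
      measurableSet_le hN measurable_const
    refine (ae_restrict_iff' hS).1 ?_
    refine ae_eq_of_forall_setIntegral_eq_of_sigmaFinite (fun E hE hμ => ?_)
      (fun E hE hμ => ?_) fun E hE hμ => ?_
    · rw [Measure.restrict_apply hE] at hμ
      rw [IntegrableOn, Measure.restrict_restrict hE]
      refine IntegrableOn.of_bound hμ (Measurable.aestronglyMeasurable (by fun_prop))
        (dufloMooreConst ^ 2 * (‖u‖ ^ 2 * (n : ℝ) ^ 2)) ?_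
      refine (ae_restrict_iff' (hE.inter hS)).2 (.of_forall fun x hx => ?_)
      rw [Real.norm_of_nonneg (by positivity)]
      gcongr
      exact hx.2
    · exact integrableOn_const hμ.ne
    · rw [Measure.restrict_apply hE] at hμ
      rw [Measure.restrict_restrict hE]
      exact setIntegral_norm_adjoint_inverse hα m h (hE.inter hS) hμ u fun x hx => hx.2
  filter_upwards [ae_all_iff.2 hn] with x hx
  obtain ⟨n, hxn⟩ := exists_nat_ge ‖ContinuousLinearMap.adjoint (Ring.inverse (C x)) u‖
  have e := hx n hxn
  have hc := dufloMooreConst_pos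
  by_cases hu : u = 0
  · simp [hu]
  · have hu' : 0 < ‖u‖ := norm_pos_iff.2 hu
    refine (sq_eq_sq₀ (by positivity) (by positivity)).1 ?_
    refine mul_left_cancel₀ (pow_ne_zero 2 hu'.ne') ?_
    rw [← e]
    ring

/-- The exceptional null set depends on `u`, so a countable dense sequence of vectors is used;
continuity extends the norm identity to all `u`, and positivity makes `C x` scalar. -/
theorem ae_eq_smul_one_of_isPlancherelPair (hα : α ≠ 0) (m : ℝ)
    {C : Sector α β γ l → L2Plane →L[ℂ] L2Plane}
    (h : IsPlancherelPair (GNC.haar α β γ) (fun x : Sector α β γ l => gaugeRep hα m x)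
      (sectorPlancherel α β γ l) C) :
    ∀ᵐ x ∂(sectorPlancherel α β γ l), C x = (dufloMooreConst : ℂ) • (1 : L2Plane →L[ℂ] L2Plane) := by
  have hd : ∀ᵐ x ∂(sectorPlancherel α β γ l), ∀ n : ℕ, dufloMooreConst
      * ‖ContinuousLinearMap.adjoint (Ring.inverse (C x)) (TopologicalSpace.denseSeq L2Plane n)‖
      = ‖TopologicalSpace.denseSeq L2Plane n‖ :=
    ae_all_iff.2 fun n => ae_norm_adjoint_inverse hα m h _
  filter_upwards [hd, h.positive] with x hx hC
  refine hC.1.eq_smul_one hC.2 dufloMooreConst_pos fun u => ?_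
  refine congrFun (Continuous.ext_on (TopologicalSpace.denseRange_denseSeq L2Plane)
    (f := fun u => dufloMooreConst * ‖ContinuousLinearMap.adjoint (Ring.inverse (C x)) u‖)
    (g := fun u => ‖u‖) (by fun_prop) (by fun_prop) ?_) u
  rintro _ ⟨n, rfl⟩
  exact hx n

end UniqueOperators

end

theorem mainTheorem2 (α β γ : ℝ) (hα : α ≠ 0) (l m : ℝ) :
    -- the stated measure and the stated operators form a Plancherel pair
    IsPlancherelPair (GNC.haar α β γ) (fun x : Sector α β γ l => gaugeRep hα m x)
      (sectorPlancherel α β γ l)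
      (fun _ => (((2 * Real.pi) ^ (5 / 2 : ℝ) : ℝ) : ℂ) • (1 : L2Plane →L[ℂ] L2Plane)) ∧
    -- the measure is determined by the operators
    (∀ ν : Measure (Sector α β γ l),
      IsPlancherelPair (GNC.haar α β γ) (fun x : Sector α β γ l => gaugeRep hα m x) ν
        (fun _ => (((2 * Real.pi) ^ (5 / 2 : ℝ) : ℝ) : ℂ) • (1 : L2Plane →L[ℂ] L2Plane)) →
      ν = sectorPlancherel α β γ l) ∧
    -- the operators are determined by the measure
    (∀ C : Sector α β γ l → L2Plane →L[ℂ] L2Plane,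
      IsPlancherelPair (GNC.haar α β γ) (fun x : Sector α β γ l => gaugeRep hα m x)
        (sectorPlancherel α β γ l) C →
      ∀ᵐ x ∂(sectorPlancherel α β γ l),
        C x = (((2 * Real.pi) ^ (5 / 2 : ℝ) : ℝ) : ℂ) • (1 : L2Plane →L[ℂ] L2Plane)) :=
  ⟨isPlancherelPair_sectorPlancherel hα m,
    fun _ h => eq_sectorPlancherel_of_isPlancherelPair hα m h,
    fun _ h => ae_eq_smul_one_of_isPlancherelPair hα m h⟩
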